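/- Let $\mathcal S=(\mathcal P,\mathcal L,\mathrm I)$ be a finite generalized quadrangle of order $(s,t)$ with $s,t\ge 1$ and $(s,t)\ne(1,1)$: every point is on $t+1$ lines, every line has $s+1$ points, two distinct points are on at most one line (so two distinct lines share at most one point), and for every non-incident point-line pair $(p,L)$ there is a unique pair $(q,M)$ with $p\,\mathrm I\,M\,\mathrm I\,q\,\mathrm I\,L$. Let $\Omega$ be the set of flags (incident point-line pairs). For $x=(p,L)$ and $y=(q,M)$ in $\Omega$ define: - $R_0$: $x=y$; - $R_1$: $p=q$, $L\ne M$; - $R_2$: $L=M$, $p\neq q$; - $R_3$: $L\ne M$, $p\ne q$, $q\,\mathrm I\,L$; - $R_4$: $L\ne M$, $p\neq q$, $p\,\mathrm I\,M$; - $R_5$: $p\ne q$ are collinear on a line different from $L$ and $M$; - $R_6$: $L\neq M$ meet in a point different from $p$ and $q$; - $R_7$: $L$ and $M$ have no common point and $p$ and $q$ are not collinear. For $\Lambda\subseteq\{1,\dots,7\}$ write $R_\Lambda=\bigcup_{i\in\Lambda}R_i$. A partition $\pi$ of $\{1,\dots,7\}$ with at least two blocks, and different from the partition into singletons, is called a *non-trivial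 fusion* if $\{R_0\}\cup\{R_\Lambda:\Lambda\in\pi\}$ is an association scheme on $\Omega$ (not necessarily symmetric or commutative). Let $\pi^D$ be the image of $\pi$ under the index permutation $(1\,2)(3\,4)(5\,6)$, which expresses point-line duality. Consider the following table. 1. $\{1,2,3,4,7\},\{5,6\}$ for $s=t=2$; 2. $\{1,3,4,6\},\{2,5,7\}$ for $t=1$, any $s$; 3. $\{1,2,3,4,6,7\},\{5\}$ for $t=1$, any $s$; 4. $\{1\},\{2,3,4,5,6,7\}$ for all $s,t$; 5. $\{1,2,7\},\{3,4\},\{5,6\}$ for $s=t=2$; 6. $\{1\},\{2,5,6\},\{3,4,7\}$ for $s=3$, $t=1$; 7. $\{1,6\},\{2,5,7\},\{3,4\}$ for $s=3$, $t=1$; 8. $\{1\},\{2,5,7\},\{3,4,6\}$ for $t=1$, any $s$; 9. $\{1,3,4,6\},\{2,5\},\{7\}$ for $t=1$, any $s$; 10. $\{1,3,4,6\},\{2,7\},\{5\}$ for $t=1$, any $s$; 11. $\{1\},\{2,3,4,5\},\{6,7\}$ for all $s,t$; 12. $\{1,2\},\{3,4\},\{5,6\},\{7\}$ for $s=t$;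 13. $\{1,3,4,6\},\{2\},\{5\},\{7\}$ for $t=1$, any $s$; 14. $\{1\},\{2,5\},\{3,4\},\{6\},\{7\}$ for $t=1$, any $s$. (a) A partition $\pi$ of $\{1,\dots,7\}$ is a non-trivial fusion if and only if $\pi$ is in the table with $(s,t)$ among its listed values, or $\pi^D$ is in the table with $(t,s)$ among its listed values. (b) No non-trivial fusion has both $\{3\}$ and $\{4\}$ as blocks. (c) For the listed values of $s$ and $t$, the fusions in lines 1–12 are identified, up to isomorphism, as follows. - Line 1: $(\Omega,R_{\{1,2,3,4,7\}})$ is the point graph of a partial geometry $pg(4,6,3)$ ($5$ points on each line, $7$ lines on each point, and for a point $p$ not on a line $L$ exactly $3$ lines on $p$ meeting $L$). - Line 2: $(\Omega,R_{\{2,5,7\}})$ is $2K_{(s+1)^2}$. - Line 3: $(\Omega,R_{\{5\}})$ is $2(s+1)K_{s+1}$. - Line 4: $(\Omega,R_{\{1\}})$ is $(st+1)(s+1)K_{t+1}$. - Line 5: $(\Omega,R_{\{3,4\}})$ is the subgraph induced by the Gewirtz graph (the strongly regular graph with parameters $(56,10,0,2)$) on the vertices at distance two from a vertex. In it, $R_{\{5,6\}}$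 and $R_{\{1,2,7\}}$ are the pairs of distinct non-adjacent vertices with exactly one, respectively exactly two, common neighbours. - Line 6: $R_{\{2,5,6\}},R_{\{3,4,7\}},R_{\{1\}}$ are the distance-$1$, $2$, $3$ relations of the halved $6$-cube. - Line 7: $R_{\{3,4\}},R_{\{2,5,7\}},R_{\{1,6\}}$ are the distance-$1$, $2$, $3$ relations of the folded $6$-cube. - Line 8: the fusion is the rectangular scheme $R(2,(s+1)^2)$ on the cells of a $2\times(s+1)^2$ grid, with $R_{\{2,5,7\}}$ "same row", $R_{\{1\}}$ "same column" and $R_{\{3,4,6\}}$ "different row and column". - Line 9: $(\Omega,R_{\{2,5\}})$ is the disjoint union of two Hamming graphs $H(2,s+1)$, $R_{\{7\}}$ consists of the pairs at distance two in the same copy, and $R_{\{1,3,4,6\}}$ of the pairs in different copies. - Line 10: for some strongly regular graph with parameters $(2(s+1),s+1,0,s+1)$ and adjacency matrix $A$, the relations $R_{\{1,3,4,6\}},R_{\{2,7\}},R_{\{5\}}$ have adjacency matrices $A\otimes J_{s+1}$, $(J-I-A)\otimes J_{s+1}$, $I\otimes(J_{s+1}-I)$. - Line 11: for some strongly regular graph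 with parameters $((st+1)(s+1),s(t+1),s-1,t+1)$ and adjacency matrix $A$, the relations $R_{\{2,3,4,5\}},R_{\{6,7\}},R_{\{1\}}$ have adjacency matrices $A\otimes J_{t+1}$, $(J-I-A)\otimes J_{t+1}$, $I\otimes(J_{t+1}-I)$. - Line 12: $(\Omega,R_{\{1,2\}})$ is the point graph of the dual of the double $(\mathcal P\cup\mathcal L,\Omega,\in)$ of $\mathcal S$. -/

import Mathlib

/-! ### Incidence structures and generalized quadrangles

An incidence structure with point set `P` and line set `L` is given by its incidence relation
`I : P → L → Prop`. -/

/-- `I` is the incidence relation of a finite generalized quadrangle of order `(s, t)`. -/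
structure IsGQ {P L : Type*} (I : P → L → Prop) (s t : ℕ) : Prop where
  finite_points : Finite P
  finite_lines : Finite L
  nonempty_points : Nonempty P
  nonempty_lines : Nonempty L
  /-- Each point is on `t + 1` lines. -/
  lines_on_point : ∀ p, {l | I p l}.ncard = t + 1
  /-- Two distinct points are on at most one common line. -/
  line_unique : ∀ p q, p ≠ q → ∀ l m, I p l → I q l → I p m → I q m → l = m
  /-- Each line has `s + 1` points. -/
  points_on_line : ∀ l, {p | I p l}.ncard = s + 1
  /-- Two distinct lines have at most one common point. -/
  point_unique : ∀ l m, l ≠ m → ∀ p q, I p l → I p m → I q l → I q m → p = q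
  /-- For a non-incident pair `(p, l)` there is a unique `(q, m)` with `p I m I q I l`. -/
  antiflag : ∀ p l, ¬ I p l → ∃! x : P × L, I p x.2 ∧ I x.1 x.2 ∧ I x.1 l

/-- `I` is the incidence relation of a finite partial geometry `pg(s, t, α)`. -/
structure IsPartialGeometry {P L : Type*} (I : P → L → Prop) (s t α : ℕ) : Prop where
  finite_points : Finite P
  finite_lines : Finite L
  nonempty_points : Nonempty P
  nonempty_lines : Nonempty L
  lines_on_point : ∀ p, {l | I p l}.ncard = t + 1
  line_unique : ∀ p q, p ≠ q → ∀ l m, I p l → I q l → I p m → I q m → l = m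
  points_on_line : ∀ l, {p | I p l}.ncard = s + 1
  antiflag : ∀ p l, ¬ I p l →
    {x : P × L | I p x.2 ∧ I x.1 x.2 ∧ I x.1 l}.ncard = α

/-- The point graph of an incidence structure: distinct points are adjacent when collinear. -/
def pointGraph {P L : Type*} (I : P → L → Prop) : SimpleGraph P where
  Adj p q := p ≠ q ∧ ∃ l, I p l ∧ I q l
  symm := ⟨fun _ _ h => ⟨h.1.symm, h.2.imp fun _ hl => hl.symm⟩⟩
  loopless := ⟨fun _ h => h.1 rfl⟩

/-- The flags (incident point-line pairs). -/
abbrev IncFlag {P L : Type*} (I : P → L → Prop) : Type _ := {x : P × L // I x.1 x.2}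

/-- The dual incidence structure, whose points are the lines and whose lines are the points. -/
def dualInc {P L : Type*} (I : P → L → Prop) : L → P → Prop := fun l p => I p l

/-- The double of an incidence structure: its points are the points and the lines of `I`, its lines
are the flags of `I`, and incidence is membership. -/
def doubleInc {P L : Type*} (I : P → L → Prop) : P ⊕ L → IncFlag I → Prop
  | Sum.inl p, f => f.1.1 = p
  | Sum.inr l, f => f.1.2 = l

/-! ### Association schemes -/

/-- `(X, 𝓡)` is an association scheme (not necessarily symmetric or commutative). -/
structure IsAssociationScheme {X : Type*} (𝓡 : Set (Set (X × X))) : Prop where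
  finite : Finite X
  /-- The relations are non-empty and partition `X × X`. -/
  partition : Setoid.IsPartition 𝓡
  diagonal : Set.diagonal X ∈ 𝓡
  converse : ∀ R ∈ 𝓡, {z : X × X | (z.2, z.1) ∈ R} ∈ 𝓡
  intersection_number : ∀ A ∈ 𝓡, ∀ B ∈ 𝓡, ∀ C ∈ 𝓡, ∃ c : ℕ, ∀ x y, (x, y) ∈ C →
    {z | (x, z) ∈ A ∧ (z, y) ∈ B}.ncard = c

/-! ### The relations on flags and the fusions of the flag scheme -/

/-- The relations `R₀, …, R₇` on the flags; `x = (p, L)` and `y = (q, M)`. -/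
def flagRel {P L : Type*} (I : P → L → Prop) (i : Fin 8) (x y : IncFlag I) : Prop :=
  match i with
  | 0 => x = y
  | 1 => x.1.1 = y.1.1 ∧ x.1.2 ≠ y.1.2
  | 2 => x.1.2 = y.1.2 ∧ x.1.1 ≠ y.1.1
  | 3 => x.1.2 ≠ y.1.2 ∧ x.1.1 ≠ y.1.1 ∧ I y.1.1 x.1.2
  | 4 => x.1.2 ≠ y.1.2 ∧ x.1.1 ≠ y.1.1 ∧ I x.1.1 y.1.2
  | 5 => x.1.1 ≠ y.1.1 ∧ ∃ n, I x.1.1 n ∧ I y.1.1 n ∧ n ≠ x.1.2 ∧ n ≠ y.1.2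
  | 6 => x.1.2 ≠ y.1.2 ∧ ∃ r, I r x.1.2 ∧ I r y.1.2 ∧ r ≠ x.1.1 ∧ r ≠ y.1.1
  | 7 => (¬ ∃ r, I r x.1.2 ∧ I r y.1.2) ∧ ¬ ∃ n, I x.1.1 n ∧ I y.1.1 n

/-- The union of the relations `R i` with `i ∈ A`. -/
def classRel {P L : Type*} (I : P → L → Prop) (A : Finset (Fin 8)) (x y : IncFlag I) : Prop :=
  ∃ i ∈ A, flagRel I i x y

/-- The partition `π` of `{1, …, 7}` gives a non-trivial fusion of the flag scheme: `π` has at least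
two blocks, it is not the partition into singletons, and `R₀` together with the unions of the
relations over the blocks of `π` forms an association scheme. -/
def IsFusion {P L : Type*} (I : P → L → Prop) (π : Finpartition ({0}ᶜ : Finset (Fin 8))) : Prop :=
  2 ≤ π.parts.card ∧ (∃ A ∈ π.parts, 1 < A.card) ∧
    IsAssociationScheme
      {S : Set (IncFlag I × IncFlag I) |
        ∃ A ∈ insert {0} π.parts, S = {z | classRel I A z.1 z.2}}

/-- The action of point-line duality on the indices: `1 ↔ 2`, `3 ↔ 4`, `5 ↔ 6`, `7 ↔ 7`. -/
def dualIndex : Fin 8 → Fin 8 := ![0, 2, 1, 4, 3, 6, 5, 7]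

/-- The image of a family of blocks under point-line duality. -/
def dualBlocks (Λ : Finset (Finset (Fin 8))) : Finset (Finset (Fin 8)) :=
  Λ.image fun A => A.image dualIndex

/-- The fourteen partitions, each with the feasible values of `s` and `t`. -/
def InFusionTable (s t : ℕ) (Λ : Finset (Finset (Fin 8))) : Prop :=
  (Λ = {{1, 2, 3, 4, 7}, {5, 6}} ∧ s = 2 ∧ t = 2) ∨
  (Λ = {{1, 3, 4, 6}, {2, 5, 7}} ∧ t = 1) ∨
  (Λ = {{1, 2, 3, 4, 6, 7}, {5}} ∧ t = 1) ∨
  (Λ = {{1}, {2, 3, 4, 5, 6, 7}}) ∨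
  (Λ = {{1, 2, 7}, {3, 4}, {5, 6}} ∧ s = 2 ∧ t = 2) ∨
  (Λ = {{1}, {2, 5, 6}, {3, 4, 7}} ∧ s = 3 ∧ t = 1) ∨
  (Λ = {{1, 6}, {2, 5, 7}, {3, 4}} ∧ s = 3 ∧ t = 1) ∨
  (Λ = {{1}, {2, 5, 7}, {3, 4, 6}} ∧ t = 1) ∨
  (Λ = {{1, 3, 4, 6}, {2, 5}, {7}} ∧ t = 1) ∨
  (Λ = {{1, 3, 4, 6}, {2, 7}, {5}} ∧ t = 1) ∨
  (Λ = {{1}, {2, 3, 4, 5}, {6, 7}}) ∨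
  (Λ = {{1, 2}, {3, 4}, {5, 6}, {7}} ∧ s = t) ∨
  (Λ = {{1, 3, 4, 6}, {2}, {5}, {7}} ∧ t = 1) ∨
  (Λ = {{1}, {2, 5}, {3, 4}, {6}, {7}} ∧ t = 1)

/-! ### The graphs and schemes of the table -/

/-- `m Kₙ`, the disjoint union of `m` complete graphs of size `n`. -/
def disjointCompletes (m n : ℕ) : SimpleGraph (Fin m × Fin n) where
  Adj x y := x.1 = y.1 ∧ x.2 ≠ y.2
  symm := ⟨fun _ _ h => ⟨h.1.symm, h.2.symm⟩⟩
  loopless := ⟨fun _ h => h.2 rfl⟩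

/-- The halved `n`-cube: words of length `n` and even weight, adjacent at Hamming distance two. -/
def halvedCube (n : ℕ) :
    SimpleGraph {x : Fin n → Bool // Even (Finset.univ.filter fun i => x i = true).card} where
  Adj x y := hammingDist x.1 y.1 = 2
  symm := ⟨fun x y h => by rw [hammingDist_comm]; exact h⟩
  loopless := ⟨fun x h => by simp at h⟩

/-- The folded `(n + 1)`-cube: the `n`-cube with the pairs of opposite vertices added as edges. -/
def foldedCube (n : ℕ) : SimpleGraph (Fin n → Bool) where
  Adj x y := x ≠ y ∧ (hammingDist x y = 1 ∨ hammingDist x y = n)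
  symm := ⟨fun x y h => ⟨h.1.symm, by rw [hammingDist_comm]; exact h.2⟩⟩
  loopless := ⟨fun _ h => h.1 rfl⟩

/-- The Gewirtz graph is the unique strongly regular graph with parameters `(56, 10, 0, 2)`. -/
def IsGewirtz (G : SimpleGraph (Fin 56)) : Prop :=
  ∃ _ : DecidableRel G.Adj, G.IsSRGWith 56 10 0 2

/-- The vertices of the second subconstituent of `G` at `v` (for a graph of diameter two): the
vertices distinct from `v` and not adjacent to `v`. -/
abbrev SecondSubconstituent {V : Type*} (G : SimpleGraph V) (v : V) : Type _ :=
  {w : V // w ≠ v ∧ ¬ G.Adj v w}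

/-- The relations `R₁, R₂, R₃` on `X` are, up to a bijection, the distance-one, distance-two and
distance-three relations of the graph `Γ`. -/
def IsDistanceScheme {X V : Type*} (Γ : SimpleGraph V) (R₁ R₂ R₃ : X → X → Prop) : Prop :=
  ∃ e : X ≃ V, ∀ x y,
    (R₁ x y ↔ Γ.dist (e x) (e y) = 1) ∧
    (R₂ x y ↔ Γ.dist (e x) (e y) = 2) ∧
    (R₃ x y ↔ Γ.dist (e x) (e y) = 3)

/-- The relations `R₁, R₂, R₃` on `X` are, up to a bijection, those of the rectangular scheme
`R(m, n)`: same row, same column, and neither. -/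
def IsRectangular {X : Type*} (m n : ℕ) (R₁ R₂ R₃ : X → X → Prop) : Prop :=
  ∃ e : X ≃ Fin m × Fin n, ∀ x y,
    (R₁ x y ↔ (e x).1 = (e y).1 ∧ (e x).2 ≠ (e y).2) ∧
    (R₂ x y ↔ (e x).1 ≠ (e y).1 ∧ (e x).2 = (e y).2) ∧
    (R₃ x y ↔ (e x).1 ≠ (e y).1 ∧ (e x).2 ≠ (e y).2)

/-- The relations `R₁, R₂, R₃` on `X` are, up to a bijection, those of the scheme of the disjoint
union of `m` copies of the Hamming graph `H(2, n)`: adjacent, non-adjacent in the same copy, and in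
different copies. -/
def IsDisjointHamming {X : Type*} (m n : ℕ) (R₁ R₂ R₃ : X → X → Prop) : Prop :=
  ∃ e : X ≃ Fin m × (Fin 2 → Fin n), ∀ x y,
    (R₁ x y ↔ (e x).1 = (e y).1 ∧ hammingDist (e x).2 (e y).2 = 1) ∧
    (R₂ x y ↔ (e x).1 = (e y).1 ∧ hammingDist (e x).2 (e y).2 = 2) ∧
    (R₃ x y ↔ (e x).1 ≠ (e y).1)

/-- The relations `R₁, R₂, R₃` on `X` are, up to a bijection, those of the scheme
`SRG(v, k, l, m) ⊗ Jₙ`: with `A` the adjacency matrix of some strongly regular graph with these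
parameters, they have the adjacency matrices `A ⊗ J`, `(J - I - A) ⊗ J` and `I ⊗ (J - I)`. -/
def IsSRGTensorJ {X : Type*} (v k l m n : ℕ) (R₁ R₂ R₃ : X → X → Prop) : Prop :=
  ∃ (Γ : SimpleGraph (Fin v)) (_ : DecidableRel Γ.Adj) (e : X ≃ Fin v × Fin n),
    Γ.IsSRGWith v k l m ∧ ∀ x y,
      (R₁ x y ↔ Γ.Adj (e x).1 (e y).1) ∧
      (R₂ x y ↔ (e x).1 ≠ (e y).1 ∧ ¬ Γ.Adj (e x).1 (e y).1) ∧
      (R₃ x y ↔ (e x).1 = (e y).1 ∧ (e x).2 ≠ (e y).2)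

/-- The relations `R₁, R₂, R₃` on `X` are, up to a bijection, those of the scheme of the second
subconstituent of the Gewirtz graph at a vertex: adjacent pairs, and the pairs having exactly one,
respectively (distinct and non-adjacent with) exactly two, common neighbours in it. -/
def IsGewirtzSubconstituent {X : Type*} (R₁ R₂ R₃ : X → X → Prop) : Prop :=
  ∃ (G : SimpleGraph (Fin 56)) (v : Fin 56) (e : X ≃ SecondSubconstituent G v),
    IsGewirtz G ∧ ∀ x y,
      (R₁ x y ↔ G.Adj (e x).1 (e y).1) ∧
      (R₂ x y ↔ x ≠ y ∧ ¬ G.Adj (e x).1 (e y).1 ∧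
        {z : SecondSubconstituent G v | G.Adj (e x).1 z.1 ∧ G.Adj z.1 (e y).1}.ncard = 1) ∧
      (R₃ x y ↔ x ≠ y ∧ ¬ G.Adj (e x).1 (e y).1 ∧
        {z : SecondSubconstituent G v | G.Adj (e x).1 z.1 ∧ G.Adj z.1 (e y).1}.ncard = 2)

/-!
The proof turns on the fact that the adjacency matrices `A₀, …, A₇` of the relations on flags
multiply like the standard basis of the Hecke algebra of type `B₂` with parameters `t` and `s`
(`IsGQ.flagMatrix_mul`): each `Aᵢ` is a product of `A₁` and `A₂` along a reduced word, since a
generalized quadrangle has no triangles, and `A₁`, `A₂` satisfy quadratic relations. The structure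
constants are thus explicit polynomials in `s` and `t`, and a partition is a fusion if and only if
it is compatible with taking converses and the structure constants of its blocks are constant on
the blocks (`IsGQ.isFusion_iff`).

For part (a) this numerical condition is decided for all parameters at once. The range of `(s, t)`
is cut into twelve pieces: a few single pairs, and families in which `s` and `t` are polynomials
with natural coefficients in at most two natural variables. On each piece, every partition in the
table passes because the required identities hold between polynomials, and every other partition
compatible with converses fails because some two structure constants that should agree differ by a
polynomial with coefficients of one sign and a non-zero constant term, or because it is trivial.
The comparison is a boolean computation with lists of coefficients (`tableCorrect`), carried out by
the kernel, and `Evaluation` records that it is sound. Part (b) is then read off from the table.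

For part (c), the fusions that exist for all `s` and `t` only forget the line, or are described by
equality of points and lines. When `t = 1` the lines fall into two parallel classes, the
quadrangle is a grid, and each relation is determined by equalities between grid coordinates
(`IsGQ.exists_grid_coordinates`); for `s = 3` the vertices of the halved and folded cubes are
written down in these coordinates.

When `s = t = 2` the quadrangle is unique (`IsGQ.exists_doily_coordinates`): two disjoint lines span
a `3 × 3` grid, the six further points are the bijections from its rows to its columns, and the
flags correspond to the `45` edges of the complete graph `K₁₀` so that `R₅ ∪ R₆` means sharing one
vertex. Adjoining the ten vertices, and one vertex joined to all of these, to the graph `R₃ ∪ R₄`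
gives the Gewirtz graph. The complement of `R₅ ∪ R₆` is disjointness of edges, and `63` perfect
matchings of `K₁₀` that come from the involutions of `PSL(2, 8)` are the lines of the partial
geometry.
-/

/-! ### Generalized quadrangles and the relations on their flags -/

namespace IsGQ

variable {P L : Type*} {I : P → L → Prop} {s t : ℕ}

/-- A generalized quadrangle has no triangles. -/
theorem no_triangle (h : IsGQ I s t) {p q r : P} {l m n : L} (hpl : ¬ I p l) (hql : I q l)
    (hrl : I r l) (hpm : I p m) (hqm : I q m) (hpn : I p n) (hrn : I r n) : q = r ∧ m = n := by
  have := (h.antiflag p l hpl).unique (y₁ := (q, m)) (y₂ := (r, n)) ⟨hpm, hqm, hql⟩ ⟨hpn, hrn, hrl⟩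
  simpa using this

theorem exists_proj (h : IsGQ I s t) {p : P} {l : L} (hpl : ¬ I p l) :
    ∃ q m, I p m ∧ I q m ∧ I q l := by
  obtain ⟨⟨q, m⟩, hx, -⟩ := h.antiflag p l hpl
  exact ⟨q, m, hx⟩

/-- The dual of a generalized quadrangle of order `(s, t)` is one of order `(t, s)`. -/
theorem dual (h : IsGQ I s t) : IsGQ (dualInc I) t s where
  finite_points := h.finite_lines
  finite_lines := h.finite_points
  nonempty_points := h.nonempty_lines
  nonempty_lines := h.nonempty_points
  lines_on_point := h.points_on_line
  line_unique l m hlm p q hp hp' hq hq' := h.point_unique l m hlm p q hp hp' hq hq'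
  points_on_line := h.lines_on_point
  point_unique p q hpq l m hl hl' hm hm' := h.line_unique p q hpq l m hl hl' hm hm'
  antiflag l p hpl := by
    obtain ⟨⟨q, m⟩, ⟨h1, h2, h3⟩, hu⟩ := h.antiflag p l hpl
    refine ⟨(m, q), ⟨h3, h2, h1⟩, ?_⟩
    rintro ⟨m', q'⟩ ⟨h1', h2', h3'⟩
    have := hu (q', m') ⟨h3', h2', h1'⟩
    simp only [Prod.mk.injEq] at this ⊢
    exact ⟨this.2, this.1⟩

theorem flagRel_five_iff (h : IsGQ I s t) (x y : IncFlag I) :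
    flagRel I 5 x y ↔ ¬ I y.1.1 x.1.2 ∧ ¬ I x.1.1 y.1.2 ∧ ∃ n, I x.1.1 n ∧ I y.1.1 n := by
  obtain ⟨⟨p, l⟩, hx⟩ := x
  obtain ⟨⟨q, m⟩, hy⟩ := y
  change I p l at hx
  change I q m at hy
  change (p ≠ q ∧ ∃ n, I p n ∧ I q n ∧ n ≠ l ∧ n ≠ m) ↔ ¬ I q l ∧ ¬ I p m ∧ ∃ n, I p n ∧ I q n
  constructor
  · rintro ⟨hpq, n, hpn, hqn, hnl, hnm⟩
    exact ⟨fun hql => hnl (h.line_unique p q hpq _ _ hpn hqn hx hql),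
      fun hpm => hnm (h.line_unique p q hpq _ _ hpn hqn hpm hy), n, hpn, hqn⟩
  · rintro ⟨hql, hpm, n, hpn, hqn⟩
    refine ⟨?_, n, hpn, hqn, ?_, ?_⟩
    · rintro rfl; exact hql hx
    · rintro rfl; exact hql hqn
    · rintro rfl; exact hpm hpn

theorem flagRel_six_iff (h : IsGQ I s t) (x y : IncFlag I) :
    flagRel I 6 x y ↔ ¬ I y.1.1 x.1.2 ∧ ¬ I x.1.1 y.1.2 ∧ ∃ r, I r x.1.2 ∧ I r y.1.2 := by
  obtain ⟨⟨p, l⟩, hx⟩ := x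
  obtain ⟨⟨q, m⟩, hy⟩ := y
  change I p l at hx
  change I q m at hy
  change (l ≠ m ∧ ∃ r, I r l ∧ I r m ∧ r ≠ p ∧ r ≠ q) ↔ ¬ I q l ∧ ¬ I p m ∧ ∃ r, I r l ∧ I r m
  constructor
  · rintro ⟨hlm, r, hrl, hrm, hrp, hrq⟩
    exact ⟨fun hql => hrq (h.point_unique l m hlm _ _ hrl hrm hql hy),
      fun hpm => hrp (h.point_unique l m hlm _ _ hrl hrm hx hpm), r, hrl, hrm⟩
  · rintro ⟨hql, hpm, r, hrl, hrm⟩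
    refine ⟨?_, r, hrl, hrm, ?_, ?_⟩
    · rintro rfl; exact hpm hx
    · rintro rfl; exact hpm hrm
    · rintro rfl; exact hql hrl

/-- The relations `R₀, …, R₇` partition the pairs of flags. -/
theorem existsUnique_flagRel (h : IsGQ I s t) (x y : IncFlag I) : ∃! i, flagRel I i x y := by
  have h5 := h.flagRel_five_iff x y
  have h6 := h.flagRel_six_iff x y
  have h0 : flagRel I 0 x y ↔ x.1.1 = y.1.1 ∧ x.1.2 = y.1.2 :=
    ⟨fun e => by cases e; exact ⟨rfl, rfl⟩, fun e => Subtype.ext (Prod.ext e.1 e.2)⟩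
  have h1 : flagRel I 1 x y ↔ x.1.1 = y.1.1 ∧ ¬ x.1.2 = y.1.2 := Iff.rfl
  have h2 : flagRel I 2 x y ↔ x.1.2 = y.1.2 ∧ ¬ x.1.1 = y.1.1 := Iff.rfl
  have h3 : flagRel I 3 x y ↔ ¬ x.1.2 = y.1.2 ∧ ¬ x.1.1 = y.1.1 ∧ I y.1.1 x.1.2 := Iff.rfl
  have h4 : flagRel I 4 x y ↔ ¬ x.1.2 = y.1.2 ∧ ¬ x.1.1 = y.1.1 ∧ I x.1.1 y.1.2 := Iff.rfl
  have h7 : flagRel I 7 x y ↔ (¬ ∃ r, I r x.1.2 ∧ I r y.1.2) ∧ ¬ ∃ n, I x.1.1 n ∧ I y.1.1 n :=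
    Iff.rfl
  have e1 : x.1.1 = y.1.1 → I x.1.1 y.1.2 ∧ I y.1.1 x.1.2 := fun e =>
    ⟨by rw [e]; exact y.2, by rw [← e]; exact x.2⟩
  have e2 : x.1.2 = y.1.2 → I x.1.1 y.1.2 ∧ I y.1.1 x.1.2 := fun e =>
    ⟨by rw [← e]; exact x.2, by rw [e]; exact y.2⟩
  have e3 : I y.1.1 x.1.2 → (∃ r, I r x.1.2 ∧ I r y.1.2) ∧ ∃ n, I x.1.1 n ∧ I y.1.1 n := fun e =>
    ⟨⟨_, e, y.2⟩, _, x.2, e⟩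
  have e4 : I x.1.1 y.1.2 → (∃ r, I r x.1.2 ∧ I r y.1.2) ∧ ∃ n, I x.1.1 n ∧ I y.1.1 n := fun e =>
    ⟨⟨_, x.2, e⟩, _, e, y.2⟩
  have e5 : I y.1.1 x.1.2 → I x.1.1 y.1.2 → x.1.1 = y.1.1 ∨ x.1.2 = y.1.2 := fun a b =>
    or_iff_not_imp_left.2 fun e => h.line_unique _ _ e _ _ x.2 a b y.2
  have e6 : (∃ r, I r x.1.2 ∧ I r y.1.2) → (∃ n, I x.1.1 n ∧ I y.1.1 n) →
      I y.1.1 x.1.2 ∨ I x.1.1 y.1.2 := by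
    rintro ⟨r, hrl, hrm⟩ ⟨n, hpn, hqn⟩
    by_contra! hcon
    have := h.no_triangle hcon.1 x.2 hrl hqn hpn y.2 hrm
    exact hcon.2 (by rw [this.1]; exact hrm)
  generalize (x.1.1 = y.1.1) = a at *
  generalize (x.1.2 = y.1.2) = b at *
  generalize I y.1.1 x.1.2 = c at *
  generalize I x.1.1 y.1.2 = d at *
  generalize (∃ r, I r x.1.2 ∧ I r y.1.2) = e at *
  generalize (∃ n, I x.1.1 n ∧ I y.1.1 n) = f at *
  simp only [ExistsUnique, Fin.exists_fin_succ, Fin.forall_fin_succ]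
  simp only [Fin.isValue, Fin.succ_zero_eq_one, Fin.succ_one_eq_two, Fin.reduceSucc,
    IsEmpty.forall_iff, IsEmpty.exists_iff, h0, h1, h2, h3, h4, h5, h6, h7, Fin.reduceEq]
  clear h0 h1 h2 h3 h4 h5 h6 h7
  by_cases a <;> by_cases b <;> by_cases c <;> by_cases d <;> by_cases e <;> by_cases f <;>
    simp_all

theorem flagRel_inj (h : IsGQ I s t) {x y : IncFlag I} {i j : Fin 8} (hi : flagRel I i x y)
    (hj : flagRel I j x y) : i = j :=
  (h.existsUnique_flagRel x y).unique hi hj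

theorem finite_flags (h : IsGQ I s t) : Finite (IncFlag I) :=
  have := h.finite_points
  have := h.finite_lines
  inferInstance

end IsGQ

/-- The interchange of `3` and `4`, the effect of taking converses on the relations. -/
def converseIndex : Fin 8 → Fin 8 := ![0, 1, 2, 4, 3, 5, 6, 7]

theorem flagRel_converse {P L : Type*} (I : P → L → Prop) (i : Fin 8) (x y : IncFlag I) :
    flagRel I i x y ↔ flagRel I (converseIndex i) y x := by
  fin_cases i
  · exact eq_comm
  · exact and_congr eq_comm ne_comm
  · exact and_congr eq_comm ne_comm
  · exact and_congr ne_comm (and_congr ne_comm Iff.rfl)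
  · exact and_congr ne_comm (and_congr ne_comm Iff.rfl)
  · exact and_congr ne_comm (exists_congr fun n => by tauto)
  · exact and_congr ne_comm (exists_congr fun n => by tauto)
  · exact and_congr (not_congr (exists_congr fun _ => and_comm))
      (not_congr (exists_congr fun _ => and_comm))

/-- The flags of the dual incidence structure. -/
def dualFlag {P L : Type*} (I : P → L → Prop) : IncFlag I ≃ IncFlag (dualInc I) where
  toFun x := ⟨(x.1.2, x.1.1), x.2⟩
  invFun x := ⟨(x.1.2, x.1.1), x.2⟩
  left_inv _ := rfl
  right_inv _ := rfl

theorem flagRel_dual {P L : Type*} (I : P → L → Prop) (i : Fin 8) (x y : IncFlag I) :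
    flagRel I i x y ↔ flagRel (dualInc I) (dualIndex i) (dualFlag I x) (dualFlag I y) := by
  fin_cases i
  · exact (dualFlag I).injective.eq_iff.symm
  · exact Iff.rfl
  · exact Iff.rfl
  · exact and_left_comm
  · exact and_left_comm
  · exact Iff.rfl
  · exact Iff.rfl
  · exact and_comm

/-! ### The structure constants of the flag scheme -/

section HeckeCoefficients

variable {R : Type*} [Zero R] [One R] [Add R] [Mul R]

/-- Left multiplication by the generator `A₁`, which satisfies `A₁ ^ 2 = t + t' A₁` with
`t' = t - 1`, in the basis `A₀, …, A₇` of the Hecke algebra of type `B₂`. -/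
def heckeMulOne (t t' : R) (v : Fin 8 → R) : Fin 8 → R :=
  ![t * v 1, v 0 + t' * v 1, t * v 4, t * v 5, v 2 + t' * v 4, v 3 + t' * v 5, t * v 7,
    v 6 + t' * v 7]

/-- Left multiplication by the generator `A₂`, which satisfies `A₂ ^ 2 = s + s' A₂` with
`s' = s - 1`. -/
def heckeMulTwo (s s' : R) (v : Fin 8 → R) : Fin 8 → R :=
  ![s * v 2, s * v 3, v 0 + s' * v 2, v 1 + s' * v 3, s * v 6, s * v 7, v 4 + s' * v 6,
    v 5 + s' * v 7]

/-- Left multiplication by `Aᵢ`, through a reduced word for the element of the dihedral group of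
order eight that indexes it. -/
def heckeMul (s s' t t' : R) (i : Fin 8) (v : Fin 8 → R) : Fin 8 → R :=
  match i with
  | 0 => v
  | 1 => heckeMulOne t t' v
  | 2 => heckeMulTwo s s' v
  | 3 => heckeMulTwo s s' (heckeMulOne t t' v)
  | 4 => heckeMulOne t t' (heckeMulTwo s s' v)
  | 5 => heckeMulOne t t' (heckeMulTwo s s' (heckeMulOne t t' v))
  | 6 => heckeMulTwo s s' (heckeMulOne t t' (heckeMulTwo s s' v))
  | 7 => heckeMulOne t t' (heckeMulTwo s s' (heckeMulOne t t' (heckeMulTwo s s' v)))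

/-- The coefficient of `Aₖ` in `Aᵢ Aⱼ`. -/
def heckeCoeff (s s' t t' : R) (i j k : Fin 8) : R :=
  heckeMul s s' t t' i (fun l => if l = j then 1 else 0) k

end HeckeCoefficients

section Matrices

open Classical in
/-- The adjacency matrix of a relation. -/
noncomputable def relMatrix {X : Type*} (r : X → X → Prop) : Matrix X X ℕ :=
  Matrix.of fun x y => if r x y then 1 else 0

theorem relMatrix_mul_apply {X : Type*} [Fintype X] (r r' : X → X → Prop) (x y : X) :
    (relMatrix r * relMatrix r') x y = {z | r x z ∧ r' z y}.ncard := by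
  classical
  rw [Matrix.mul_apply, Set.ncard_eq_toFinset_card', Set.toFinset_ofPred, Finset.card_filter]
  refine Finset.sum_congr rfl fun z _ => ?_
  by_cases h1 : r x z <;> by_cases h2 : r' z y <;> simp [relMatrix, h1, h2]

theorem relMatrix_mul_eq {X : Type*} [Fintype X] {r r' r'' : X → X → Prop}
    (h : ∀ x y, r'' x y → ∃ z, r x z ∧ r' z y)
    (h' : ∀ x y z, r x z → r' z y → r'' x y ∧ ∀ z', r x z' → r' z' y → z' = z) :
    relMatrix r * relMatrix r' = relMatrix r'' := by
  classical
  ext x y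
  rw [relMatrix_mul_apply]
  by_cases hxy : r'' x y
  · obtain ⟨z, hz⟩ := h x y hxy
    have : {z | r x z ∧ r' z y} = {z} := by
      ext z'
      exact ⟨fun hz' => (h' x y z hz.1 hz.2).2 z' hz'.1 hz'.2, by rintro rfl; exact hz⟩
    simp [this, relMatrix, hxy]
  · have : {z | r x z ∧ r' z y} = ∅ := by
      ext z
      simpa using fun hz hz' => hxy (h' x y z hz hz').1
    simp [this, relMatrix, hxy]

/-- The adjacency matrix of the relation `Rᵢ` on the flags. -/
noncomputable abbrev flagMatrix {P L : Type*} (I : P → L → Prop) (i : Fin 8) :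
    Matrix (IncFlag I) (IncFlag I) ℕ :=
  relMatrix (flagRel I i)

theorem flagMatrix_zero {P L : Type*} (I : P → L → Prop) [DecidableEq (IncFlag I)] :
    flagMatrix I 0 = 1 := by
  ext x y
  by_cases hxy : x = y <;> simp [relMatrix, flagRel, hxy, Matrix.one_apply]

theorem flagMatrix_dual {P L : Type*} (I : P → L → Prop) (i : Fin 8) :
    (flagMatrix (dualInc I) (dualIndex i)).submatrix (dualFlag I) (dualFlag I) =
      flagMatrix I i := by
  classical
  ext x y
  simp only [relMatrix, Matrix.submatrix_apply, Matrix.of_apply]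
  exact if_congr (flagRel_dual I i x y).symm rfl rfl

end Matrices

namespace IsGQ

variable {P L : Type*} {I : P → L → Prop} {s t : ℕ} [Fintype (IncFlag I)]

theorem flagMatrix_one_mul_two :
    flagMatrix I 1 * flagMatrix I 2 = flagMatrix I 4 := by
  apply relMatrix_mul_eq
  · rintro x y ⟨hl, hp, hi⟩
    exact ⟨⟨(x.1.1, y.1.2), hi⟩, ⟨rfl, hl⟩, rfl, hp⟩
  · rintro x y z ⟨h1, h2⟩ ⟨h3, h4⟩
    refine ⟨⟨h3 ▸ h2, h1 ▸ h4, ?_⟩, ?_⟩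
    · rw [h1, ← h3]; exact z.2
    · rintro z' ⟨h1', -⟩ ⟨h3', -⟩
      exact Subtype.ext (Prod.ext (h1'.symm.trans h1) (h3'.trans h3.symm))

theorem flagMatrix_one_mul_three (h : IsGQ I s t) :
    flagMatrix I 1 * flagMatrix I 3 = flagMatrix I 5 := by
  apply relMatrix_mul_eq
  · rintro x y ⟨hp, n, hxn, hyn, hn, hn'⟩
    exact ⟨⟨(x.1.1, n), hxn⟩, ⟨rfl, hn.symm⟩, hn', hp, hyn⟩
  · rintro x y z ⟨h1, h2⟩ ⟨h3, h4, h5⟩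
    have hz := z.2
    rw [← h1] at hz h4
    refine ⟨⟨h4, z.1.2, hz, h5, h2.symm, h3⟩, ?_⟩
    rintro z' ⟨h1', -⟩ ⟨-, -, h5'⟩
    have hz' := z'.2
    rw [← h1'] at hz'
    exact Subtype.ext (Prod.ext (h1'.symm.trans h1) (h.line_unique _ _ h4 _ _ hz' h5' hz h5))

theorem flagMatrix_one_mul_six (h : IsGQ I s t) :
    flagMatrix I 1 * flagMatrix I 6 = flagMatrix I 7 := by
  apply relMatrix_mul_eq
  · rintro x y ⟨h1, h2⟩
    have hx : ¬ I x.1.1 y.1.2 := fun hx => h2 ⟨_, hx, y.2⟩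
    obtain ⟨r, n, hn, hrn, hr⟩ := h.exists_proj hx
    refine ⟨⟨(x.1.1, n), hn⟩, ⟨rfl, ?_⟩, ?_, r, hrn, hr, ?_, ?_⟩
    · rintro hxn
      exact h1 ⟨r, by rw [hxn]; exact hrn, hr⟩
    · rintro (rfl : n = _)
      exact hx hn
    · rintro (rfl : r = _)
      exact hx hr
    · rintro rfl
      exact h2 ⟨n, hn, hrn⟩
  · rintro x y z ⟨h1, h2⟩ ⟨h3, r, hr, hr', hrz, hry⟩
    have hz := z.2
    rw [← h1] at hz hrz
    have hx : ¬ I x.1.1 y.1.2 := fun hx => hrz (h.point_unique _ _ h3 _ _ hr hr' hz hx)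
    refine ⟨⟨?_, ?_⟩, ?_⟩
    · rintro ⟨r', hr1, hr2⟩
      exact h2 (h.no_triangle hx hr2 hr' x.2 hr1 hz hr).2
    · rintro ⟨n, hn, hn'⟩
      exact hry (h.no_triangle hx hr' y.2 hz hr hn hn').1
    · rintro z' ⟨h1', -⟩ ⟨-, r', hr1, hr2, -, -⟩
      have hz' := z'.2
      rw [← h1'] at hz'
      exact Subtype.ext (Prod.ext (h1'.symm.trans h1)
        (h.no_triangle hx hr2 hr' hz' hr1 hz hr).2)

theorem flagMatrix_one_mul_one (h : IsGQ I s t) :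
    flagMatrix I 1 * flagMatrix I 1 = t • flagMatrix I 0 + (t - 1) • flagMatrix I 1 := by
  classical
  have := h.finite_lines
  ext x y
  rw [relMatrix_mul_apply]
  have key : {z | flagRel I 1 x z ∧ flagRel I 1 z y}.ncard =
      if x.1.1 = y.1.1 then ({l | I x.1.1 l} \ {x.1.2, y.1.2}).ncard else 0 := by
    split_ifs with hxy
    · refine Set.ncard_congr (fun z _ => z.1.2) ?_ ?_ ?_
      · rintro z ⟨⟨h1, h2⟩, h3, h4⟩
        refine ⟨?_, ?_⟩
        · change I _ _
          rw [h1]; exact z.2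
        · simp [h2.symm, h4]
      · rintro z z' ⟨⟨h1, -⟩, -⟩ ⟨⟨h1', -⟩, -⟩ hz
        exact Subtype.ext (Prod.ext (h1.symm.trans h1') hz)
      · rintro l ⟨hl, hl'⟩
        simp only [Set.mem_insert_iff, Set.mem_singleton_iff, not_or] at hl'
        exact ⟨⟨(x.1.1, l), hl⟩, ⟨⟨rfl, Ne.symm hl'.1⟩, hxy, hl'.2⟩, rfl⟩
    · rw [Set.ncard_eq_zero (Set.toFinite _)]
      ext z
      simp only [Set.mem_ofPred_eq, Set.mem_empty_iff_false, iff_false]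
      rintro ⟨⟨h1, -⟩, h3, -⟩
      exact hxy (h1.trans h3)
  rw [key]
  have hl := h.lines_on_point x.1.1
  by_cases hxy : x.1.1 = y.1.1
  · have hy : I x.1.1 y.1.2 := by rw [hxy]; exact y.2
    rw [if_pos hxy, Set.ncard_sdiff (by rintro l (rfl | rfl); exacts [x.2, hy]), hl]
    by_cases hl' : x.1.2 = y.1.2
    · have : x = y := Subtype.ext (Prod.ext hxy hl')
      simp [relMatrix, flagRel, this]
    · have : x ≠ y := fun e => hl' (by rw [e])
      rw [Set.ncard_pair hl']
      simp [relMatrix, flagRel, this, hxy, hl']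
  · have : x ≠ y := fun e => hxy (by rw [e])
    simp [relMatrix, flagRel, this, hxy]

/-- Products of flag matrices can be computed in the dual. -/
theorem flagMatrix_mul_dual (i j : Fin 8) [Fintype (IncFlag (dualInc I))] :
    flagMatrix I i * flagMatrix I j =
      (flagMatrix (dualInc I) (dualIndex i) * flagMatrix (dualInc I) (dualIndex j)).submatrix
        (dualFlag I) (dualFlag I) := by
  rw [← flagMatrix_dual I i, ← flagMatrix_dual I j, Matrix.submatrix_mul_equiv]

theorem flagMatrix_two_mul_one (h : IsGQ I s t) :
    flagMatrix I 2 * flagMatrix I 1 = flagMatrix I 3 := by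
  have := h.dual.finite_flags
  have := Fintype.ofFinite (IncFlag (dualInc I))
  rw [flagMatrix_mul_dual, ← flagMatrix_dual I 3]
  exact congrArg (Matrix.submatrix · _ _) (flagMatrix_one_mul_two (I := dualInc I))

theorem flagMatrix_two_mul_four (h : IsGQ I s t) :
    flagMatrix I 2 * flagMatrix I 4 = flagMatrix I 6 := by
  have := h.dual.finite_flags
  have := Fintype.ofFinite (IncFlag (dualInc I))
  rw [flagMatrix_mul_dual, ← flagMatrix_dual I 6]
  exact congrArg (Matrix.submatrix · _ _) h.dual.flagMatrix_one_mul_three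

theorem flagMatrix_two_mul_five (h : IsGQ I s t) :
    flagMatrix I 2 * flagMatrix I 5 = flagMatrix I 7 := by
  have := h.dual.finite_flags
  have := Fintype.ofFinite (IncFlag (dualInc I))
  rw [flagMatrix_mul_dual, ← flagMatrix_dual I 7]
  exact congrArg (Matrix.submatrix · _ _) h.dual.flagMatrix_one_mul_six

theorem flagMatrix_two_mul_two (h : IsGQ I s t) :
    flagMatrix I 2 * flagMatrix I 2 = s • flagMatrix I 0 + (s - 1) • flagMatrix I 2 := by
  have := h.dual.finite_flags
  have := Fintype.ofFinite (IncFlag (dualInc I))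
  rw [flagMatrix_mul_dual, ← flagMatrix_dual I 2, ← flagMatrix_dual I 0]
  exact congrArg (Matrix.submatrix · _ _) h.dual.flagMatrix_one_mul_one

theorem flagMatrix_one_mul_sum (h : IsGQ I s t) (v : Fin 8 → ℕ) :
    flagMatrix I 1 * ∑ k, v k • flagMatrix I k =
      ∑ k, heckeMulOne t (t - 1) v k • flagMatrix I k := by
  classical
  have h0 : flagMatrix I 1 * flagMatrix I 0 = flagMatrix I 1 := by
    rw [flagMatrix_zero, mul_one]
  have h2 := flagMatrix_one_mul_two (I := I)
  have h3 := h.flagMatrix_one_mul_three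
  have h6 := h.flagMatrix_one_mul_six
  have h1 := h.flagMatrix_one_mul_one
  have key : ∀ {X Y : Matrix (IncFlag I) (IncFlag I) ℕ}, flagMatrix I 1 * X = Y →
      flagMatrix I 1 * Y = t • X + (t - 1) • Y := by
    rintro X Y rfl
    rw [← mul_assoc, h1, add_mul, smul_mul_assoc, smul_mul_assoc, flagMatrix_zero, one_mul]
  have h4 := key h2
  have h5 := key h3
  have h7 := key h6
  simp only [Fin.sum_univ_eight, mul_add, mul_smul_comm, h0, h1, h2, h3, h4, h5, h6, h7,
    heckeMulOne]
  simp only [Matrix.cons_val, smul_add, smul_smul, add_smul, mul_comm]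
  abel

theorem flagMatrix_two_mul_sum (h : IsGQ I s t) (v : Fin 8 → ℕ) :
    flagMatrix I 2 * ∑ k, v k • flagMatrix I k =
      ∑ k, heckeMulTwo s (s - 1) v k • flagMatrix I k := by
  classical
  have h0 : flagMatrix I 2 * flagMatrix I 0 = flagMatrix I 2 := by
    rw [flagMatrix_zero, mul_one]
  have h1 := h.flagMatrix_two_mul_one
  have h4 := h.flagMatrix_two_mul_four
  have h5 := h.flagMatrix_two_mul_five
  have h2 := h.flagMatrix_two_mul_two
  have key : ∀ {X Y : Matrix (IncFlag I) (IncFlag I) ℕ}, flagMatrix I 2 * X = Y →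
      flagMatrix I 2 * Y = s • X + (s - 1) • Y := by
    rintro X Y rfl
    rw [← mul_assoc, h2, add_mul, smul_mul_assoc, smul_mul_assoc, flagMatrix_zero, one_mul]
  have h3 := key h1
  have h6 := key h4
  have h7 := key h5
  simp only [Fin.sum_univ_eight, mul_add, mul_smul_comm, h0, h1, h2, h3, h4, h5, h6, h7,
    heckeMulTwo]
  simp only [Matrix.cons_val, smul_add, smul_smul, add_smul, mul_comm]
  abel

/-- The flag matrices multiply like the standard basis of the Hecke algebra of type `B₂` with
parameters `t` and `s`. -/
theorem flagMatrix_mul (h : IsGQ I s t) (i j : Fin 8) :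
    flagMatrix I i * flagMatrix I j =
      ∑ k, heckeCoeff s (s - 1) t (t - 1) i j k • flagMatrix I k := by
  classical
  have hj : flagMatrix I j = ∑ k, (if k = j then 1 else 0) • flagMatrix I k := by simp
  have key : ∀ v : Fin 8 → ℕ, flagMatrix I i * ∑ k, v k • flagMatrix I k =
      ∑ k, heckeMul s (s - 1) t (t - 1) i v k • flagMatrix I k := by
    intro v
    have h1 := h.flagMatrix_one_mul_sum
    have h2 := h.flagMatrix_two_mul_sum
    fin_cases i
    · change flagMatrix I 0 * _ = _
      rw [flagMatrix_zero, one_mul]; rfl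
    · exact h1 v
    · exact h2 v
    · change flagMatrix I 3 * _ = _
      rw [← h.flagMatrix_two_mul_one, mul_assoc, h1, h2]; rfl
    · change flagMatrix I 4 * _ = _
      rw [← flagMatrix_one_mul_two, mul_assoc, h2, h1]; rfl
    · change flagMatrix I 5 * _ = _
      rw [← h.flagMatrix_one_mul_three, ← h.flagMatrix_two_mul_one, mul_assoc, mul_assoc, h1, h2,
        h1]; rfl
    · change flagMatrix I 6 * _ = _
      rw [← h.flagMatrix_two_mul_four, ← flagMatrix_one_mul_two, mul_assoc, mul_assoc, h2, h1,
        h2]; rfl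
    · change flagMatrix I 7 * _ = _
      rw [← h.flagMatrix_one_mul_six, ← h.flagMatrix_two_mul_four, ← flagMatrix_one_mul_two,
        mul_assoc, mul_assoc, mul_assoc, h2, h1, h2, h1]; rfl
  conv_lhs => rw [hj]
  exact key _

end IsGQ

/-! ### Association schemes and numerical fusion conditions -/

theorem classRel_singleton {P L : Type*} (I : P → L → Prop) (i : Fin 8) (x y : IncFlag I) :
    classRel I {i} x y ↔ flagRel I i x y := by
  simp [classRel]

theorem classRel_converse {P L : Type*} (I : P → L → Prop) (A : Finset (Fin 8))
    (x y : IncFlag I) : classRel I A x y ↔ classRel I (A.image converseIndex) y x := by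
  simp only [classRel, Finset.mem_image, exists_exists_and_eq_and]
  exact exists_congr fun i => and_congr_right fun _ => flagRel_converse I i x y

/-- The numbers of flags in the relations `R₀, …, R₇` with a given flag. -/
def valency (s t : ℕ) : Fin 8 → ℕ :=
  ![1, t, s, s * t, s * t, s * t ^ 2, s ^ 2 * t, s ^ 2 * t ^ 2]

/-- The coefficient of `Aₖ` in the product of the sums of the `Aᵢ` over `A` and over `B`. -/
def blockCoeff (s t : ℕ) (A B : Finset (Fin 8)) (k : Fin 8) : ℕ :=
  ∑ i ∈ A, ∑ j ∈ B, heckeCoeff s (s - 1) t (t - 1) i j k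

namespace IsGQ

variable {P L : Type*} {I : P → L → Prop} {s t : ℕ}

theorem classRel_iff_mem (h : IsGQ I s t) {A : Finset (Fin 8)} {x y : IncFlag I} {k : Fin 8}
    (hk : flagRel I k x y) : classRel I A x y ↔ k ∈ A := by
  constructor
  · rintro ⟨i, hi, hxy⟩
    exact h.flagRel_inj hk hxy ▸ hi
  · exact fun hA => ⟨k, hA, hk⟩

theorem relMatrix_classRel (h : IsGQ I s t) (A : Finset (Fin 8)) :
    relMatrix (classRel I A) = ∑ i ∈ A, flagMatrix I i := by
  classical
  ext x y
  obtain ⟨k, hk, -⟩ := h.existsUnique_flagRel x y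
  have hk' : ∀ i, flagRel I i x y ↔ k = i := fun i =>
    ⟨fun hi => h.flagRel_inj hk hi, fun e => e ▸ hk⟩
  simp only [Matrix.sum_apply, relMatrix, Matrix.of_apply, h.classRel_iff_mem hk, hk',
    Finset.sum_ite_eq]

theorem ncard_classRel (h : IsGQ I s t) (A B : Finset (Fin 8)) {k : Fin 8} {x y : IncFlag I}
    (hk : flagRel I k x y) :
    {z | classRel I A x z ∧ classRel I B z y}.ncard = blockCoeff s t A B k := by
  classical
  have := h.finite_flags
  have := Fintype.ofFinite (IncFlag I)
  have hk' : ∀ i, flagRel I i x y ↔ k = i := fun i =>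
    ⟨fun hi => h.flagRel_inj hk hi, fun e => e ▸ hk⟩
  rw [← relMatrix_mul_apply, h.relMatrix_classRel, h.relMatrix_classRel, Finset.sum_mul_sum,
    Matrix.sum_apply, blockCoeff]
  refine Finset.sum_congr rfl fun i _ => ?_
  rw [Matrix.sum_apply]
  refine Finset.sum_congr rfl fun j _ => ?_
  rw [h.flagMatrix_mul, Matrix.sum_apply]
  simp [relMatrix, hk']

theorem ncard_flagRel (h : IsGQ I s t) (i : Fin 8) (x : IncFlag I) :
    {y | flagRel I i x y}.ncard = valency s t i := by
  have h1 : {y | flagRel I i x y} =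
      {z | classRel I {i} x z ∧ classRel I {converseIndex i} z x} := by
    ext z
    simp only [classRel_singleton, Set.mem_ofPred_eq]
    rw [flagRel_converse I i, and_self]
  rw [h1, h.ncard_classRel _ _ (k := 0) (show flagRel I 0 x x from rfl)]
  fin_cases i <;>
    simp [blockCoeff, heckeCoeff, heckeMul, heckeMulOne, heckeMulTwo, converseIndex, valency] <;>
    ring

theorem nonempty_flags (h : IsGQ I s t) : Nonempty (IncFlag I) := by
  obtain ⟨p⟩ := h.nonempty_points
  have : {l | I p l}.Nonempty := by
    apply Set.nonempty_of_ncard_ne_zero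
    rw [h.lines_on_point]; omega
  obtain ⟨l, hl⟩ := this
  exact ⟨⟨(p, l), hl⟩⟩

theorem exists_flagRel (h : IsGQ I s t) (hs : 1 ≤ s) (ht : 1 ≤ t) (i : Fin 8) :
    ∃ x y, flagRel I i x y := by
  obtain ⟨x⟩ := h.nonempty_flags
  have : {y | flagRel I i x y}.Nonempty := by
    apply Set.nonempty_of_ncard_ne_zero
    rw [h.ncard_flagRel]
    have : 0 < s := hs
    have : 0 < t := ht
    fin_cases i <;> simp [valency] <;> omega
  obtain ⟨y, hy⟩ := this
  exact ⟨x, y, hy⟩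

theorem card_flags (h : IsGQ I s t) : Nat.card (IncFlag I) = (1 + s) * (1 + t) * (1 + s * t) := by
  classical
  have := h.finite_flags
  have := Fintype.ofFinite (IncFlag I)
  obtain ⟨x⟩ := h.nonempty_flags
  have h1 : (Finset.univ : Finset (IncFlag I)) =
      Finset.univ.biUnion fun i => Finset.univ.filter fun y => flagRel I i x y := by
    ext y
    simpa using (h.existsUnique_flagRel x y).exists
  rw [Nat.card_eq_fintype_card, ← Finset.card_univ, h1, Finset.card_biUnion]
  · have h2 : ∀ i, (Finset.univ.filter fun y => flagRel I i x y).card = valency s t i := by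
      intro i
      rw [← h.ncard_flagRel i x, Set.ncard_eq_toFinset_card', Set.toFinset_ofPred]
    simp only [h2, Fin.sum_univ_eight]
    simp [valency]
    ring
  · intro i _ j _ hij
    rw [Function.onFun, Finset.disjoint_left]
    intro y hy hy'
    simp only [Finset.mem_filter, Finset.mem_univ, true_and] at hy hy'
    exact hij (h.flagRel_inj hy hy')

theorem classRel_injective (h : IsGQ I s t) (hs : 1 ≤ s) (ht : 1 ≤ t) {A B : Finset (Fin 8)}
    (hAB : ∀ x y, classRel I A x y ↔ classRel I B x y) : A = B := by
  ext k
  obtain ⟨x, y, hk⟩ := h.exists_flagRel hs ht k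
  rw [← h.classRel_iff_mem hk, hAB, h.classRel_iff_mem hk]

/-- Being a fusion is a numerical condition on the partition of the indices, since the adjacency
matrices of the relations are linearly independent and their products are known. -/
theorem isFusion_iff (h : IsGQ I s t) (hs : 1 ≤ s) (ht : 1 ≤ t)
    (π : Finpartition ({0}ᶜ : Finset (Fin 8))) :
    IsFusion I π ↔ 2 ≤ π.parts.card ∧ (∃ A ∈ π.parts, 1 < A.card) ∧
      (∀ A ∈ insert {0} π.parts, A.image converseIndex ∈ insert {0} π.parts) ∧
      ∀ A ∈ insert {0} π.parts, ∀ B ∈ insert {0} π.parts, ∀ C ∈ insert {0} π.parts,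
        ∀ k ∈ C, ∀ k' ∈ C, blockCoeff s t A B k = blockCoeff s t A B k' := by
  refine and_congr_right fun _ => and_congr_right fun _ => ?_
  constructor
  · intro hS
    refine ⟨fun A hA => ?_, fun A hA B hB C hC k hk k' hk' => ?_⟩
    · obtain ⟨B, hB, hAB⟩ := hS.converse _ ⟨A, hA, rfl⟩
      have : A.image converseIndex = B := by
        apply h.classRel_injective hs ht
        intro x y
        rw [← classRel_converse]
        exact Set.ext_iff.1 hAB (x, y)
      rwa [this]
    · obtain ⟨c, hc⟩ := hS.intersection_number _ ⟨A, hA, rfl⟩ _ ⟨B, hB, rfl⟩ _ ⟨C, hC, rfl⟩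
      have key : ∀ k ∈ C, blockCoeff s t A B k = c := by
        intro k hk
        obtain ⟨x, y, hxy⟩ := h.exists_flagRel hs ht k
        rw [← hc x y ⟨k, hk, hxy⟩, ← h.ncard_classRel A B hxy]
        rfl
      rw [key k hk, key k' hk']
  · rintro ⟨hconv, hnum⟩
    have hne : ∀ A ∈ insert {0} π.parts, A.Nonempty := by
      intro A hA
      rcases Finset.mem_insert.1 hA with rfl | hA
      · exact Finset.singleton_nonempty 0
      · exact π.nonempty_of_mem_parts hA
    have hex : ∀ k : Fin 8, ∃ A ∈ insert {0} π.parts, k ∈ A := by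
      intro k
      by_cases hk : k = 0
      · exact ⟨{0}, Finset.mem_insert_self _ _, by simp [hk]⟩
      · obtain ⟨A, hA, hkA⟩ := π.exists_mem (a := k) (by simpa using hk)
        exact ⟨A, Finset.mem_insert_of_mem hA, hkA⟩
    have hun : ∀ A ∈ insert {0} π.parts, ∀ B ∈ insert {0} π.parts, ∀ k, k ∈ A → k ∈ B →
        A = B := by
      have h0 : ∀ A ∈ π.parts, (0 : Fin 8) ∉ A := fun A hA h0 => by
        have := π.le hA h0
        simp at this
      intro A hA B hB k hkA hkB
      rcases Finset.mem_insert.1 hA with rfl | hA <;> rcases Finset.mem_insert.1 hB with rfl | hB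
      · rfl
      · rw [Finset.mem_singleton] at hkA
        exact absurd (hkA ▸ hkB) (h0 B hB)
      · rw [Finset.mem_singleton] at hkB
        exact absurd (hkB ▸ hkA) (h0 A hA)
      · exact π.eq_of_mem_parts hA hB hkA hkB
    refine ⟨h.finite_flags, ⟨?_, ?_⟩, ?_, ?_, ?_⟩
    · rintro ⟨A, hA, hA'⟩
      obtain ⟨k, hk⟩ := hne A hA
      obtain ⟨x, y, hxy⟩ := h.exists_flagRel hs ht k
      have : (x, y) ∈ (∅ : Set (IncFlag I × IncFlag I)) := hA' ▸ ⟨k, hk, hxy⟩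
      exact this
    · rintro ⟨x, y⟩
      obtain ⟨k, hk, -⟩ := h.existsUnique_flagRel x y
      obtain ⟨A, hA, hkA⟩ := hex k
      refine ⟨_, ⟨⟨A, hA, rfl⟩, k, hkA, hk⟩, ?_⟩
      rintro _ ⟨⟨B, hB, rfl⟩, hxy⟩
      rw [hun A hA B hB k hkA ((h.classRel_iff_mem hk).1 hxy)]
    · refine ⟨{0}, Finset.mem_insert_self _ _, ?_⟩
      ext ⟨x, y⟩
      exact (classRel_singleton I 0 x y).symm
    · rintro _ ⟨A, hA, rfl⟩
      refine ⟨_, hconv A hA, ?_⟩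
      ext ⟨x, y⟩
      exact classRel_converse I A y x
    · rintro _ ⟨A, hA, rfl⟩ _ ⟨B, hB, rfl⟩ _ ⟨C, hC, rfl⟩
      obtain ⟨k, hk⟩ := hne C hC
      refine ⟨blockCoeff s t A B k, ?_⟩
      rintro x y ⟨k', hk', hxy⟩
      rw [hnum A hA B hB C hC k hk k' hk', ← h.ncard_classRel A B hxy]
      rfl

end IsGQ

/-! ### Polynomials with natural coefficients, for computation in the kernel -/

/-- Polynomials over `R`, as lists of coefficients with the constant coefficient first. They are
meant for evaluation by the kernel; trailing zeros are allowed. -/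
structure CoeffList (R : Type) where
  /-- The list of coefficients. -/
  coeffs : List R

namespace CoeffList

variable {R : Type}

/-- Addition of lists of coefficients. -/
def addList [Add R] : List R → List R → List R
  | [], q => q
  | p, [] => p
  | a :: p, b :: q => (a + b) :: addList p q

/-- Multiplication of lists of coefficients. -/
def mulList [Zero R] [Add R] [Mul R] : List R → List R → List R
  | [], _ => []
  | a :: p, q => addList (q.map (a * ·)) (0 :: mulList p q)

instance : Zero (CoeffList R) := ⟨⟨[]⟩⟩
instance [One R] : One (CoeffList R) := ⟨⟨[1]⟩⟩
instance [Add R] : Add (CoeffList R) := ⟨fun p q => ⟨addList p.coeffs q.coeffs⟩⟩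
instance [Zero R] [Add R] [Mul R] : Mul (CoeffList R) := ⟨fun p q => ⟨mulList p.coeffs q.coeffs⟩⟩

end CoeffList

/-- Sufficient boolean conditions for `≤` and `<` on polynomials with natural coefficients in
natural variables. -/
class CoeffOrder (R : Type) where
  /-- Coefficientwise comparison. -/
  leb : R → R → Bool
  /-- Coefficientwise comparison, with constant coefficients that differ. -/
  ltb : R → R → Bool

instance : CoeffOrder ℕ := ⟨Nat.ble, Nat.blt⟩

namespace CoeffList

variable {R : Type}

/-- Coefficientwise comparison of lists, with missing coefficients read as zero. -/
def lebList [Zero R] [CoeffOrder R] : List R → List R → Bool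
  | [], _ => true
  | a :: p, [] => CoeffOrder.leb a 0 && lebList p []
  | a :: p, b :: q => CoeffOrder.leb a b && lebList p q

/-- Coefficientwise comparison of lists with a strict inequality at the constant coefficient. -/
def ltbList [Zero R] [CoeffOrder R] : List R → List R → Bool
  | _, [] => false
  | [], b :: _ => CoeffOrder.ltb 0 b
  | a :: p, b :: q => CoeffOrder.ltb a b && lebList p q

instance [Zero R] [CoeffOrder R] : CoeffOrder (CoeffList R) :=
  ⟨fun p q => lebList p.coeffs q.coeffs, fun p q => ltbList p.coeffs q.coeffs⟩

end CoeffList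

/-- Evaluation of polynomials at natural numbers: a map to `ℕ` that respects the operations and for
which the boolean comparisons are sound. -/
structure Evaluation (R : Type) [Zero R] [One R] [Add R] [Mul R] [CoeffOrder R] where
  /-- The value of a polynomial. -/
  val : R → ℕ
  val_zero : val 0 = 0
  val_one : val 1 = 1
  val_add : ∀ a b, val (a + b) = val a + val b
  val_mul : ∀ a b, val (a * b) = val a * val b
  val_le : ∀ a b, CoeffOrder.leb a b = true → val a ≤ val b
  val_lt : ∀ a b, CoeffOrder.ltb a b = true → val a < val b

namespace Evaluation

/-- The evaluation of constants. -/
def nat : Evaluation ℕ where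
  val := id
  val_zero := rfl
  val_one := rfl
  val_add _ _ := rfl
  val_mul _ _ := rfl
  val_le _ _ h := Nat.le_of_ble_eq_true h
  val_lt _ _ h := Nat.le_of_ble_eq_true h

variable {R : Type} [Zero R] [One R] [Add R] [Mul R] [CoeffOrder R]

/-- The value at `x` of the polynomial with the given list of coefficients. -/
def valList (φ : Evaluation R) (x : ℕ) : List R → ℕ
  | [] => 0
  | a :: p => φ.val a + x * valList φ x p

theorem valList_add (φ : Evaluation R) (x : ℕ) (p q : List R) :
    φ.valList x (CoeffList.addList p q) = φ.valList x p + φ.valList x q := by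
  induction p generalizing q with
  | nil => simp [CoeffList.addList, valList]
  | cons a p ih =>
    cases q with
    | nil => simp [CoeffList.addList, valList]
    | cons b q =>
      simp only [CoeffList.addList, valList, ih, φ.val_add]
      ring

theorem valList_map_mul (φ : Evaluation R) (x : ℕ) (a : R) (q : List R) :
    φ.valList x (q.map (a * ·)) = φ.val a * φ.valList x q := by
  induction q with
  | nil => simp [valList]
  | cons b q ih =>
    simp only [List.map_cons, valList, ih, φ.val_mul]
    ring

theorem valList_mul (φ : Evaluation R) (x : ℕ) (p q : List R) :
    φ.valList x (CoeffList.mulList p q) = φ.valList x p * φ.valList x q := by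
  induction p with
  | nil => simp [CoeffList.mulList, valList]
  | cons a p ih =>
    simp only [CoeffList.mulList, valList, valList_add, valList_map_mul, ih, φ.val_zero]
    ring

theorem valList_le (φ : Evaluation R) (x : ℕ) (p q : List R)
    (h : CoeffList.lebList p q = true) : φ.valList x p ≤ φ.valList x q := by
  induction p generalizing q with
  | nil => simp [valList]
  | cons a p ih =>
    cases q with
    | nil =>
      simp only [CoeffList.lebList, Bool.and_eq_true] at h
      have h1 := φ.val_le _ _ h.1
      have h2 := ih _ h.2
      rw [φ.val_zero] at h1
      simp only [valList] at h2 ⊢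
      have : x * φ.valList x p = 0 := by rw [Nat.le_zero.1 h2, mul_zero]
      omega
    | cons b q =>
      simp only [CoeffList.lebList, Bool.and_eq_true] at h
      exact Nat.add_le_add (φ.val_le _ _ h.1) (Nat.mul_le_mul_left _ (ih _ h.2))

theorem valList_lt (φ : Evaluation R) (x : ℕ) (p q : List R)
    (h : CoeffList.ltbList p q = true) : φ.valList x p < φ.valList x q := by
  cases q with
  | nil => cases p <;> simp [CoeffList.ltbList] at h
  | cons b q =>
    cases p with
    | nil =>
      have h1 := φ.val_lt _ _ h
      rw [φ.val_zero] at h1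
      exact Nat.add_pos_left h1 _
    | cons a p =>
      simp only [CoeffList.ltbList, Bool.and_eq_true] at h
      exact Nat.add_lt_add_of_lt_of_le (φ.val_lt _ _ h.1)
        (Nat.mul_le_mul_left _ (φ.valList_le x _ _ h.2))

/-- The evaluation at `x` of polynomials in one more variable. -/
def poly (φ : Evaluation R) (x : ℕ) : Evaluation (CoeffList R) where
  val p := φ.valList x p.coeffs
  val_zero := rfl
  val_one := by
    change φ.val 1 + x * 0 = 1
    simp [φ.val_one]
  val_add p q := φ.valList_add x p.coeffs q.coeffs
  val_mul p q := φ.valList_mul x p.coeffs q.coeffs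
  val_le p q h := φ.valList_le x p.coeffs q.coeffs h
  val_lt p q h := φ.valList_lt x p.coeffs q.coeffs h

theorem val_heckeMulOne (φ : Evaluation R) (t t' : R) (v : Fin 8 → R) :
    (fun k => φ.val (heckeMulOne t t' v k)) =
      heckeMulOne (φ.val t) (φ.val t') fun k => φ.val (v k) := by
  funext k
  fin_cases k <;> simp [heckeMulOne, φ.val_add, φ.val_mul]

theorem val_heckeMulTwo (φ : Evaluation R) (s s' : R) (v : Fin 8 → R) :
    (fun k => φ.val (heckeMulTwo s s' v k)) =
      heckeMulTwo (φ.val s) (φ.val s') fun k => φ.val (v k) := by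
  funext k
  fin_cases k <;> simp [heckeMulTwo, φ.val_add, φ.val_mul]

theorem val_heckeCoeff (φ : Evaluation R) (s s' t t' : R) (i j k : Fin 8) :
    φ.val (heckeCoeff s s' t t' i j k) =
      heckeCoeff (φ.val s) (φ.val s') (φ.val t) (φ.val t') i j k := by
  have h0 : (fun l => φ.val (if l = j then 1 else 0)) = fun l => if l = j then 1 else 0 := by
    funext l
    split_ifs
    exacts [φ.val_one, φ.val_zero]
  have key : ∀ v : Fin 8 → R, (fun k => φ.val (heckeMul s s' t t' i v k)) =
      heckeMul (φ.val s) (φ.val s') (φ.val t) (φ.val t') i fun k => φ.val (v k) := by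
    intro v
    fin_cases i <;> simp only [heckeMul, val_heckeMulOne, val_heckeMulTwo]
  have := congrFun (key fun l => if l = j then 1 else 0) k
  rw [h0] at this
  exact this

end Evaluation

/-! ### Boolean fusion test for partitions, given as colourings -/

/-- The indices `0, …, 7`. -/
def allIndices : List (Fin 8) := [0, 1, 2, 3, 4, 5, 6, 7]

/-- The colour of the index `i` in a colouring, given as the list of the colours of `0, …, 7`. -/
def color (l : List (Fin 8)) (i : Fin 8) : Fin 8 := go l i.val
where
  /-- The entry of a list at a position. -/
  go : List (Fin 8) → ℕ → Fin 8
  | [], _ => 0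
  | c :: _, 0 => c
  | _ :: l, n + 1 => go l n

/-- Comparison of indices. -/
def sameIndex (i j : Fin 8) : Bool := Nat.beq i.val j.val

/-- The indices with the same colour as `i`. -/
def colorClass (l : List (Fin 8)) (i : Fin 8) : List (Fin 8) :=
  allIndices.filter fun k => sameIndex (color l k) (color l i)

/-- The colouring is invariant under the converse of relations: the indices `3` and `4` have the
same colour, or no other index has one of their colours. -/
def isConverseClosed (l : List (Fin 8)) : Bool :=
  sameIndex (color l 3) (color l 4) || allIndices.all fun i => sameIndex i 3 || sameIndex i 4 ||
    !(sameIndex (color l i) (color l 3) || sameIndex (color l i) (color l 4))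

/-- The colourings of `0, …, n`, for `n ≤ 7`, in which the colour of an index is the least index of
the same colour and `0` is the only index of colour `0`. As soon as `3` and `4` are coloured, only
the converse-closed colourings are kept. -/
def colorings : ℕ → List (List (Fin 8))
  | 0 => [[0]]
  | n + 1 => (colorings n).flatMap fun l =>
      ((allIndices.filter fun c =>
        Nat.beq c.val (n + 1) ||
          (Nat.ble 1 c.val && Nat.ble c.val n && sameIndex (color l c) c)).map
        fun c => l ++ [c]).filter fun l => Nat.ble n 2 || isConverseClosed l

/-- There are at least two colours other than `0`, and some colour occurs at least twice. -/
def isProperColoring (l : List (Fin 8)) : Bool :=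
  (allIndices.any fun i => !(sameIndex i 0 || sameIndex (color l i) 1)) &&
    allIndices.any fun i => !sameIndex (color l i) i

section Test

variable {R : Type} [Zero R] [One R] [Add R] [Mul R] [CoeffOrder R]

/-- The coefficient of `Aₖ` in the product of the sums of the `A`'s over the colour classes of `i`
and of `j`. -/
def colorCoeff (s s' t t' : R) (l : List (Fin 8)) (i j k : Fin 8) : R :=
  (colorClass l i).foldr (fun i' a =>
    (colorClass l j).foldr (fun j' b => heckeCoeff s s' t t' i' j' k + b) 0 + a) 0

/-- All coefficients that should be equal in a fusion are equal as polynomials. -/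
def testPos (s s' t t' : R) (l : List (Fin 8)) : Bool :=
  allIndices.all fun i => !sameIndex (color l i) i || allIndices.all fun j =>
    !sameIndex (color l j) j ||
    allIndices.all fun k =>
      CoeffOrder.leb (colorCoeff s s' t t' l i j k) (colorCoeff s s' t t' l i j (color l k)) &&
      CoeffOrder.leb (colorCoeff s s' t t' l i j (color l k)) (colorCoeff s s' t t' l i j k)

/-- The triples `(i, j, (k, k'))` for which the coefficients at `k` and `k'` of the product of the
classes of `i` and `j` are compared; they suffice to exclude every non-fusion. -/
def testTriples : List (Fin 8 × Fin 8 × Fin 8 × Fin 8) :=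
  [(1, 2, 3, 4), (5, 7, 1, 2), (3, 4, 2, 6), (3, 5, 1, 6), (1, 3, 5, 7), (3, 3, 1, 7),
    (3, 3, 2, 7), (4, 5, 6, 7), (6, 7, 1, 5), (3, 6, 2, 5), (1, 2, 4, 7), (1, 3, 5, 6),
    (5, 5, 4, 6), (7, 7, 2, 3), (1, 5, 1, 4), (1, 3, 2, 3), (1, 2, 4, 5), (1, 2, 4, 6)]

/-- Some two coefficients that should be equal in a fusion differ for all values of the
variables. -/
def testNeg (s s' t t' : R) (l : List (Fin 8)) : Bool :=
  testTriples.any fun ⟨i, j, k, k'⟩ => sameIndex (color l k) (color l k') &&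
    (CoeffOrder.ltb (colorCoeff s s' t t' l i j k) (colorCoeff s s' t t' l i j k') ||
      CoeffOrder.ltb (colorCoeff s s' t t' l i j k') (colorCoeff s s' t t' l i j k))

/-- The colouring satisfies the fusion conditions for all values of the variables. -/
def isFusionColoring (s s' t t' : R) (l : List (Fin 8)) : Bool :=
  isProperColoring l && isConverseClosed l && testPos s s' t t' l

/-- The colouring violates the fusion conditions for all values of the variables. -/
def isNonfusionColoring (s s' t t' : R) (l : List (Fin 8)) : Bool :=
  !isProperColoring l || testNeg s s' t t' l

end Test

/-- The colourings of the partitions of the table and of their duals, each with the condition on the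
parameters. The arguments tell which conditions hold: `s = t = 2`, `s = t`, `t = 1`, `s = 1`,
`t = 1` and `s = 3`, `s = 1` and `t = 3`. -/
def tableColorings (two eq tOne sOne sThree tThree : Bool) : List (Bool × List (Fin 8)) :=
  [(two, [0, 1, 1, 1, 1, 5, 5, 1]), (tOne, [0, 1, 2, 1, 1, 2, 1, 2]),
    (tOne, [0, 1, 1, 1, 1, 5, 1, 1]), (true, [0, 1, 2, 2, 2, 2, 2, 2]),
    (two, [0, 1, 1, 3, 3, 5, 5, 1]), (sThree, [0, 1, 2, 3, 3, 2, 2, 3]),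
    (sThree, [0, 1, 2, 3, 3, 2, 1, 2]), (tOne, [0, 1, 2, 3, 3, 2, 3, 2]),
    (tOne, [0, 1, 2, 1, 1, 2, 1, 7]), (tOne, [0, 1, 2, 1, 1, 5, 1, 2]),
    (true, [0, 1, 2, 2, 2, 2, 6, 6]), (eq, [0, 1, 1, 3, 3, 5, 5, 7]),
    (tOne, [0, 1, 2, 1, 1, 5, 1, 7]), (tOne, [0, 1, 2, 3, 3, 2, 6, 7]),
    (two, [0, 1, 1, 1, 1, 5, 5, 1]), (sOne, [0, 1, 2, 2, 2, 2, 1, 1]),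
    (sOne, [0, 1, 1, 1, 1, 1, 6, 1]), (true, [0, 1, 2, 1, 1, 1, 1, 1]),
    (two, [0, 1, 1, 3, 3, 5, 5, 1]), (tThree, [0, 1, 2, 3, 3, 1, 1, 3]),
    (tThree, [0, 1, 2, 3, 3, 2, 1, 1]), (sOne, [0, 1, 2, 3, 3, 3, 1, 1]),
    (sOne, [0, 1, 2, 2, 2, 2, 1, 7]), (sOne, [0, 1, 2, 2, 2, 2, 6, 1]),
    (true, [0, 1, 2, 1, 1, 5, 1, 5]), (eq, [0, 1, 1, 3, 3, 5, 5, 7]),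
    (sOne, [0, 1, 2, 2, 2, 2, 6, 7]), (sOne, [0, 1, 2, 3, 3, 5, 1, 7])]

/-- The colouring is one of the partitions of the table or one of their duals, with parameters for
which that is a fusion. -/
def isTableColoring (two eq tOne sOne sThree tThree : Bool) (l : List (Fin 8)) : Bool :=
  (tableColorings two eq tOne sOne sThree tThree).any fun r =>
    (allIndices.all fun i => sameIndex (color l i) (color r.2 i)) && r.1

/-! ### Partitions of the indices and their colourings -/

/-- Two indices are equal or lie in a common member of the family. -/
def SameBlock (Λ : Finset (Finset (Fin 8))) (i k : Fin 8) : Prop :=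
  k = i ∨ ∃ A ∈ Λ, i ∈ A ∧ k ∈ A

instance (Λ : Finset (Finset (Fin 8))) (i k : Fin 8) : Decidable (SameBlock Λ i k) :=
  inferInstanceAs (Decidable (_ ∨ _))

/-- The least index in the block of `i`. -/
def leastIndex (Λ : Finset (Finset (Fin 8))) (i : Fin 8) : Fin 8 :=
  (Finset.univ.filter (SameBlock Λ i)).min' ⟨i, by simp [SameBlock]⟩

/-- The colouring that belongs to a family of blocks. -/
def coloringOf (Λ : Finset (Finset (Fin 8))) : List (Fin 8) := allIndices.map (leastIndex Λ)

/-- The family of blocks that belongs to a colouring. -/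
def blocksOf (l : List (Fin 8)) : Finset (Finset (Fin 8)) :=
  ({0}ᶜ : Finset (Fin 8)).image fun i => Finset.univ.filter fun k => color l k = color l i

theorem sameIndex_iff {i j : Fin 8} : sameIndex i j = true ↔ i = j :=
  ⟨fun h => Fin.ext (Nat.eq_of_beq_eq_true h), fun h => by rw [h]; exact Nat.beq_refl _⟩

theorem mem_allIndices (i : Fin 8) : i ∈ allIndices := by
  fin_cases i <;> simp [allIndices]

theorem color_map (f : Fin 8 → Fin 8) (i : Fin 8) : color (allIndices.map f) i = f i := by
  fin_cases i <;> rfl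

theorem color_take_map (f : Fin 8 → Fin 8) {n : ℕ} (hn : n < 8) {i : Fin 8} (hi : i.val < n) :
    color ((allIndices.take n).map f) i = f i := by
  interval_cases n <;> fin_cases i <;> first | rfl | simp at hi

theorem color_take_map_of_le (f : Fin 8 → Fin 8) {n : ℕ} (hn : n < 8) {i : Fin 8}
    (hi : n ≤ i.val) : color ((allIndices.take n).map f) i = 0 := by
  interval_cases n <;> fin_cases i <;> first | rfl | simp at hi

/-- The missing entries of a truncated colouring are read as `0`, a colour that only `0` has, so
that they do not interfere with the condition for the converse. -/
theorem isConverseClosed_take {f : Fin 8 → Fin 8} (h0' : ∀ i, f i = 0 → i = 0)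
    (hf : isConverseClosed (allIndices.map f) = true) {n : ℕ} (hn : n < 8) (hn' : 4 < n) :
    isConverseClosed ((allIndices.take n).map f) = true := by
  simp only [isConverseClosed, Bool.or_eq_true, List.all_eq_true, mem_allIndices, true_imp_iff,
    Bool.not_eq_true', ← Bool.not_eq_true, sameIndex_iff, color_map] at hf ⊢
  rw [color_take_map f hn (show (3 : Fin 8).val < n by omega),
    color_take_map f hn (show (4 : Fin 8).val < n from hn')]
  refine hf.imp id fun h i => (h i).imp id fun h1 => ?_
  rcases Nat.lt_or_ge i.val n with hi | hi
  · rwa [color_take_map f hn hi]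
  · rw [color_take_map_of_le f hn hi]
    rintro (h2 | h2)
    · exact absurd (h0' _ h2.symm) (by decide)
    · exact absurd (h0' _ h2.symm) (by decide)

/-- The list `colorings 7` contains every converse-closed colouring by least indices. -/
theorem map_mem_colorings {f : Fin 8 → Fin 8} (h0 : f 0 = 0) (h0' : ∀ i, f i = 0 → i = 0)
    (hle : ∀ i, f i ≤ i) (hf : ∀ i, f (f i) = f i)
    (hconv : isConverseClosed (allIndices.map f) = true) : allIndices.map f ∈ colorings 7 := by
  have key : ∀ n, n < 8 → (allIndices.take (n + 1)).map f ∈ colorings n := by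
    intro n hn
    induction n with
    | zero => simp [allIndices, colorings, h0]
    | succ n ih =>
      have hcol := color_take_map f hn (i := f ⟨n + 1, hn⟩)
      have hlist : (allIndices.take (n + 1 + 1)).map f =
          (allIndices.take (n + 1)).map f ++ [f ⟨n + 1, hn⟩] := by
        rw [List.take_add_one, List.map_append]
        congr 1
        have : n < 7 := by omega
        interval_cases n <;> rfl
      rw [colorings, List.mem_flatMap]
      refine ⟨_, ih (by omega), ?_⟩
      rw [List.mem_filter, List.mem_map]
      refine ⟨⟨_, ?_, hlist.symm⟩, ?_⟩
      · rw [List.mem_filter]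
        refine ⟨mem_allIndices _, ?_⟩
        simp only [Bool.or_eq_true, Bool.and_eq_true, sameIndex_iff, Nat.ble_eq]
        by_cases hc : (f ⟨n + 1, hn⟩).val = n + 1
        · exact Or.inl (by rw [hc]; exact Nat.beq_refl _)
        · have h1 : (f ⟨n + 1, hn⟩).val ≤ n + 1 := hle ⟨n + 1, hn⟩
          refine Or.inr ⟨⟨?_, by omega⟩, ?_⟩
          · rw [Nat.one_le_iff_ne_zero]
            intro h2
            have := h0' ⟨n + 1, hn⟩ (Fin.ext h2)
            simp [Fin.ext_iff] at this
          · rw [hcol (by omega)]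
            exact hf _
      · rw [Bool.or_eq_true, Nat.ble_eq]
        rcases Nat.lt_or_ge n 3 with h3 | h3
        · exact Or.inl (by omega)
        · right
          rcases Nat.lt_or_ge n 6 with h6 | h6
          · exact isConverseClosed_take h0' hconv (by omega) (by omega)
          · obtain rfl : n = 6 := by omega
            exact hconv
  exact key 7 (by norm_num)

section Finpartition

variable (π : Finpartition ({0}ᶜ : Finset (Fin 8)))

theorem sameBlock_zero_iff (i : Fin 8) : SameBlock π.parts i 0 ↔ i = 0 := by
  constructor
  · rintro (h | ⟨A, hA, -, h⟩)
    · exact h.symm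
    · have := π.le hA h
      simp at this
  · exact fun h => Or.inl h.symm

theorem sameBlock_equivalence : Equivalence (SameBlock π.parts) where
  refl _ := Or.inl rfl
  symm := by
    rintro i j (rfl | ⟨A, hA, h, h'⟩)
    exacts [Or.inl rfl, Or.inr ⟨A, hA, h', h⟩]
  trans := by
    rintro i j k (rfl | ⟨A, hA, h, h'⟩) (rfl | ⟨B, hB, h1, h2⟩)
    · exact Or.inl rfl
    · exact Or.inr ⟨B, hB, h1, h2⟩
    · exact Or.inr ⟨A, hA, h, h'⟩
    · obtain rfl := π.eq_of_mem_parts hA hB h' h1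
      exact Or.inr ⟨A, hA, h, h2⟩

theorem sameBlock_leastIndex (i : Fin 8) : SameBlock π.parts i (leastIndex π.parts i) := by
  exact (Finset.mem_filter.1 (Finset.min'_mem (Finset.univ.filter (SameBlock π.parts i)) _)).2

theorem leastIndex_le {i k : Fin 8} (h : SameBlock π.parts i k) : leastIndex π.parts i ≤ k :=
  Finset.min'_le _ _ (by simpa using h)

theorem leastIndex_eq_iff (i k : Fin 8) :
    leastIndex π.parts i = leastIndex π.parts k ↔ SameBlock π.parts i k := by
  have e := sameBlock_equivalence π
  constructor
  · intro h
    exact e.trans (h ▸ sameBlock_leastIndex π i) (e.symm (sameBlock_leastIndex π k))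
  · intro h
    exact le_antisymm (leastIndex_le π (e.trans h (sameBlock_leastIndex π k)))
      (leastIndex_le π (e.trans (e.symm h) (sameBlock_leastIndex π i)))

theorem leastIndex_leastIndex (i : Fin 8) :
    leastIndex π.parts (leastIndex π.parts i) = leastIndex π.parts i :=
  (leastIndex_eq_iff π _ _).2 ((sameBlock_equivalence π).symm (sameBlock_leastIndex π i))

theorem color_coloringOf (Λ : Finset (Finset (Fin 8))) (i : Fin 8) :
    color (coloringOf Λ) i = leastIndex Λ i := color_map _ _

theorem coloringOf_mem_colorings (hconv : isConverseClosed (coloringOf π.parts) = true) :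
    coloringOf π.parts ∈ colorings 7 := by
  refine map_mem_colorings ?_ ?_ ?_ (leastIndex_leastIndex π) hconv
  · exact le_antisymm (leastIndex_le π (Or.inl rfl)) (Fin.zero_le _)
  · intro i hi
    have := sameBlock_leastIndex π i
    rw [hi] at this
    exact (sameBlock_zero_iff π i).1 this
  · exact fun i => leastIndex_le π (Or.inl rfl)

/-- The block of an index, the index `0` forming a block of its own. -/
def blockAt (i : Fin 8) : Finset (Fin 8) := Finset.univ.filter (SameBlock π.parts i)

theorem mem_blockAt {i k : Fin 8} : k ∈ blockAt π i ↔ SameBlock π.parts i k := by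
  simp [blockAt]

theorem blockAt_of_mem {A : Finset (Fin 8)} (hA : A ∈ π.parts) {i : Fin 8} (hi : i ∈ A) :
    blockAt π i = A := by
  ext k
  rw [mem_blockAt]
  constructor
  · rintro (rfl | ⟨B, hB, h, h'⟩)
    · exact hi
    · exact π.eq_of_mem_parts hB hA h hi ▸ h'
  · exact fun hk => Or.inr ⟨A, hA, hi, hk⟩

theorem blockAt_mem {i : Fin 8} (hi : i ≠ 0) : blockAt π i ∈ π.parts := by
  obtain ⟨A, hA, hiA⟩ := π.exists_mem (a := i) (by simpa using hi)
  exact blockAt_of_mem π hA hiA ▸ hA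

theorem blockAt_zero : blockAt π 0 = {0} := by
  ext k
  rw [mem_blockAt, Finset.mem_singleton, ← sameBlock_zero_iff π k]
  exact ⟨(sameBlock_equivalence π).symm, (sameBlock_equivalence π).symm⟩

theorem mem_insert_parts_iff {A : Finset (Fin 8)} :
    A ∈ insert {0} π.parts ↔ ∃ i, A = blockAt π i := by
  rw [Finset.mem_insert]
  constructor
  · rintro (rfl | hA)
    · exact ⟨0, (blockAt_zero π).symm⟩
    · obtain ⟨i, hi⟩ := π.nonempty_of_mem_parts hA
      exact ⟨i, (blockAt_of_mem π hA hi).symm⟩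
  · rintro ⟨i, rfl⟩
    by_cases hi : i = 0
    · exact Or.inl (hi ▸ blockAt_zero π)
    · exact Or.inr (blockAt_mem π hi)

theorem blockAt_eq_iff {i k : Fin 8} :
    blockAt π i = blockAt π k ↔ SameBlock π.parts i k := by
  rw [← leastIndex_eq_iff]
  constructor
  · intro h
    rw [leastIndex_eq_iff, ← mem_blockAt, h, mem_blockAt]
    exact Or.inl rfl
  · intro h
    ext j
    rw [mem_blockAt, mem_blockAt, ← leastIndex_eq_iff, ← leastIndex_eq_iff, h]

theorem blocksOf_coloringOf : blocksOf (coloringOf π.parts) = π.parts := by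
  have h1 : ∀ i, (Finset.univ.filter fun k =>
      color (coloringOf π.parts) k = color (coloringOf π.parts) i) = blockAt π i := by
    intro i
    ext k
    simp only [color_coloringOf, Finset.mem_filter, Finset.mem_univ, true_and, mem_blockAt]
    rw [← leastIndex_eq_iff, eq_comm]
  ext A
  simp only [blocksOf, h1, Finset.mem_image, Finset.mem_compl, Finset.mem_singleton]
  constructor
  · rintro ⟨i, hi, rfl⟩
    exact blockAt_mem π hi
  · intro hA
    obtain ⟨i, hi⟩ := π.nonempty_of_mem_parts hA
    refine ⟨i, ?_, blockAt_of_mem π hA hi⟩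
    simpa using π.le hA hi

theorem parts_eq_iff {Λ : Finset (Finset (Fin 8))} {l : List (Fin 8)} (h : coloringOf Λ = l)
    (h' : blocksOf l = Λ) : π.parts = Λ ↔ coloringOf π.parts = l := by
  constructor
  · rintro rfl
    exact h
  · intro h1
    rw [← h', ← h1, blocksOf_coloringOf]

theorem dualBlocks_dualBlocks (Λ : Finset (Finset (Fin 8))) : dualBlocks (dualBlocks Λ) = Λ := by
  have h1 : dualIndex ∘ dualIndex = id := by decide
  simp [dualBlocks, Finset.image_image, Function.comp_def, funext_iff] at h1 ⊢
  simp [h1]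

theorem dualBlocks_parts_eq_iff {Λ : Finset (Finset (Fin 8))} {l : List (Fin 8)}
    (h : coloringOf (dualBlocks Λ) = l) (h' : blocksOf l = dualBlocks Λ) :
    dualBlocks π.parts = Λ ↔ coloringOf π.parts = l := by
  rw [← parts_eq_iff π h h']
  constructor
  · rintro rfl
    rw [dualBlocks_dualBlocks]
  · intro h1
    rw [h1, dualBlocks_dualBlocks]

theorem coloringOf_eq_iff {l : List (Fin 8)} (hl : l.length = 8) : coloringOf π.parts = l ↔
    (allIndices.all fun i => sameIndex (color (coloringOf π.parts) i) (color l i)) = true := by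
  constructor
  · rintro rfl
    simp [sameIndex_iff]
  · intro h
    simp only [List.all_eq_true, sameIndex_iff] at h
    have h1 : l = allIndices.map (color l) := by
      match l, hl with
      | [_, _, _, _, _, _, _, _], _ => rfl
    rw [h1]
    refine List.map_congr_left fun i hi => ?_
    rw [← h i hi, color_coloringOf]

/-- Membership in the table, up to duality, in terms of colourings. -/
theorem inFusionTable_iff (s t : ℕ) {two eq tOne sOne sThree tThree : Bool}
    (h1 : two = true ↔ s = 2 ∧ t = 2) (h2 : eq = true ↔ s = t) (h3 : tOne = true ↔ t = 1)
    (h4 : sOne = true ↔ s = 1) (h5 : sThree = true ↔ s = 3 ∧ t = 1)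
    (h6 : tThree = true ↔ t = 3 ∧ s = 1) :
    InFusionTable s t π.parts ∨ InFusionTable t s (dualBlocks π.parts) ↔
      isTableColoring two eq tOne sOne sThree tThree (coloringOf π.parts) = true := by
  simp only [isTableColoring, tableColorings, List.any_cons, List.any_nil, Bool.or_false,
    Bool.or_eq_true, Bool.and_eq_true, h1, h2, h3, h4, h5, h6, and_true]
  simp only [← coloringOf_eq_iff, List.length_cons, List.length_nil]
  simp only [InFusionTable]
  rw [parts_eq_iff π (l := [0, 1, 1, 1, 1, 5, 5, 1]) (by decide +kernel) (by decide +kernel),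
    parts_eq_iff π (l := [0, 1, 2, 1, 1, 2, 1, 2]) (by decide +kernel) (by decide +kernel),
    parts_eq_iff π (l := [0, 1, 1, 1, 1, 5, 1, 1]) (by decide +kernel) (by decide +kernel),
    parts_eq_iff π (l := [0, 1, 2, 2, 2, 2, 2, 2]) (by decide +kernel) (by decide +kernel),
    parts_eq_iff π (l := [0, 1, 1, 3, 3, 5, 5, 1]) (by decide +kernel) (by decide +kernel),
    parts_eq_iff π (l := [0, 1, 2, 3, 3, 2, 2, 3]) (by decide +kernel) (by decide +kernel),
    parts_eq_iff π (l := [0, 1, 2, 3, 3, 2, 1, 2]) (by decide +kernel) (by decide +kernel),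
    parts_eq_iff π (l := [0, 1, 2, 3, 3, 2, 3, 2]) (by decide +kernel) (by decide +kernel),
    parts_eq_iff π (l := [0, 1, 2, 1, 1, 2, 1, 7]) (by decide +kernel) (by decide +kernel),
    parts_eq_iff π (l := [0, 1, 2, 1, 1, 5, 1, 2]) (by decide +kernel) (by decide +kernel),
    parts_eq_iff π (l := [0, 1, 2, 2, 2, 2, 6, 6]) (by decide +kernel) (by decide +kernel),
    parts_eq_iff π (l := [0, 1, 1, 3, 3, 5, 5, 7]) (by decide +kernel) (by decide +kernel),
    parts_eq_iff π (l := [0, 1, 2, 1, 1, 5, 1, 7]) (by decide +kernel) (by decide +kernel),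
    parts_eq_iff π (l := [0, 1, 2, 3, 3, 2, 6, 7]) (by decide +kernel) (by decide +kernel),
    dualBlocks_parts_eq_iff π (l := [0, 1, 1, 1, 1, 5, 5, 1]) (by decide +kernel)
      (by decide +kernel),
    dualBlocks_parts_eq_iff π (l := [0, 1, 2, 2, 2, 2, 1, 1]) (by decide +kernel)
      (by decide +kernel),
    dualBlocks_parts_eq_iff π (l := [0, 1, 1, 1, 1, 1, 6, 1]) (by decide +kernel)
      (by decide +kernel),
    dualBlocks_parts_eq_iff π (l := [0, 1, 2, 1, 1, 1, 1, 1]) (by decide +kernel)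
      (by decide +kernel),
    dualBlocks_parts_eq_iff π (l := [0, 1, 1, 3, 3, 5, 5, 1]) (by decide +kernel)
      (by decide +kernel),
    dualBlocks_parts_eq_iff π (l := [0, 1, 2, 3, 3, 1, 1, 3]) (by decide +kernel)
      (by decide +kernel),
    dualBlocks_parts_eq_iff π (l := [0, 1, 2, 3, 3, 2, 1, 1]) (by decide +kernel)
      (by decide +kernel),
    dualBlocks_parts_eq_iff π (l := [0, 1, 2, 3, 3, 3, 1, 1]) (by decide +kernel)
      (by decide +kernel),
    dualBlocks_parts_eq_iff π (l := [0, 1, 2, 2, 2, 2, 1, 7]) (by decide +kernel)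
      (by decide +kernel),
    dualBlocks_parts_eq_iff π (l := [0, 1, 2, 2, 2, 2, 6, 1]) (by decide +kernel)
      (by decide +kernel),
    dualBlocks_parts_eq_iff π (l := [0, 1, 2, 1, 1, 5, 1, 5]) (by decide +kernel)
      (by decide +kernel),
    dualBlocks_parts_eq_iff π (l := [0, 1, 1, 3, 3, 5, 5, 7]) (by decide +kernel)
      (by decide +kernel),
    dualBlocks_parts_eq_iff π (l := [0, 1, 2, 2, 2, 2, 6, 7]) (by decide +kernel)
      (by decide +kernel),
    dualBlocks_parts_eq_iff π (l := [0, 1, 2, 3, 3, 5, 1, 7]) (by decide +kernel)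
      (by decide +kernel)]
  rw [eq_comm (a := t) (b := s), and_comm (a := t = 2) (b := s = 2)]
  simp only [or_assoc]

end Finpartition

/-! ### The classification of the fusions -/

section Criterion

variable (π : Finpartition ({0}ᶜ : Finset (Fin 8)))

theorem isProperColoring_iff : isProperColoring (coloringOf π.parts) = true ↔
    2 ≤ π.parts.card ∧ ∃ A ∈ π.parts, 1 < A.card := by
  have e := sameBlock_equivalence π
  have h1 : leastIndex π.parts 1 = 1 := by
    refine le_antisymm (leastIndex_le π (Or.inl rfl)) (Fin.one_le_of_ne_zero fun h => ?_)
    have := sameBlock_leastIndex π 1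
    rw [h, sameBlock_zero_iff] at this
    exact absurd this (by decide)
  have h2 : ∀ i, sameIndex (color (coloringOf π.parts) i) 1 = true ↔ SameBlock π.parts 1 i := by
    intro i
    rw [sameIndex_iff, color_coloringOf, ← leastIndex_eq_iff, h1, eq_comm]
  have h2' : ∀ i, (sameIndex (leastIndex π.parts i) 1 = true) ↔ SameBlock π.parts 1 i := by
    intro i
    rw [← h2, color_coloringOf]
  simp only [isProperColoring, Bool.and_eq_true, List.any_eq_true, Bool.not_eq_true',
    ← Bool.not_eq_true, Bool.or_eq_true, not_or, h2', mem_allIndices, true_and, sameIndex_iff,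
    color_coloringOf]
  refine and_congr ⟨?_, ?_⟩ ⟨?_, ?_⟩
  · rintro ⟨i, hi0, hi⟩
    refine Finset.one_lt_card.2 ⟨_, blockAt_mem π (i := 1) (by decide), _, blockAt_mem π hi0, ?_⟩
    rwa [Ne, blockAt_eq_iff]
  · intro h
    obtain ⟨A, hA, hne⟩ := Finset.exists_mem_ne h (blockAt π 1)
    obtain ⟨i, hi⟩ := π.nonempty_of_mem_parts hA
    refine ⟨i, by simpa using π.le hA hi, fun h3 => hne ?_⟩
    rw [← blockAt_of_mem π hA hi, ← (blockAt_eq_iff π).2 h3]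
  · rintro ⟨i, hi⟩
    have hi0 : i ≠ 0 := by
      rintro rfl
      exact hi (le_antisymm (leastIndex_le π (Or.inl rfl)) (Fin.zero_le _))
    refine ⟨_, blockAt_mem π hi0, Finset.one_lt_card.2 ⟨i, ?_, leastIndex π.parts i, ?_, ?_⟩⟩
    · exact (mem_blockAt π).2 (e.refl i)
    · exact (mem_blockAt π).2 (sameBlock_leastIndex π i)
    · exact Ne.symm hi
  · rintro ⟨A, hA, hcard⟩
    obtain ⟨i, hi, j, hj, hij⟩ := Finset.one_lt_card.1 hcard
    have h3 := (leastIndex_eq_iff π i j).2 (Or.inr ⟨A, hA, hi, hj⟩)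
    by_contra! h4
    rw [h4, h4] at h3
    exact hij h3

theorem isConverseClosed_iff : isConverseClosed (coloringOf π.parts) = true ↔
    ∀ A ∈ insert {0} π.parts, A.image converseIndex ∈ insert {0} π.parts := by
  have e := sameBlock_equivalence π
  have hsame : ∀ i j, leastIndex π.parts i = leastIndex π.parts j ↔ SameBlock π.parts i j :=
    leastIndex_eq_iff π
  have hinv : ∀ i, converseIndex (converseIndex i) = i := by decide
  have hfix : ∀ i, i = 3 ∨ i = 4 ∨ converseIndex i = i := by decide
  have hfix' : ∀ i, ¬ (i = 3 ∨ i = 4) → converseIndex i = i := by decide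
  have hmem : ∀ (A : Finset (Fin 8)) i, i ∈ A.image converseIndex ↔ converseIndex i ∈ A := by
    intro A i
    rw [Finset.mem_image]
    constructor
    · rintro ⟨j, hj, rfl⟩
      rwa [hinv]
    · exact fun h => ⟨_, h, hinv i⟩
  simp only [isConverseClosed, Bool.or_eq_true, List.all_eq_true, mem_allIndices, true_imp_iff,
    Bool.not_eq_true', ← Bool.not_eq_true, not_or, sameIndex_iff, color_coloringOf, hsame]
  constructor
  · rintro h A hA
    obtain ⟨i, rfl⟩ := (mem_insert_parts_iff π).1 hA
    refine (mem_insert_parts_iff π).2 ⟨converseIndex i, ?_⟩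
    ext k
    rw [hmem, mem_blockAt, mem_blockAt]
    rcases h with h | h
    · have h5 : ∀ i, SameBlock π.parts i (converseIndex i) := by
        intro i
        rcases hfix i with rfl | rfl | hi
        · exact h
        · exact e.symm h
        · rw [hi]; exact e.refl i
      exact ⟨fun h6 => e.trans (e.symm (h5 i)) (e.trans h6 (e.symm (h5 k))),
        fun h6 => e.trans (h5 i) (e.trans h6 (h5 k))⟩
    · have h5 : ∀ i, (i = 3 ∨ i = 4) → ∀ j, SameBlock π.parts i j → j = 3 ∨ j = 4 := by
        rintro i hi j hij
        rcases h j with hj | hj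
        · exact hj
        · rcases hi with rfl | rfl
          exacts [absurd (e.symm hij) hj.1, absurd (e.symm hij) hj.2]
      by_cases h7 : SameBlock π.parts 3 4
      · have h8 : ∀ i, SameBlock π.parts i (converseIndex i) := by
          intro i
          rcases hfix i with rfl | rfl | hi
          · exact h7
          · exact e.symm h7
          · rw [hi]; exact e.refl i
        exact ⟨fun h6 => e.trans (e.symm (h8 i)) (e.trans h6 (e.symm (h8 k))),
          fun h6 => e.trans (h8 i) (e.trans h6 (h8 k))⟩
      · have h9 : ¬ SameBlock π.parts 4 3 := fun h => h7 (e.symm h)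
        have h10 : ∀ i k, SameBlock π.parts i k →
            SameBlock π.parts (converseIndex i) (converseIndex k) := by
          intro i k hik
          by_cases hi : i = 3 ∨ i = 4
          · rcases h5 i hi k hik with rfl | rfl <;> rcases hi with rfl | rfl
            · exact e.refl _
            · exact absurd hik h9
            · exact absurd hik h7
            · exact e.refl _
          · by_cases hk : k = 3 ∨ k = 4
            · exact absurd (h5 k hk i (e.symm hik)) hi
            · rw [hfix' i hi, hfix' k hk]
              exact hik
        constructor
        · intro h6
          have := h10 _ _ h6
          rwa [hinv] at this
        · intro h6
          have := h10 _ _ h6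
          rwa [hinv] at this
  · intro h
    by_contra! hcon
    obtain ⟨h1, i, hi, h2⟩ := hcon
    have key : ∀ a, (a = 3 ∨ a = 4) → SameBlock π.parts i a → False := by
      intro a ha hia
      obtain ⟨j, hj⟩ := (mem_insert_parts_iff π).1
        (h _ ((mem_insert_parts_iff π).2 ⟨a, rfl⟩))
      have hii : converseIndex i = i := ((hfix i).resolve_left hi.1).resolve_left hi.2
      have m1 : i ∈ (blockAt π a).image converseIndex := by
        rw [hmem, hii, mem_blockAt]; exact e.symm hia
      have m2 : converseIndex a ∈ (blockAt π a).image converseIndex := by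
        rw [hmem, hinv, mem_blockAt]; exact e.refl a
      rw [hj, mem_blockAt] at m1 m2
      have m3 := e.trans (e.symm hia) (e.trans (e.symm m1) m2)
      rcases ha with rfl | rfl
      · exact h1 m3
      · exact h1 (e.symm m3)
    by_cases h3 : SameBlock π.parts i 3
    · exact key 3 (Or.inl rfl) h3
    · exact key 4 (Or.inr rfl) (h2 h3)

theorem colorClass_coloringOf (i : Fin 8) :
    (colorClass (coloringOf π.parts) i).toFinset = blockAt π i := by
  ext k
  simp only [colorClass, List.mem_toFinset, List.mem_filter, mem_allIndices, true_and,
    sameIndex_iff, color_coloringOf, mem_blockAt]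
  rw [← leastIndex_eq_iff, eq_comm]

theorem foldr_add_eq_sum {α : Type*} (g : α → ℕ) (l : List α) :
    l.foldr (fun a b => g a + b) 0 = (l.map g).sum := by
  induction l with
  | nil => rfl
  | cons a l ih => simp [ih]

variable {R : Type} [Zero R] [One R] [Add R] [Mul R] [CoeffOrder R]

theorem Evaluation.val_foldr {α : Type*} (φ : Evaluation R) (g : α → R) (l : List α) :
    φ.val (l.foldr (fun a b => g a + b) 0) = l.foldr (fun a b => φ.val (g a) + b) 0 := by
  induction l with
  | nil => exact φ.val_zero
  | cons a l ih => simp [φ.val_add, ih]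

theorem val_colorCoeff (φ : Evaluation R) {s t : ℕ} {s₀ s₁ t₀ t₁ : R} (hs : φ.val s₀ = s)
    (hs' : φ.val s₁ = s - 1) (ht : φ.val t₀ = t) (ht' : φ.val t₁ = t - 1) (i j k : Fin 8) :
    φ.val (colorCoeff s₀ s₁ t₀ t₁ (coloringOf π.parts) i j k) =
      blockCoeff s t (blockAt π i) (blockAt π j) k := by
  have hn : ∀ i, (colorClass (coloringOf π.parts) i).Nodup := fun i =>
    List.Nodup.filter _ (by decide)
  simp only [colorCoeff, φ.val_foldr, φ.val_heckeCoeff, hs, hs', ht, ht', foldr_add_eq_sum,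
    blockCoeff, ← colorClass_coloringOf, List.sum_toFinset _ (hn _)]

theorem IsGQ.isFusion_of_isFusionColoring {P L : Type*} {I : P → L → Prop} {s t : ℕ}
    (h : IsGQ I s t) (hs1 : 1 ≤ s) (ht1 : 1 ≤ t) (φ : Evaluation R) {s₀ s₁ t₀ t₁ : R}
    (hs : φ.val s₀ = s) (hs' : φ.val s₁ = s - 1) (ht : φ.val t₀ = t) (ht' : φ.val t₁ = t - 1)
    (hb : isFusionColoring s₀ s₁ t₀ t₁ (coloringOf π.parts) = true) : IsFusion I π := by
  have hval := val_colorCoeff π φ hs hs' ht ht'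
  rw [h.isFusion_iff hs1 ht1 π, ← and_assoc, ← isProperColoring_iff, ← isConverseClosed_iff]
  simp only [isFusionColoring, Bool.and_eq_true] at hb
  obtain ⟨⟨hb1, hb2⟩, hb3⟩ := hb
  simp only [testPos, List.all_eq_true, mem_allIndices, true_imp_iff, Bool.or_eq_true,
    Bool.not_eq_true', Bool.and_eq_true, ← Bool.not_eq_true, sameIndex_iff] at hb3
  refine ⟨hb1, hb2, ?_⟩
  intro A hA B hB C hC k hk k' hk'
  obtain ⟨i, rfl⟩ := (mem_insert_parts_iff π).1 hA
  obtain ⟨j, rfl⟩ := (mem_insert_parts_iff π).1 hB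
  obtain ⟨m, rfl⟩ := (mem_insert_parts_iff π).1 hC
  have key : ∀ k, blockCoeff s t (blockAt π i) (blockAt π j) k =
      blockCoeff s t (blockAt π i) (blockAt π j) (leastIndex π.parts k) := by
    intro k
    have hrep : ∀ i, blockAt π i = blockAt π (leastIndex π.parts i) := fun i =>
      (blockAt_eq_iff π).2 (sameBlock_leastIndex π i)
    have hc : ∀ i, color (coloringOf π.parts) (leastIndex π.parts i) = leastIndex π.parts i :=
      fun i => by rw [color_coloringOf, leastIndex_leastIndex]
    rw [hrep i, hrep j, ← hval, ← hval]
    have h1 := (hb3 (leastIndex π.parts i)).resolve_left (not_not.2 (hc i))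
    have h2 := (h1 (leastIndex π.parts j)).resolve_left (not_not.2 (hc j)) k
    rw [color_coloringOf] at h2
    exact le_antisymm (φ.val_le _ _ h2.1) (φ.val_le _ _ h2.2)
  rw [mem_blockAt, ← leastIndex_eq_iff] at hk hk'
  rw [key k, key k', ← hk, ← hk']

theorem IsGQ.not_isFusion_of_isNonfusionColoring {P L : Type*} {I : P → L → Prop} {s t : ℕ}
    (h : IsGQ I s t) (hs1 : 1 ≤ s) (ht1 : 1 ≤ t) (φ : Evaluation R) {s₀ s₁ t₀ t₁ : R}
    (hs : φ.val s₀ = s) (hs' : φ.val s₁ = s - 1) (ht : φ.val t₀ = t) (ht' : φ.val t₁ = t - 1)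
    (hb : isNonfusionColoring s₀ s₁ t₀ t₁ (coloringOf π.parts) = true) : ¬ IsFusion I π := by
  have hval := val_colorCoeff π φ hs hs' ht ht'
  rw [h.isFusion_iff hs1 ht1 π, ← and_assoc, ← isProperColoring_iff, ← isConverseClosed_iff]
  simp only [isNonfusionColoring, Bool.or_eq_true, Bool.not_eq_true'] at hb
  rintro ⟨h1, -, h3⟩
  simp only [h1, Bool.true_eq_false, false_or, testNeg, List.any_eq_true, Bool.and_eq_true,
    Bool.or_eq_true, sameIndex_iff, color_coloringOf] at hb
  obtain ⟨⟨i, j, k, k'⟩, -, hk, hlt⟩ := hb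
  have h4 := h3 _ ((mem_insert_parts_iff π).2 ⟨i, rfl⟩) _
    ((mem_insert_parts_iff π).2 ⟨j, rfl⟩) _ ((mem_insert_parts_iff π).2 ⟨k, rfl⟩) k
    ((mem_blockAt π).2 (Or.inl rfl)) k'
    ((mem_blockAt π).2 ((leastIndex_eq_iff π k k').1 hk))
  rw [← hval, ← hval] at h4
  rcases hlt with hlt | hlt
  · exact (φ.val_lt _ _ hlt).ne h4
  · exact (φ.val_lt _ _ hlt).ne' h4

end Criterion

/-- The colourings of the table pass the test for fusions, and the others the one for
non-fusions. -/
def tableCorrect {R : Type} [Zero R] [One R] [Add R] [Mul R] [CoeffOrder R] (s s' t t' : R)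
    (two eq tOne sOne sThree tThree : Bool) : Bool :=
  ((tableColorings two eq tOne sOne sThree tThree).all fun r =>
      !r.1 || isFusionColoring s s' t t' r.2) &&
    (colorings 7).all fun l => isNonfusionColoring s s' t t' l ||
      isTableColoring two eq tOne sOne sThree tThree l

/-- The classification for all parameters that are values of the given polynomials, provided that
the boolean test succeeds for these polynomials. -/
theorem IsGQ.isFusion_iff_inFusionTable_of_tableCorrect
    {R : Type} [Zero R] [One R] [Add R] [Mul R] [CoeffOrder R]
    {P L : Type*} {I : P → L → Prop} {s t : ℕ}
    (h : IsGQ I s t) (hs1 : 1 ≤ s) (ht1 : 1 ≤ t) (φ : Evaluation R) {s₀ s₁ t₀ t₁ : R}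
    (hs : φ.val s₀ = s) (hs' : φ.val s₁ = s - 1) (ht : φ.val t₀ = t) (ht' : φ.val t₁ = t - 1)
    {two eq tOne sOne sThree tThree : Bool}
    (h1 : two = true ↔ s = 2 ∧ t = 2) (h2 : eq = true ↔ s = t) (h3 : tOne = true ↔ t = 1)
    (h4 : sOne = true ↔ s = 1) (h5 : sThree = true ↔ s = 3 ∧ t = 1)
    (h6 : tThree = true ↔ t = 3 ∧ s = 1)
    (hall : tableCorrect s₀ s₁ t₀ t₁ two eq tOne sOne sThree tThree = true)
    (π : Finpartition ({0}ᶜ : Finset (Fin 8))) :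
    IsFusion I π ↔ InFusionTable s t π.parts ∨ InFusionTable t s (dualBlocks π.parts) := by
  rw [inFusionTable_iff π s t h1 h2 h3 h4 h5 h6]
  simp only [tableCorrect, Bool.and_eq_true, List.all_eq_true, Bool.or_eq_true,
    Bool.not_eq_true'] at hall
  constructor
  · intro hπ
    have hconv := (isConverseClosed_iff π).2 ((h.isFusion_iff hs1 ht1 π).1 hπ).2.2.1
    refine (hall.2 _ (coloringOf_mem_colorings π hconv)).resolve_left fun hneg => ?_
    exact h.not_isFusion_of_isNonfusionColoring π hs1 ht1 φ hs hs' ht ht' hneg hπ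
  · intro htab
    rw [isTableColoring, List.any_eq_true] at htab
    obtain ⟨r, hr, htab⟩ := htab
    rw [Bool.and_eq_true] at htab
    have hlen : ∀ r ∈ tableColorings two eq tOne sOne sThree tThree, r.2.length = 8 := by
      simp [tableColorings]
    rw [← coloringOf_eq_iff π (hlen r hr)] at htab
    apply h.isFusion_of_isFusionColoring π hs1 ht1 φ hs hs' ht ht'
    rw [htab.1]
    exact (hall.1 r hr).resolve_left (by simp [htab.2])

namespace IsGQ

variable {P L : Type*} {I : P → L → Prop} {s t : ℕ}

/-- The polynomial `a + b x`, as a list of coefficients. -/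
abbrev linearPoly (a b : ℕ) : CoeffList ℕ := ⟨[a, b]⟩

/-- The polynomial `a + b y + c x`, as a list of coefficients. -/
abbrev linearPolyTwo (a b c : ℕ) : CoeffList (CoeffList ℕ) := ⟨[⟨[a, b]⟩, ⟨[c]⟩]⟩

theorem val_linearPoly (a b x : ℕ) :
    (Evaluation.nat.poly x).val (linearPoly a b) = a + b * x := by
  change a + x * (b + x * 0) = _
  ring

theorem val_linearPolyTwo (a b c x y : ℕ) :
    ((Evaluation.nat.poly y).poly x).val (linearPolyTwo a b c) = a + b * y + c * x := by
  change (a + y * (b + y * 0)) + x * ((c + y * 0) + x * 0) = _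
  ring

theorem tableCorrect_of_four_le_of_one :
    tableCorrect (linearPoly 4 1) (linearPoly 3 1) (linearPoly 1 0) (linearPoly 0 0)
      false false true false false false = true := by decide +kernel

theorem tableCorrect_three_one : tableCorrect 3 2 1 0 false false true false true false = true := by
  decide +kernel

theorem tableCorrect_two_one : tableCorrect 2 1 1 0 false false true false false false = true := by
  decide +kernel

theorem tableCorrect_one_of_four_le :
    tableCorrect (linearPoly 1 0) (linearPoly 0 0) (linearPoly 4 1) (linearPoly 3 1)
      false false false true false false = true := by decide +kernel

theorem tableCorrect_one_three : tableCorrect 1 0 3 2 false false false true false true = true := by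
  decide +kernel

theorem tableCorrect_one_two : tableCorrect 1 0 2 1 false false false true false false = true := by
  decide +kernel

theorem tableCorrect_two_two : tableCorrect 2 1 2 1 true true false false false false = true := by
  decide +kernel

theorem tableCorrect_of_eq :
    tableCorrect (linearPoly 3 1) (linearPoly 2 1) (linearPoly 3 1) (linearPoly 2 1)
      false true false false false false = true := by decide +kernel

theorem tableCorrect_of_three_le_of_two :
    tableCorrect (linearPoly 3 1) (linearPoly 2 1) (linearPoly 2 0) (linearPoly 1 0)
      false false false false false false = true := by decide +kernel

theorem tableCorrect_two_of_three_le :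
    tableCorrect (linearPoly 2 0) (linearPoly 1 0) (linearPoly 3 1) (linearPoly 2 1)
      false false false false false false = true := by decide +kernel

theorem tableCorrect_of_gt :
    tableCorrect (linearPolyTwo 4 1 1) (linearPolyTwo 3 1 1) (linearPolyTwo 3 1 0)
      (linearPolyTwo 2 1 0) false false false false false false = true := by decide +kernel

theorem tableCorrect_of_lt :
    tableCorrect (linearPolyTwo 3 1 0) (linearPolyTwo 2 1 0) (linearPolyTwo 4 1 1)
      (linearPolyTwo 3 1 1) false false false false false false = true := by decide +kernel

/-- The fusions of the flag scheme are those in the table and their duals. The range of `(s, t)` is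
cut into pieces on which the differences of the coefficients that matter have constant sign. -/
theorem isFusion_iff_inFusionTable (h : IsGQ I s t) (hs : 1 ≤ s) (ht : 1 ≤ t)
    (hst : (s, t) ≠ (1, 1)) (π : Finpartition ({0}ᶜ : Finset (Fin 8))) :
    IsFusion I π ↔ InFusionTable s t π.parts ∨ InFusionTable t s (dualBlocks π.parts) := by
  have hst' : ¬ (s = 1 ∧ t = 1) := fun e => hst (by rw [e.1, e.2])
  have key {R : Type} [Zero R] [One R] [Add R] [Mul R] [CoeffOrder R] (φ : Evaluation R)
      {s₀ s₁ t₀ t₁ : R} {two eq tOne sOne sThree tThree : Bool}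
      (hall : tableCorrect s₀ s₁ t₀ t₁ two eq tOne sOne sThree tThree = true) :=
    h.isFusion_iff_inFusionTable_of_tableCorrect hs ht φ (s₀ := s₀) (s₁ := s₁) (t₀ := t₀)
      (t₁ := t₁) (two := two) (eq := eq) (tOne := tOne) (sOne := sOne) (sThree := sThree)
      (tThree := tThree) (hall := hall) (π := π)
  have hval := val_linearPoly
  have hval2 := val_linearPolyTwo
  -- The regimes are separated by `t = 1`, `s = 1`, and the order of `s` and `t`. In each of them
  -- `s` and `t` are natural polynomials in variables that range over all natural numbers.
  rcases Nat.lt_or_ge t 2 with ht2 | ht2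
  · obtain rfl : t = 1 := by omega
    rcases Nat.lt_or_ge s 4 with hs4 | hs4
    · obtain rfl | rfl : s = 2 ∨ s = 3 := by omega
      · apply key Evaluation.nat tableCorrect_two_one <;> first | rfl | simp
      · apply key Evaluation.nat tableCorrect_three_one <;> first | rfl | simp
    · obtain ⟨x, rfl⟩ := Nat.exists_eq_add_of_le hs4
      apply key (Evaluation.nat.poly x) tableCorrect_of_four_le_of_one <;>
        simp only [hval, Bool.false_eq_true, false_iff] <;> omega
  rcases Nat.lt_or_ge s 2 with hs2 | hs2
  · obtain rfl : s = 1 := by omega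
    rcases Nat.lt_or_ge t 4 with ht4 | ht4
    · obtain rfl | rfl : t = 2 ∨ t = 3 := by omega
      · apply key Evaluation.nat tableCorrect_one_two <;> first | rfl | simp
      · apply key Evaluation.nat tableCorrect_one_three <;> first | rfl | simp
    · obtain ⟨x, rfl⟩ := Nat.exists_eq_add_of_le ht4
      apply key (Evaluation.nat.poly x) tableCorrect_one_of_four_le <;>
        simp only [hval, Bool.false_eq_true, false_iff] <;> omega
  rcases lt_trichotomy s t with hlt | rfl | hlt
  · rcases Nat.lt_or_ge s 3 with hs3 | hs3
    · obtain rfl : s = 2 := by omega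
      obtain ⟨x, rfl⟩ := Nat.exists_eq_add_of_le (show 3 ≤ t from hlt)
      apply key (Evaluation.nat.poly x) tableCorrect_two_of_three_le <;>
        simp only [hval, Bool.false_eq_true, false_iff] <;> omega
    · obtain ⟨y, rfl⟩ := Nat.exists_eq_add_of_le hs3
      obtain ⟨x, rfl⟩ := Nat.exists_eq_add_of_lt hlt
      apply key ((Evaluation.nat.poly y).poly x) tableCorrect_of_lt <;>
        simp only [hval2, Bool.false_eq_true, false_iff] <;> omega
  · rcases Nat.lt_or_ge s 3 with hs3 | hs3
    · obtain rfl : s = 2 := by omega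
      apply key Evaluation.nat tableCorrect_two_two <;> first | rfl | simp
    · obtain ⟨x, rfl⟩ := Nat.exists_eq_add_of_le hs3
      apply key (Evaluation.nat.poly x) tableCorrect_of_eq <;>
        simp only [hval, Bool.false_eq_true, false_iff] <;> omega
  · rcases Nat.lt_or_ge t 3 with ht3 | ht3
    · obtain rfl : t = 2 := by omega
      obtain ⟨x, rfl⟩ := Nat.exists_eq_add_of_le (show 3 ≤ s from hlt)
      apply key (Evaluation.nat.poly x) tableCorrect_of_three_le_of_two <;>
        simp only [hval, Bool.false_eq_true, false_iff] <;> omega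
    · obtain ⟨y, rfl⟩ := Nat.exists_eq_add_of_le ht3
      obtain ⟨x, rfl⟩ := Nat.exists_eq_add_of_lt hlt
      apply key ((Evaluation.nat.poly y).poly x) tableCorrect_of_gt <;>
        simp only [hval2, Bool.false_eq_true, false_iff] <;> omega

end IsGQ

/-! ### Point graphs -/

/-- A map all of whose fibres have `n` elements is the first projection of a product with `Fin n`,
up to a bijection. -/
theorem exists_equiv_fin_prod {X Y : Type*} [Finite X] (f : X → Y) {m n : ℕ}
    (hf : ∀ y, {x | f x = y}.ncard = n) (e : Y ≃ Fin m) :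
    ∃ e' : X ≃ Fin m × Fin n, ∀ x, (e' x).1 = e (f x) := by
  have h1 : ∀ y, Nonempty ({x // f x = y} ≃ Fin n) := fun y =>
    ⟨Finite.equivFinOfCardEq (by rw [← hf y]; rfl)⟩
  let g := fun y => (h1 y).some
  refine ⟨(Equiv.sigmaFiberEquiv f).symm.trans ((Equiv.sigmaCongrRight g).trans
    ((Equiv.sigmaEquivProd Y (Fin n)).trans (Equiv.prodCongr e (Equiv.refl _)))), fun x => rfl⟩

/-- A criterion for strong regularity by cardinalities of sets, without decidability. -/
theorem isSRGWith_comap_of_ncard {V : Type*} (G : SimpleGraph V) {n k l m : ℕ} (e : Fin n ≃ V)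
    [DecidableRel (G.comap e).Adj] (hk : ∀ v, {w | G.Adj v w}.ncard = k)
    (hl : ∀ v w, G.Adj v w → {u | G.Adj v u ∧ G.Adj u w}.ncard = l)
    (hm : ∀ v w, v ≠ w → ¬ G.Adj v w → {u | G.Adj v u ∧ G.Adj u w}.ncard = m) :
    (G.comap e).IsSRGWith n k l m := by
  have hpre : ∀ S : Set V, (e ⁻¹' S).ncard = S.ncard := fun S =>
    Set.ncard_preimage_of_injective_subset_range e.injective (by simp)
  have hcommon : ∀ v w, Fintype.card ((G.comap e).commonNeighbors v w) =
      {u | G.Adj (e v) u ∧ G.Adj u (e w)}.ncard := by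
    intro v w
    rw [← Nat.card_eq_fintype_card, Nat.card_coe_set_eq, ← hpre]
    congr 1
    ext u
    simp [SimpleGraph.mem_commonNeighbors, G.adj_comm (e w) (e u)]
  refine ⟨Fintype.card_fin n, fun v => ?_, fun v w h => ?_, fun v w hvw h => ?_⟩
  · rw [← hk (e v), ← hpre, ← SimpleGraph.card_neighborSet_eq_degree, ← Nat.card_eq_fintype_card,
      Nat.card_coe_set_eq]
    rfl
  · exact (hcommon v w).trans (hl _ _ h)
  · exact (hcommon v w).trans (hm _ _ (e.injective.ne hvw) h)

namespace IsGQ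

variable {P L : Type*} {I : P → L → Prop} {s t : ℕ}

theorem ncard_flags_on_point (h : IsGQ I s t) (p : P) :
    {x : IncFlag I | x.1.1 = p}.ncard = t + 1 := by
  rw [← h.lines_on_point p]
  refine Set.ncard_congr (fun x _ => x.1.2) ?_ ?_ ?_
  · rintro x rfl
    exact x.2
  · rintro x y rfl hy hxy
    exact Subtype.ext (Prod.ext hy.symm hxy)
  · intro l hl
    exact ⟨⟨(p, l), hl⟩, rfl, rfl⟩

theorem ncard_flags_over (h : IsGQ I s t) (Q : Set P) :
    {x : IncFlag I | x.1.1 ∈ Q}.ncard = Q.ncard * (t + 1) := by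
  have := h.finite_points
  have := h.finite_flags
  obtain ⟨e', he'⟩ := exists_equiv_fin_prod
    (fun x : {x : IncFlag I | x.1.1 ∈ Q} => (⟨x.1.1.1, x.2⟩ : Q)) (n := t + 1)
    (fun p => by
      rw [← h.ncard_flags_on_point p.1]
      refine Set.ncard_congr (fun x _ => x.1) ?_ ?_ ?_
      · rintro x hx
        exact congrArg Subtype.val hx
      · rintro x y _ _ hxy
        exact Subtype.ext hxy
      · intro x hx
        exact ⟨⟨x, by rw [Set.mem_ofPred_eq, hx]; exact p.2⟩, Subtype.ext hx, rfl⟩)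
    (Finite.equivFin Q)
  rw [← Nat.card_coe_set_eq, Nat.card_congr e', Nat.card_prod, Nat.card_fin, Nat.card_fin,
    Nat.card_coe_set_eq]

theorem card_points (h : IsGQ I s t) : Nat.card P = (s * t + 1) * (s + 1) := by
  have h1 := h.ncard_flags_over Set.univ
  simp only [Set.mem_univ] at h1
  rw [show {x : IncFlag I | True} = Set.univ from rfl, Set.ncard_univ, Set.ncard_univ,
    h.card_flags] at h1
  apply Nat.eq_of_mul_eq_mul_right (Nat.succ_pos t)
  rw [Nat.succ_eq_add_one, ← h1]
  ring

theorem card_lines (h : IsGQ I s t) : Nat.card L = (s * t + 1) * (t + 1) := by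
  rw [h.dual.card_points, mul_comm s t]

theorem classRel_one_iff (x y : IncFlag I) :
    classRel I {1} x y ↔ x.1.1 = y.1.1 ∧ x ≠ y := by
  rw [classRel_singleton]
  change x.1.1 = y.1.1 ∧ x.1.2 ≠ y.1.2 ↔ _
  refine and_congr_right fun h => not_congr ⟨fun h' => Subtype.ext (Prod.ext h h'), ?_⟩
  rintro rfl
  rfl

theorem classRel_two_three_four_five_iff (x y : IncFlag I) :
    classRel I {2, 3, 4, 5} x y ↔ (pointGraph I).Adj x.1.1 y.1.1 := by
  constructor
  · rintro ⟨i, hi, hxy⟩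
    simp only [Finset.mem_insert, Finset.mem_singleton] at hi
    rcases hi with rfl | rfl | rfl | rfl
    · exact ⟨hxy.2, _, x.2, by rw [hxy.1]; exact y.2⟩
    · exact ⟨hxy.2.1, _, x.2, hxy.2.2⟩
    · exact ⟨hxy.2.1, _, hxy.2.2, y.2⟩
    · exact ⟨hxy.1, hxy.2.imp fun n hn => ⟨hn.1, hn.2.1⟩⟩
  · rintro ⟨hp, n, hx, hy⟩
    by_cases hl : x.1.2 = y.1.2
    · exact ⟨2, by decide, hl, hp⟩
    · by_cases h3 : n = x.1.2
      · exact ⟨3, by decide, hl, hp, h3 ▸ hy⟩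
      · by_cases h4 : n = y.1.2
        · exact ⟨4, by decide, hl, hp, h4 ▸ hx⟩
        · exact ⟨5, by decide, hp, n, hx, hy, h3, h4⟩

theorem classRel_six_seven_iff (h : IsGQ I s t) (x y : IncFlag I) :
    classRel I {6, 7} x y ↔ x.1.1 ≠ y.1.1 ∧ ¬ (pointGraph I).Adj x.1.1 y.1.1 := by
  obtain ⟨k, hk, -⟩ := h.existsUnique_flagRel x y
  have h01 : x.1.1 = y.1.1 ↔ k ∈ ({0, 1} : Finset (Fin 8)) := by
    rw [← h.classRel_iff_mem hk]
    constructor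
    · intro hp
      by_cases hl : x.1.2 = y.1.2
      · exact ⟨0, by decide, Subtype.ext (Prod.ext hp hl)⟩
      · exact ⟨1, by decide, hp, hl⟩
    · rintro ⟨i, hi, hxy⟩
      simp only [Finset.mem_insert, Finset.mem_singleton] at hi
      rcases hi with rfl | rfl
      · have hxy : x = y := hxy
        rw [hxy]
      · exact hxy.1
  rw [← classRel_two_three_four_five_iff, h.classRel_iff_mem hk, h.classRel_iff_mem hk, Ne, h01]
  clear hk h01
  revert k
  decide

/-- The coefficients that count, in flags, the common neighbours in the point graph. -/
theorem blockCoeff_two_three_four_five (hs : 1 ≤ s) (ht : 1 ≤ t) (k : Fin 8) :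
    blockCoeff s t {2, 3, 4, 5} {2, 3, 4, 5} k =
      (![s * (t + 1), s * (t + 1), s - 1, s - 1, s - 1, s - 1, t + 1, t + 1] k) * (t + 1) := by
  obtain ⟨s, rfl⟩ := Nat.exists_eq_add_of_le' hs
  obtain ⟨t, rfl⟩ := Nat.exists_eq_add_of_le' ht
  fin_cases k <;>
    simp [blockCoeff, heckeCoeff, heckeMul, heckeMulOne, heckeMulTwo] <;> ring

theorem ncard_common_neighbors (h : IsGQ I s t) (hs : 1 ≤ s) (ht : 1 ≤ t) {x y : IncFlag I}
    {k : Fin 8} (hk : flagRel I k x y) :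
    {p | (pointGraph I).Adj x.1.1 p ∧ (pointGraph I).Adj p y.1.1}.ncard =
      ![s * (t + 1), s * (t + 1), s - 1, s - 1, s - 1, s - 1, t + 1, t + 1] k := by
  have h1 := h.ncard_classRel {2, 3, 4, 5} {2, 3, 4, 5} hk
  simp only [classRel_two_three_four_five_iff] at h1
  have h2 := h.ncard_flags_over
    {p | (pointGraph I).Adj x.1.1 p ∧ (pointGraph I).Adj p y.1.1}
  simp only [Set.mem_ofPred_eq] at h2
  rw [h2, blockCoeff_two_three_four_five hs ht] at h1
  exact Nat.eq_of_mul_eq_mul_right (Nat.succ_pos t) h1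

theorem exists_flag_on (h : IsGQ I s t) (p : P) : ∃ x : IncFlag I, x.1.1 = p := by
  have : {x : IncFlag I | x.1.1 = p}.Nonempty := by
    apply Set.nonempty_of_ncard_ne_zero
    rw [h.ncard_flags_on_point]; omega
  exact this

/-- The point graph of a generalized quadrangle is strongly regular. -/
theorem isSRGWith_pointGraph {n : ℕ} (e : Fin n ≃ P) [DecidableRel ((pointGraph I).comap e).Adj]
    (h : IsGQ I s t) (hs : 1 ≤ s) (ht : 1 ≤ t) :
    ((pointGraph I).comap e).IsSRGWith n (s * (t + 1)) (s - 1) (t + 1) := by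
  have key := fun x y k => h.ncard_common_neighbors hs ht (x := x) (y := y) (k := k)
  refine isSRGWith_comap_of_ncard _ e ?_ ?_ ?_
  · intro p
    obtain ⟨x, rfl⟩ := h.exists_flag_on p
    have h1 := key x x 0 rfl
    simp only [(pointGraph I).adj_comm _ x.1.1, and_self] at h1
    exact h1
  · intro p q hpq
    obtain ⟨x, rfl⟩ := h.exists_flag_on p
    obtain ⟨y, rfl⟩ := h.exists_flag_on q
    obtain ⟨i, hi, hxy⟩ := (classRel_two_three_four_five_iff x y).2 hpq
    rw [key x y i hxy]
    simp only [Finset.mem_insert, Finset.mem_singleton] at hi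
    rcases hi with rfl | rfl | rfl | rfl <;> rfl
  · intro p q hne hpq
    obtain ⟨x, rfl⟩ := h.exists_flag_on p
    obtain ⟨y, rfl⟩ := h.exists_flag_on q
    obtain ⟨i, hi, hxy⟩ := (h.classRel_six_seven_iff x y).2 ⟨hne, hpq⟩
    rw [key x y i hxy]
    simp only [Finset.mem_insert, Finset.mem_singleton] at hi
    rcases hi with rfl | rfl <;> rfl

theorem classRel_one_iso (h : IsGQ I s t) : Nonempty (classRel I {1} ≃r
    (disjointCompletes ((s * t + 1) * (s + 1)) (t + 1)).Adj) := by
  have := h.finite_points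
  have := h.finite_flags
  let e : P ≃ Fin ((s * t + 1) * (s + 1)) := Finite.equivFinOfCardEq h.card_points
  obtain ⟨e', he'⟩ := exists_equiv_fin_prod (fun x : IncFlag I => x.1.1) h.ncard_flags_on_point e
  refine ⟨e', ?_⟩
  intro x y
  change (e' x).1 = (e' y).1 ∧ (e' x).2 ≠ (e' y).2 ↔ _
  rw [classRel_one_iff, he', he', e.injective.eq_iff]
  refine and_congr_right fun hp => not_congr ⟨fun h2 => ?_, fun hxy => hxy ▸ rfl⟩
  apply e'.injective
  exact Prod.ext (by rw [he', he', hp]) h2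

theorem isSRGTensorJ_pointGraph (h : IsGQ I s t) (hs : 1 ≤ s) (ht : 1 ≤ t) :
    IsSRGTensorJ ((s * t + 1) * (s + 1)) (s * (t + 1)) (s - 1) (t + 1) (t + 1)
      (classRel I {2, 3, 4, 5}) (classRel I {6, 7}) (classRel I {1}) := by
  classical
  have := h.finite_points
  have := h.finite_flags
  let e : P ≃ Fin ((s * t + 1) * (s + 1)) := Finite.equivFinOfCardEq h.card_points
  obtain ⟨e', he'⟩ := exists_equiv_fin_prod (fun x : IncFlag I => x.1.1) h.ncard_flags_on_point e
  have hne : ∀ x y : IncFlag I, x.1.1 = y.1.1 → ((e' x).2 ≠ (e' y).2 ↔ x ≠ y) := by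
    intro x y hp
    refine not_congr ⟨fun h2 => ?_, fun hxy => hxy ▸ rfl⟩
    exact e'.injective (Prod.ext (by rw [he', he', hp]) h2)
  refine ⟨(pointGraph I).comap e.symm, Classical.decRel _, e',
    h.isSRGWith_pointGraph e.symm hs ht, fun x y => ⟨?_, ?_, ?_⟩⟩
  · rw [classRel_two_three_four_five_iff, SimpleGraph.comap_adj, he', he', e.symm_apply_apply,
      e.symm_apply_apply]
  · rw [h.classRel_six_seven_iff, SimpleGraph.comap_adj, he', he', e.symm_apply_apply,
      e.symm_apply_apply, Ne, Ne, e.injective.eq_iff]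
  · rw [classRel_one_iff, he', he', e.injective.eq_iff]
    exact and_congr_right fun hp => (hne x y hp).symm

end IsGQ

theorem classRel_one_two_iff {P L : Type*} (I : P → L → Prop) (x y : IncFlag I) :
    classRel I {1, 2} x y ↔ (pointGraph (dualInc (doubleInc I))).Adj x y := by
  have hne : x ≠ y ↔ ¬ (x.1.1 = y.1.1 ∧ x.1.2 = y.1.2) :=
    not_congr ⟨fun h => h ▸ ⟨rfl, rfl⟩, fun h => Subtype.ext (Prod.ext h.1 h.2)⟩
  constructor
  · rintro ⟨i, hi, hxy⟩
    simp only [Finset.mem_insert, Finset.mem_singleton] at hi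
    rcases hi with rfl | rfl
    · exact ⟨hne.2 fun e => hxy.2 e.2, Sum.inl x.1.1, rfl, hxy.1.symm⟩
    · exact ⟨hne.2 fun e => hxy.2 e.1, Sum.inr x.1.2, rfl, hxy.1.symm⟩
  · rintro ⟨h1, v | v, hx, hy⟩
    · have hp : x.1.1 = y.1.1 := hx.trans hy.symm
      exact ⟨1, by decide, hp, fun hl => hne.1 h1 ⟨hp, hl⟩⟩
    · have hl : x.1.2 = y.1.2 := hx.trans hy.symm
      exact ⟨2, by decide, hl, fun hp => hne.1 h1 ⟨hp, hl⟩⟩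

/-! ### Generalized quadrangles with two lines on each point -/

/-- The index of the relation between two flags of a grid. The flag `(o, a, b)` has line number `a`
in the parallel class `o`, and the other line on its point has number `b` in the other class. -/
def gridIndex {n : ℕ} (u v : Fin 2 × Fin n × Fin n) : Fin 8 :=
  if u.1 = v.1 then
    if u.2.1 = v.2.1 then if u.2.2 = v.2.2 then 0 else 2 else if u.2.2 = v.2.2 then 5 else 7
  else
    if u.2.1 = v.2.2 then if u.2.2 = v.2.1 then 1 else 3 else if u.2.2 = v.2.1 then 4 else 6

namespace IsGQ

variable {P L : Type*} {I : P → L → Prop} {s : ℕ}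

/-- When every point is on two lines, the lines fall into two parallel classes. -/
theorem exists_parallel_classes (h : IsGQ I s 1) : ∃ c : L → Fin 2,
    (∀ p l m, I p l → I p m → l ≠ m → c l ≠ c m) ∧ ∀ l m, c l ≠ c m → ∃ p, I p l ∧ I p m := by
  classical
  obtain ⟨l₀⟩ := h.nonempty_lines
  -- Class `1` consists of the lines that meet `l₀` in a single point.
  let Q : L → Prop := fun l => l ≠ l₀ ∧ ∃ p, I p l ∧ I p l₀
  have hpair : ∀ p l m n, I p l → I p m → I p n → l ≠ m → n = l ∨ n = m := by
    intro p l m n hl hm hn hlm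
    have := h.finite_lines
    by_contra! hcon
    have h1 : ({l, m, n} : Set L).ncard = 3 :=
      Set.ncard_eq_three.2 ⟨l, m, n, hlm, hcon.1.symm, hcon.2.symm, rfl⟩
    have h2 : ({l, m, n} : Set L).ncard ≤ {l | I p l}.ncard :=
      Set.ncard_le_ncard (by rintro x (rfl | rfl | rfl) <;> assumption)
    rw [h.lines_on_point, h1] at h2
    omega
  have hother : ∀ p l, I p l → ∃ m, I p m ∧ m ≠ l := by
    intro p l hl
    have h1 : 1 < {l | I p l}.ncard := by rw [h.lines_on_point]; norm_num
    obtain ⟨m, hm, hne⟩ := Set.exists_ne_of_one_lt_ncard h1 l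
    exact ⟨m, hm, hne⟩
  -- Of two lines on a point exactly one meets `l₀` in a single point.
  have hQ : ∀ p l m, I p l → I p m → l ≠ m → (Q l ↔ ¬ Q m) := by
    intro p l m hl hm hlm
    by_cases hp : I p l₀
    · rcases hpair p l m l₀ hl hm hp hlm with rfl | rfl
      · exact iff_of_false (fun hq => hq.1 rfl) (not_not.2 ⟨hlm.symm, p, hm, hp⟩)
      · exact iff_of_true ⟨hlm, p, hl, hp⟩ fun hq => hq.1 rfl
    · obtain ⟨q, n, hn, hqn, hq⟩ := h.exists_proj hp
      have hne : n ≠ l₀ := fun e => hp (e ▸ hn)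
      have huniq : ∀ k, I p k → Q k → k = n := by
        rintro k hk ⟨-, r, hr, hr0⟩
        exact (h.no_triangle hp hr0 hq hk hr hn hqn).2
      rcases hpair p l m n hl hm hn hlm with rfl | rfl
      · exact iff_of_true ⟨hne, q, hqn, hq⟩ fun hq => hlm (huniq m hm hq).symm
      · exact iff_of_false (fun hq => hlm (huniq l hl hq)) (not_not.2 ⟨hne, q, hqn, hq⟩)
  have hmeet : ∀ l m, Q l → ¬ Q m → ∃ p, I p l ∧ I p m := by
    rintro l m ⟨hl, q, hql, hq⟩ hm
    by_cases hm0 : m = l₀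
    · exact ⟨q, hql, hm0 ▸ hq⟩
    · have hqm : ¬ I q m := fun hqm => hm ⟨hm0, q, hqm, hq⟩
      obtain ⟨r, n, hqn, hrn, hr⟩ := h.exists_proj hqm
      have hn : n ≠ l₀ := fun e => hm ⟨hm0, r, hr, e ▸ hrn⟩
      rcases hpair q l l₀ n hql hq hqn hl with rfl | rfl
      · exact ⟨r, hrn, hr⟩
      · exact absurd rfl hn
  refine ⟨fun l => if Q l then 1 else 0, ?_, ?_⟩
  · intro p l m hl hm hlm
    have := hQ p l m hl hm hlm
    by_cases hq : Q m <;> simp_all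
  · intro l m hlm
    by_cases hl : Q l <;> by_cases hm : Q m
    · simp [hl, hm] at hlm
    · exact hmeet l m hl hm
    · obtain ⟨p, hp, hp'⟩ := hmeet m l hm hl
      exact ⟨p, hp', hp⟩
    · simp [hl, hm] at hlm

/-- Coordinates for the flags of a generalized quadrangle with two lines on each point. -/
theorem exists_grid_coordinates (h : IsGQ I s 1) :
    ∃ e : IncFlag I ≃ Fin 2 × Fin (s + 1) × Fin (s + 1),
      ∀ x y, flagRel I (gridIndex (e x) (e y)) x y := by
  obtain ⟨c, hc, hmeet⟩ := h.exists_parallel_classes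
  have hfl := h.finite_lines
  have htwo : ∀ a b d : Fin 2, a ≠ b → d ≠ b → a = d := by decide
  have hcross : ∀ x : IncFlag I, ∃ m, I x.1.1 m ∧ m ≠ x.1.2 := by
    intro x
    have h1 : 1 < {l | I x.1.1 l}.ncard := by rw [h.lines_on_point]; norm_num
    obtain ⟨m, hm, hne⟩ := Set.exists_ne_of_one_lt_ncard h1 x.1.2
    exact ⟨m, hm, hne⟩
  choose k hk hkne using hcross
  have hck : ∀ x, c (k x) ≠ c x.1.2 := fun x => hc _ _ _ (hk x) x.2 (hkne x)
  have hon : ∀ p l m, I p l → I p m → c l = c m → l = m := fun p l m hl hm e => by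
    by_contra hne
    exact hc p l m hl hm hne e
  -- The lines of a parallel class correspond to the points of a line in the other class.
  have hcard : ∀ o, {l | c l = o}.ncard = s + 1 := by
    intro o
    obtain ⟨x⟩ := h.nonempty_flags
    obtain ⟨m, hm⟩ : ∃ m, c m ≠ o := by
      by_cases ho : c x.1.2 = o
      · exact ⟨k x, fun e => hck x (e.trans ho.symm)⟩
      · exact ⟨_, ho⟩
    rw [← h.points_on_line m]
    have hm' : ∀ l, c l = o → c l ≠ c m := fun l e e' => hm (e'.symm.trans e)
    refine Set.ncard_congr (fun l hl => (hmeet l m (hm' l hl)).choose) ?_ ?_ ?_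
    · intro l hl
      exact (hmeet l m (hm' l hl)).choose_spec.2
    · intro l l' hl hl' e
      have h1 := (hmeet l m (hm' l hl)).choose_spec.1
      have h2 := (hmeet l' m (hm' l' hl')).choose_spec.1
      rw [← e] at h2
      exact hon _ _ _ h1 h2 (hl.trans hl'.symm)
    · intro p hp
      have h2 : ∀ l, I p l → l ≠ m → c l = o := fun l hl hne =>
        htwo _ _ _ (hc _ _ _ hl hp hne) hm.symm
      have hl : I p (k ⟨(p, m), hp⟩) := hk ⟨(p, m), hp⟩
      have hne : k ⟨(p, m), hp⟩ ≠ m := hkne ⟨(p, m), hp⟩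
      refine ⟨_, h2 _ hl hne, ?_⟩
      have h3 := (hmeet _ m (hm' _ (h2 _ hl hne))).choose_spec
      exact h.point_unique _ _ hne _ _ h3.1 h3.2 hl hp
  obtain ⟨e, he⟩ := exists_equiv_fin_prod c hcard (Equiv.refl _)
  have he : ∀ l, (e l).1 = c l := he
  have heq : ∀ l m, c l = c m → ((e l).2 = (e m).2 ↔ l = m) := by
    intro l m hlm
    refine ⟨fun h2 => e.injective (Prod.ext ?_ h2), fun h2 => h2 ▸ rfl⟩
    rw [he, he, hlm]
  have hpt : ∀ x y : IncFlag I, I x.1.1 y.1.2 → I x.1.1 (k y) → x.1.1 = y.1.1 := fun x y h1 h2 =>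
    h.point_unique _ _ (hkne y) _ _ h2 h1 (hk y) y.2
  let f : IncFlag I → Fin 2 × Fin (s + 1) × Fin (s + 1) := fun x =>
    (c x.1.2, (e x.1.2).2, (e (k x)).2)
  have hcc : ∀ x y : IncFlag I, c x.1.2 = c y.1.2 → c (k x) = c (k y) := fun x y hxy =>
    htwo _ _ _ (hck x) (hxy ▸ hck y)
  have hrel : ∀ x y, flagRel I (gridIndex (f x) (f y)) x y := by
    intro x y
    by_cases h0 : c x.1.2 = c y.1.2
    · simp only [f, gridIndex, h0, if_true]
      by_cases h1 : x.1.2 = y.1.2 <;> by_cases h2 : k x = k y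
      · rw [if_pos ((heq _ _ h0).2 h1), if_pos ((heq _ _ (hcc x y h0)).2 h2)]
        exact Subtype.ext (Prod.ext (hpt x y (h1 ▸ x.2) (h2 ▸ hk x)) h1)
      · rw [if_pos ((heq _ _ h0).2 h1), if_neg (mt (heq _ _ (hcc x y h0)).1 h2)]
        refine ⟨h1, fun hp => h2 (hon _ _ _ (hk x) ?_ (hcc x y h0))⟩
        rw [hp]; exact hk y
      · rw [if_neg (mt (heq _ _ h0).1 h1), if_pos ((heq _ _ (hcc x y h0)).2 h2)]
        refine ⟨fun hp => h1 (hon _ _ _ x.2 ?_ h0), k x, hk x, h2 ▸ hk y, hkne x, h2 ▸ hkne y⟩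
        rw [hp]; exact y.2
      · rw [if_neg (mt (heq _ _ h0).1 h1), if_neg (mt (heq _ _ (hcc x y h0)).1 h2)]
        refine ⟨fun ⟨r, hr, hr'⟩ => h1 (hon _ _ _ hr hr' h0), fun ⟨n, hn, hn'⟩ => ?_⟩
        by_cases h3 : c n = c x.1.2
        · exact h1 ((hon _ _ _ x.2 hn h3.symm).trans (hon _ _ _ hn' y.2 (h3.trans h0)))
        · exact h2 ((hon _ _ _ (hk x) hn (htwo _ _ _ (hck x) h3)).trans
            (hon _ _ _ hn' (hk y) (htwo _ _ _ (h0 ▸ h3) (hck y))))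
    · have h3 : c x.1.2 = c (k y) := htwo _ _ _ h0 (hck y)
      have h4 : c (k x) = c y.1.2 := htwo _ _ _ (hck x) (Ne.symm h0)
      have hl : x.1.2 ≠ y.1.2 := fun hl => h0 (hl ▸ rfl)
      simp only [f, gridIndex, h0, if_false]
      have hx : I y.1.1 x.1.2 → x.1.2 = k y := fun hi => hon _ _ _ hi (hk y) h3
      have hy : I x.1.1 y.1.2 → k x = y.1.2 := fun hi => hon _ _ _ (hk x) hi h4
      by_cases h1 : x.1.2 = k y <;> by_cases h2 : k x = y.1.2
      · rw [if_pos ((heq _ _ h3).2 h1), if_pos ((heq _ _ h4).2 h2)]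
        exact ⟨hpt x y (h2 ▸ hk x) (h1 ▸ x.2), hl⟩
      · rw [if_pos ((heq _ _ h3).2 h1), if_neg (mt (heq _ _ h4).1 h2)]
        refine ⟨hl, fun hp => h2 (hy ?_), ?_⟩
        · rw [hp]; exact y.2
        · rw [h1]; exact hk y
      · rw [if_neg (mt (heq _ _ h3).1 h1), if_pos ((heq _ _ h4).2 h2)]
        refine ⟨hl, fun hp => h1 (hx ?_), ?_⟩
        · rw [← hp]; exact x.2
        · rw [← h2]; exact hk x
      · rw [if_neg (mt (heq _ _ h3).1 h1), if_neg (mt (heq _ _ h4).1 h2)]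
        obtain ⟨r, hr, hr'⟩ := hmeet _ _ h0
        refine ⟨hl, r, hr, hr', ?_, ?_⟩
        · rintro rfl; exact h2 (hy hr')
        · rintro rfl; exact h1 (hx hr)
  refine ⟨Equiv.ofBijective f ⟨?_, ?_⟩, hrel⟩
  · intro x y hxy
    have := hrel x y
    rw [hxy] at this
    simpa [gridIndex, flagRel] using this
  · rintro ⟨o, a, b⟩
    obtain ⟨o', ho⟩ : ∃ o', o' ≠ o := exists_ne o
    have hl : c (e.symm (o, a)) = o := by rw [← he, e.apply_symm_apply]
    have hm : c (e.symm (o', b)) = o' := by rw [← he, e.apply_symm_apply]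
    obtain ⟨p, hp, hp'⟩ := hmeet (e.symm (o, a)) (e.symm (o', b)) (by rw [hl, hm]; exact ho.symm)
    refine ⟨⟨(p, e.symm (o, a)), hp⟩, ?_⟩
    have h1 : k ⟨(p, e.symm (o, a)), hp⟩ = e.symm (o', b) := by
      refine hon _ _ _ (hk ⟨(p, e.symm (o, a)), hp⟩) hp' (htwo _ _ _ (hck _) ?_)
      change c (e.symm (o', b)) ≠ c (e.symm (o, a))
      rw [hl, hm]
      exact ho
    simp only [f, hl, h1, e.apply_symm_apply]

end IsGQ

section Grid

variable {P L : Type*} {I : P → L → Prop} {s : ℕ}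

theorem IsGQ.classRel_grid (h : IsGQ I s 1) :
    ∃ e : IncFlag I ≃ Fin 2 × Fin (s + 1) × Fin (s + 1),
      ∀ A x y, classRel I A x y ↔ gridIndex (e x) (e y) ∈ A := by
  obtain ⟨e, he⟩ := h.exists_grid_coordinates
  exact ⟨e, fun A x y => h.classRel_iff_mem (he x y)⟩

theorem IsGQ.two_five_seven_iso (h : IsGQ I s 1) :
    Nonempty (classRel I {2, 5, 7} ≃r (disjointCompletes 2 ((s + 1) ^ 2)).Adj) := by
  obtain ⟨e, he⟩ := h.classRel_grid
  let g : Fin (s + 1) × Fin (s + 1) ≃ Fin ((s + 1) ^ 2) :=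
    finProdFinEquiv.trans (finCongr (sq (s + 1)).symm)
  refine ⟨e.trans ((Equiv.refl _).prodCongr g), ?_⟩
  intro x y
  rw [he]
  change (e x).1 = (e y).1 ∧ g (e x).2 ≠ g (e y).2 ↔ _
  rw [g.injective.ne_iff]
  generalize e x = u
  generalize e y = v
  rw [Ne, Prod.ext_iff, gridIndex]
  split_ifs <;> simp_all

theorem IsGQ.five_iso (h : IsGQ I s 1) :
    Nonempty (classRel I {5} ≃r (disjointCompletes (2 * (s + 1)) (s + 1)).Adj) := by
  obtain ⟨e, he⟩ := h.classRel_grid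
  -- Two flags are related when the other lines on their points coincide.
  let g : Fin 2 × Fin (s + 1) × Fin (s + 1) ≃ Fin (2 * (s + 1)) × Fin (s + 1) :=
    ((Equiv.refl _).prodCongr (Equiv.prodComm _ _)).trans
      ((Equiv.prodAssoc _ _ _).symm.trans (finProdFinEquiv.prodCongr (Equiv.refl _)))
  refine ⟨e.trans g, ?_⟩
  intro x y
  rw [he]
  change finProdFinEquiv ((e x).1, (e x).2.2) = finProdFinEquiv ((e y).1, (e y).2.2) ∧
    (e x).2.1 ≠ (e y).2.1 ↔ _
  rw [finProdFinEquiv.injective.eq_iff, Prod.ext_iff]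
  generalize e x = u
  generalize e y = v
  rw [gridIndex]
  split_ifs <;> simp_all

theorem IsGQ.isRectangular (h : IsGQ I s 1) : IsRectangular 2 ((s + 1) ^ 2)
    (classRel I {2, 5, 7}) (classRel I {1}) (classRel I {3, 4, 6}) := by
  obtain ⟨e, he⟩ := h.classRel_grid
  let g : Fin (s + 1) × Fin (s + 1) ≃ Fin ((s + 1) ^ 2) :=
    finProdFinEquiv.trans (finCongr (sq (s + 1)).symm)
  -- The column of a flag is its point, given by its lines in the classes `0` and `1`.
  let k : Fin 2 × Fin (s + 1) × Fin (s + 1) ≃ Fin 2 × Fin (s + 1) × Fin (s + 1) :=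
    Equiv.prodShear (Equiv.refl _) fun o => if o = 0 then Equiv.refl _ else Equiv.prodComm _ _
  have hk : ∀ u v, ((k u).1 = (k v).1 ↔ u.1 = v.1) ∧
      ((k u).2 = (k v).2 ↔ if u.1 = v.1 then u.2 = v.2 else u.2.1 = v.2.2 ∧ u.2.2 = v.2.1) := by
    rintro ⟨o, a, b⟩ ⟨o', a', b'⟩
    refine ⟨Iff.rfl, ?_⟩
    change (if o = 0 then Equiv.refl _ else Equiv.prodComm _ _ : _ ≃ _) (a, b) =
      (if o' = 0 then Equiv.refl _ else Equiv.prodComm _ _ : _ ≃ _) (a', b') ↔ _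
    match o, o' with
    | 0, 0 => simp
    | 0, 1 => simp
    | 1, 0 => simp [and_comm]
    | 1, 1 => simp [and_comm]
  refine ⟨e.trans (k.trans ((Equiv.refl _).prodCongr g)), fun x y => ?_⟩
  rw [he, he, he]
  change (_ ↔ (k (e x)).1 = (k (e y)).1 ∧ g (k (e x)).2 ≠ g (k (e y)).2) ∧
    (_ ↔ (k (e x)).1 ≠ (k (e y)).1 ∧ g (k (e x)).2 = g (k (e y)).2) ∧
    (_ ↔ (k (e x)).1 ≠ (k (e y)).1 ∧ g (k (e x)).2 ≠ g (k (e y)).2)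
  simp only [g.injective.eq_iff, Ne, hk]
  generalize e x = u
  generalize e y = v
  rw [Prod.ext_iff, gridIndex]
  split_ifs <;> simp_all

theorem IsGQ.isDisjointHamming (h : IsGQ I s 1) : IsDisjointHamming 2 (s + 1)
    (classRel I {2, 5}) (classRel I {7}) (classRel I {1, 3, 4, 6}) := by
  obtain ⟨e, he⟩ := h.classRel_grid
  refine ⟨e.trans ((Equiv.refl _).prodCongr (finTwoArrowEquiv (Fin (s + 1))).symm),
    fun x y => ?_⟩
  rw [he, he, he]
  change (_ ↔ (e x).1 = (e y).1 ∧ hammingDist ![(e x).2.1, (e x).2.2] ![(e y).2.1, (e y).2.2] = 1) ∧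
    (_ ↔ (e x).1 = (e y).1 ∧ hammingDist ![(e x).2.1, (e x).2.2] ![(e y).2.1, (e y).2.2] = 2) ∧
    (_ ↔ (e x).1 ≠ (e y).1)
  generalize e x = u
  generalize e y = v
  have hdist : ∀ a b a' b' : Fin (s + 1), hammingDist ![a, b] ![a', b'] =
      (if a = a' then 0 else 1) + if b = b' then 0 else 1 := by
    intro a b a' b'
    rw [hammingDist, Finset.card_filter, Fin.sum_univ_two]
    by_cases h1 : a = a' <;> by_cases h2 : b = b' <;> simp [h1, h2]
  rw [hdist, gridIndex]
  split_ifs <;> simp_all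

theorem IsGQ.isSRGTensorJ_lines (h : IsGQ I s 1) :
    IsSRGTensorJ (2 * (s + 1)) (s + 1) 0 (s + 1) (s + 1)
      (classRel I {1, 3, 4, 6}) (classRel I {2, 7}) (classRel I {5}) := by
  classical
  obtain ⟨e, he⟩ := h.classRel_grid
  let g : Fin 2 × Fin (s + 1) × Fin (s + 1) ≃ Fin (2 * (s + 1)) × Fin (s + 1) :=
    ((Equiv.refl _).prodCongr (Equiv.prodComm _ _)).trans
      ((Equiv.prodAssoc _ _ _).symm.trans (finProdFinEquiv.prodCongr (Equiv.refl _)))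
  -- The complete bipartite graph, with the parallel classes as its parts.
  let G : SimpleGraph (Fin 2 × Fin (s + 1)) :=
    { Adj := fun a b => a.1 ≠ b.1
      symm := ⟨fun _ _ h => h.symm⟩
      loopless := ⟨fun _ h => h rfl⟩ }
  have hfib : ∀ o : Fin 2, {u : Fin 2 × Fin (s + 1) | u.1 = o}.ncard = s + 1 := by
    intro o
    rw [← Nat.card_coe_set_eq, Nat.card_congr (β := Fin (s + 1))
      ⟨fun u => u.1.2, fun a => ⟨(o, a), rfl⟩, fun u => Subtype.ext (Prod.ext u.2.symm rfl),
        fun a => rfl⟩, Nat.card_fin]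
  have hne : ∀ o o' : Fin 2, o ≠ o' ↔ o' = 1 - o := by decide
  refine ⟨G.comap finProdFinEquiv.symm, inferInstance, e.trans g,
    isSRGWith_comap_of_ncard G _ ?_ ?_ ?_, fun x y => ?_⟩
  · rintro ⟨o, a⟩
    change {u : Fin 2 × Fin (s + 1) | o ≠ u.1}.ncard = _
    simp only [hne, hfib]
  · rintro ⟨o, a⟩ ⟨o', a'⟩ hadj
    change {u : Fin 2 × Fin (s + 1) | o ≠ u.1 ∧ u.1 ≠ o'}.ncard = 0
    rw [Set.ncard_eq_zero]
    ext u
    have hadj : o ≠ o' := hadj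
    simp only [Set.mem_ofPred_eq, Set.mem_empty_iff_false, iff_false]
    rintro ⟨h1, h2⟩
    have key : ∀ o o' w : Fin 2, o ≠ o' → o ≠ w → w ≠ o' → False := by decide
    exact key _ _ _ hadj h1 h2
  · rintro ⟨o, a⟩ ⟨o', a'⟩ - hadj
    change {u : Fin 2 × Fin (s + 1) | o ≠ u.1 ∧ u.1 ≠ o'}.ncard = _
    have hadj : o = o' := not_not.1 hadj
    subst hadj
    simp only [ne_comm (b := o), and_self]
    simp only [hne, hfib]
  · rw [he, he, he]
    change (_ ↔ (finProdFinEquiv.symm (finProdFinEquiv ((e x).1, (e x).2.2))).1 ≠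
        (finProdFinEquiv.symm (finProdFinEquiv ((e y).1, (e y).2.2))).1) ∧
      (_ ↔ finProdFinEquiv ((e x).1, (e x).2.2) ≠ finProdFinEquiv ((e y).1, (e y).2.2) ∧
        ¬ (finProdFinEquiv.symm (finProdFinEquiv ((e x).1, (e x).2.2))).1 ≠
          (finProdFinEquiv.symm (finProdFinEquiv ((e y).1, (e y).2.2))).1) ∧
      (_ ↔ finProdFinEquiv ((e x).1, (e x).2.2) = finProdFinEquiv ((e y).1, (e y).2.2) ∧
        (e x).2.1 ≠ (e y).2.1)
    simp only [finProdFinEquiv.injective.eq_iff, Ne, Equiv.symm_apply_apply]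
    generalize e x = u
    generalize e y = v
    rw [Prod.ext_iff, gridIndex]
    split_ifs <;> simp_all

end Grid

/-! ### Distance schemes of cubes -/

/-- A criterion for relations to be the distance relations of a graph of diameter three. -/
theorem isDistanceScheme_of_adj {X V : Type*} (Γ : SimpleGraph V) (e : X ≃ V)
    {R₁ R₂ R₃ : X → X → Prop} (h1 : ∀ x y, R₁ x y ↔ Γ.Adj (e x) (e y))
    (hex : ∀ x y, x = y ∨ R₁ x y ∨ R₂ x y ∨ R₃ x y) (hne2 : ∀ x y, R₂ x y → x ≠ y ∧ ¬ R₁ x y)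
    (hne3 : ∀ x y, R₃ x y → x ≠ y ∧ ¬ R₁ x y) (h2 : ∀ x y, R₂ x y → ∃ z, R₁ x z ∧ R₁ z y)
    (h3 : ∀ x y, R₃ x y → ∃ z, R₁ x z ∧ R₂ z y)
    (h4 : ∀ x y z, R₁ x z → R₁ z y → ¬ R₃ x y) : IsDistanceScheme Γ R₁ R₂ R₃ := by
  have hwalk : ∀ {a b : V} (p : Γ.Walk a b), p.length = 2 → ∃ v, Γ.Adj a v ∧ Γ.Adj v b
    | _, _, .cons ha (.cons hb .nil), _ => ⟨_, ha, hb⟩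
  have d0 : ∀ x, Γ.dist (e x) (e x) = 0 := fun x => SimpleGraph.dist_self
  have d1 : ∀ x y, R₁ x y ↔ Γ.dist (e x) (e y) = 1 := fun x y => by
    rw [h1, SimpleGraph.dist_eq_one_iff_adj]
  have hpos : ∀ x y, x ≠ y → Γ.Reachable (e x) (e y) → Γ.dist (e x) (e y) ≠ 0 :=
    fun x y hxy hr => (hr.pos_dist_of_ne (e.injective.ne hxy)).ne'
  have d2 : ∀ x y, R₂ x y → Γ.Reachable (e x) (e y) ∧ Γ.dist (e x) (e y) = 2 := by
    intro x y hxy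
    obtain ⟨z, hz, hz'⟩ := h2 x y hxy
    let p : Γ.Walk (e x) (e y) := .cons ((h1 _ _).1 hz) (.cons ((h1 _ _).1 hz') .nil)
    have hle : Γ.dist (e x) (e y) ≤ 2 := SimpleGraph.dist_le p
    have := hpos x y (hne2 x y hxy).1 ⟨p⟩
    have : Γ.dist (e x) (e y) ≠ 1 := fun h => (hne2 x y hxy).2 ((d1 x y).2 h)
    exact ⟨⟨p⟩, by omega⟩
  have d3 : ∀ x y, R₃ x y → Γ.dist (e x) (e y) = 3 := by
    intro x y hxy
    obtain ⟨z, hz, hz'⟩ := h3 x y hxy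
    obtain ⟨q, hq⟩ := (d2 z y hz').1.exists_walk_length_eq_dist
    rw [(d2 z y hz').2] at hq
    let p : Γ.Walk (e x) (e y) := .cons ((h1 _ _).1 hz) q
    have hle : Γ.dist (e x) (e y) ≤ 3 := by
      refine (SimpleGraph.dist_le p).trans ?_
      rw [SimpleGraph.Walk.length_cons, hq]
    have := hpos x y (hne3 x y hxy).1 ⟨p⟩
    have : Γ.dist (e x) (e y) ≠ 1 := fun h => (hne3 x y hxy).2 ((d1 x y).2 h)
    have : Γ.dist (e x) (e y) ≠ 2 := by
      intro h
      obtain ⟨r, hr⟩ := SimpleGraph.Reachable.exists_walk_length_eq_dist ⟨p⟩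
      rw [h] at hr
      obtain ⟨v, ha, hb⟩ := hwalk r hr
      refine h4 x y (e.symm v) ?_ ?_ hxy
      · rwa [h1, e.apply_symm_apply]
      · rwa [h1, e.apply_symm_apply]
    omega
  refine ⟨e, fun x y => ⟨d1 x y, ⟨fun h => (d2 x y h).2, fun h => ?_⟩, ⟨d3 x y, fun h => ?_⟩⟩⟩
  · rcases hex x y with rfl | hxy | hxy | hxy
    · rw [d0] at h; omega
    · rw [(d1 x y).1 hxy] at h; omega
    · exact hxy
    · rw [d3 x y hxy] at h; omega
  · rcases hex x y with rfl | hxy | hxy | hxy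
    · rw [d0] at h; omega
    · rw [(d1 x y).1 hxy] at h; omega
    · rw [(d2 x y hxy).2] at h; omega
    · exact hxy

/-- For unions of the flag relations, the combinatorial part of the criterion for distance schemes
can be read off from the structure constants. -/
theorem IsGQ.isDistanceScheme_classRel {P L V : Type*} {I : P → L → Prop} {s t : ℕ}
    (h : IsGQ I s t) (Γ : SimpleGraph V) (e : IncFlag I ≃ V) {A B C : Finset (Fin 8)}
    (hadj : ∀ x y, classRel I A x y ↔ Γ.Adj (e x) (e y))
    (hABC : ∀ k : Fin 8, k = 0 ∨ k ∈ A ∨ k ∈ B ∨ k ∈ C)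
    (hB : ∀ k ∈ B, k ≠ 0 ∧ k ∉ A) (hC : ∀ k ∈ C, k ≠ 0 ∧ k ∉ A)
    (h2 : ∀ k ∈ B, blockCoeff s t A A k ≠ 0) (h3 : ∀ k ∈ C, blockCoeff s t A B k ≠ 0)
    (h4 : ∀ k ∈ C, blockCoeff s t A A k = 0) :
    IsDistanceScheme Γ (classRel I A) (classRel I B) (classRel I C) := by
  have := h.finite_flags
  have hne : ∀ D : Finset (Fin 8), (∀ k ∈ D, k ≠ 0 ∧ k ∉ A) → ∀ x y, classRel I D x y →
      x ≠ y ∧ ¬ classRel I A x y := by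
    rintro D hD x y ⟨k, hk, hxy⟩
    refine ⟨?_, fun hA => (hD k hk).2 ((h.classRel_iff_mem hxy).1 hA)⟩
    rintro rfl
    exact (hD k hk).1 (h.flagRel_inj hxy (show flagRel I 0 x x from rfl))
  refine isDistanceScheme_of_adj Γ e hadj ?_ (hne B hB) (hne C hC) ?_ ?_ ?_
  · intro x y
    obtain ⟨k, hk, -⟩ := h.existsUnique_flagRel x y
    refine (hABC k).imp ?_ (Or.imp (fun hA => ⟨k, hA, hk⟩)
      (Or.imp (fun hA => ⟨k, hA, hk⟩) fun hA => ⟨k, hA, hk⟩))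
    rintro rfl
    exact hk
  · rintro x y ⟨k, hk, hxy⟩
    have := h2 k hk
    rw [← h.ncard_classRel A A hxy] at this
    exact Set.nonempty_of_ncard_ne_zero this
  · rintro x y ⟨k, hk, hxy⟩
    have := h3 k hk
    rw [← h.ncard_classRel A B hxy] at this
    exact Set.nonempty_of_ncard_ne_zero this
  · rintro x y z hxz hzy ⟨k, hk, hxy⟩
    have := h4 k hk
    rw [← h.ncard_classRel A A hxy, Set.ncard_eq_zero] at this
    exact Set.eq_empty_iff_forall_notMem.1 this z ⟨hxz, hzy⟩

/-- The four words of even weight in three letters. -/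
def evenTriple (c : Fin 4) (j : Fin 3) : Bool := c.val != 3 && c.val != j.val

/-- Words of even weight for the flags of the grid with four points on each line: an even triple for
each of the two lines on the point of the flag, complemented for flags on lines of class `1`. -/
def halvedCubeWord (u : Fin 2 × Fin 4 × Fin 4) : Fin 6 → Bool :=
  let a := if u.1 = 0 then u.2.1 else u.2.2
  let b := if u.1 = 0 then u.2.2 else u.2.1
  let d := u.1 == 1
  ![evenTriple a 0 ^^ d, evenTriple a 1 ^^ d, evenTriple a 2 ^^ d,
    evenTriple b 0 ^^ d, evenTriple b 1 ^^ d, evenTriple b 2 ^^ d]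

/-- Vertices of the folded `6`-cube for the flags of the grid with four points on each line: the
word is the same as for the halved cube, but with only the first triple complemented, and it is
reduced to five letters by adding its last letter to the others. -/
def foldedCubeWord (u : Fin 2 × Fin 4 × Fin 4) : Fin 5 → Bool :=
  let a := if u.1 = 0 then u.2.1 else u.2.2
  let b := if u.1 = 0 then u.2.2 else u.2.1
  let d := u.1 == 1
  let f := evenTriple b 2
  ![evenTriple a 0 ^^ d ^^ f, evenTriple a 1 ^^ d ^^ f, evenTriple a 2 ^^ d ^^ f,
    evenTriple b 0 ^^ f, evenTriple b 1 ^^ f]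

theorem even_halvedCubeWord : ∀ u : Fin 2 × Fin 4 × Fin 4,
    Even (Finset.univ.filter fun i => halvedCubeWord u i = true).card := by
  decide +kernel

theorem hammingDist_halvedCubeWord : ∀ u v : Fin 2 × Fin 4 × Fin 4,
    gridIndex u v ∈ ({2, 5, 6} : Finset (Fin 8)) ↔
      hammingDist (halvedCubeWord u) (halvedCubeWord v) = 2 := by
  decide +kernel

theorem halvedCubeWord_injective : Function.Injective halvedCubeWord := by
  unfold Function.Injective
  decide +kernel

theorem hammingDist_foldedCubeWord : ∀ u v : Fin 2 × Fin 4 × Fin 4,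
    gridIndex u v ∈ ({3, 4} : Finset (Fin 8)) ↔ foldedCubeWord u ≠ foldedCubeWord v ∧
      (hammingDist (foldedCubeWord u) (foldedCubeWord v) = 1 ∨
        hammingDist (foldedCubeWord u) (foldedCubeWord v) = 5) := by
  decide +kernel

theorem foldedCubeWord_injective : Function.Injective foldedCubeWord := by
  unfold Function.Injective
  decide +kernel

theorem IsGQ.isDistanceScheme_halvedCube {P L : Type*} {I : P → L → Prop} (h : IsGQ I 3 1) :
    IsDistanceScheme (halvedCube 6) (classRel I {2, 5, 6}) (classRel I {3, 4, 7})
      (classRel I {1}) := by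
  obtain ⟨e, he⟩ := h.classRel_grid
  let w : Fin 2 × Fin 4 × Fin 4 →
      {x : Fin 6 → Bool // Even (Finset.univ.filter fun i => x i = true).card} :=
    fun u => ⟨halvedCubeWord u, even_halvedCubeWord u⟩
  have hw : Function.Bijective w := by
    rw [Fintype.bijective_iff_injective_and_card]
    refine ⟨fun u v huv => halvedCubeWord_injective (congrArg Subtype.val huv), ?_⟩
    decide +kernel
  refine h.isDistanceScheme_classRel _ (e.trans (Equiv.ofBijective w hw)) (fun x y => ?_)
    (by decide) (by decide) (by decide) (by decide +kernel) (by decide +kernel)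
    (by decide +kernel)
  rw [he]
  exact hammingDist_halvedCubeWord _ _

theorem IsGQ.isDistanceScheme_foldedCube {P L : Type*} {I : P → L → Prop} (h : IsGQ I 3 1) :
    IsDistanceScheme (foldedCube 5) (classRel I {3, 4}) (classRel I {2, 5, 7})
      (classRel I {1, 6}) := by
  obtain ⟨e, he⟩ := h.classRel_grid
  have hw : Function.Bijective foldedCubeWord := by
    rw [Fintype.bijective_iff_injective_and_card]
    exact ⟨foldedCubeWord_injective, by simp⟩
  refine h.isDistanceScheme_classRel _ (e.trans (Equiv.ofBijective _ hw)) (fun x y => ?_)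
    (by decide) (by decide) (by decide) (by decide +kernel) (by decide +kernel)
    (by decide +kernel)
  rw [he]
  exact hammingDist_foldedCubeWord _ _

/-! ### The generalized quadrangle of order two -/

namespace IsGQ

variable {P L : Type*} {I : P → L → Prop}

theorem exists_points_of_line (h : IsGQ I 2 2) (l : L) :
    ∃ f : Fin 3 → P, Function.Injective f ∧ ∀ q, I q l ↔ ∃ i, q = f i := by
  have h3 := h.points_on_line l
  have := h.finite_points
  let e : {p | I p l} ≃ Fin 3 := Finite.equivFinOfCardEq h3
  refine ⟨fun i => (e.symm i).1, fun i j hij => e.symm.injective (Subtype.ext hij), fun q => ?_⟩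
  constructor
  · exact fun hq => ⟨e ⟨q, hq⟩, by simp⟩
  · rintro ⟨i, rfl⟩
    exact (e.symm i).2

/-- Three distinct points on a line of a generalized quadrangle of order two are all of them. -/
theorem incident_iff_of_injective (h : IsGQ I 2 2) {l : L} {f : Fin 3 → P}
    (hf : Function.Injective f) (hl : ∀ i, I (f i) l) (q : P) : I q l ↔ ∃ i, q = f i := by
  have := h.finite_points
  have h1 : Set.range f = {p | I p l} := by
    refine Set.eq_of_subset_of_ncard_le ?_ ?_ (Set.toFinite _)
    · rintro _ ⟨i, rfl⟩
      exact hl i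
    · rw [h.points_on_line, ← Set.image_univ, Set.ncard_image_of_injective _ hf, Set.ncard_univ]
      simp
  change q ∈ {p | I p l} ↔ _
  rw [← h1]
  exact exists_congr fun i => eq_comm

theorem exists_third_point (h : IsGQ I 2 2) {l : L} {a b : P} (hab : a ≠ b) (ha : I a l)
    (hb : I b l) : ∃ c, c ≠ a ∧ c ≠ b ∧ I c l ∧ ∀ q, I q l → q = a ∨ q = b ∨ q = c := by
  obtain ⟨f, hf, hl⟩ := h.exists_points_of_line l
  obtain ⟨i, rfl⟩ := (hl a).1 ha
  obtain ⟨j, rfl⟩ := (hl b).1 hb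
  have hij : i ≠ j := fun e => hab (by rw [e])
  obtain ⟨k, hk⟩ : ∃ k, k ≠ i ∧ k ≠ j ∧ ∀ m, m = i ∨ m = j ∨ m = k := by
    clear hl ha hb hab
    revert i j
    decide
  refine ⟨f k, hf.ne hk.1, hf.ne hk.2.1, (hl _).2 ⟨k, rfl⟩, fun q hq => ?_⟩
  obtain ⟨m, rfl⟩ := (hl q).1 hq
  rcases hk.2.2 m with rfl | rfl | rfl <;> simp

/-- Two disjoint lines of a generalized quadrangle of order two span a `3 × 3` grid. -/
theorem exists_grid (h : IsGQ I 2 2) : ∃ (r c : Fin 3 → L) (p : Fin 3 → Fin 3 → P),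
    (∀ i j i' j', p i j = p i' j' → i = i' ∧ j = j') ∧
    (∀ i q, I q (r i) ↔ ∃ j, q = p i j) ∧ ∀ j q, I q (c j) ↔ ∃ i, q = p i j := by
  obtain ⟨r₀⟩ := h.nonempty_lines
  obtain ⟨a, ha, har⟩ := h.exists_points_of_line r₀
  have ha' : ∀ j, I (a j) r₀ := fun j => (har _).2 ⟨j, rfl⟩
  -- the feet on `r₀` of the lines through a point off `r₀` coincide
  have foot : ∀ {q m n i j}, ¬ I q r₀ → I q m → I q n → I (a i) m → I (a j) n → i = j :=
    fun hq hm hn hi hj => ha (h.no_triangle hq (ha' _) (ha' _) hm hi hn hj).1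
  have hdis : ∃ r₁, ∀ q, I q r₀ → ¬ I q r₁ := by
    obtain ⟨g, hg, hgl⟩ := h.dual.exists_points_of_line (a 0)
    change ∀ m, I (a 0) m ↔ _ at hgl
    obtain ⟨n, hn, han⟩ : ∃ n, n ≠ r₀ ∧ I (a 0) n := by
      by_cases h0 : g 0 = r₀
      · exact ⟨g 1, fun h1 => absurd (hg (h0.trans h1.symm)) (by decide), (hgl _).2 ⟨_, rfl⟩⟩
      · exact ⟨g 0, h0, (hgl _).2 ⟨_, rfl⟩⟩
    obtain ⟨f, hf, hfl⟩ := h.exists_points_of_line n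
    obtain ⟨b, hb, hbn⟩ : ∃ b, b ≠ a 0 ∧ I b n := by
      by_cases h0 : f 0 = a 0
      · exact ⟨f 1, fun h1 => absurd (hf (h0.trans h1.symm)) (by decide), (hfl _).2 ⟨_, rfl⟩⟩
      · exact ⟨f 0, h0, (hfl _).2 ⟨_, rfl⟩⟩
    obtain ⟨k, hk, hkl⟩ := h.dual.exists_points_of_line b
    change ∀ m, I b m ↔ _ at hkl
    obtain ⟨m, hm, hbm⟩ : ∃ m, m ≠ n ∧ I b m := by
      by_cases h0 : k 0 = n
      · exact ⟨k 1, fun h1 => absurd (hk (h0.trans h1.symm)) (by decide), (hkl _).2 ⟨_, rfl⟩⟩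
      · exact ⟨k 0, h0, (hkl _).2 ⟨_, rfl⟩⟩
    have hbr : ¬ I b r₀ := fun hb0 => hb (h.point_unique n r₀ hn _ _ hbn hb0 han (ha' 0))
    exact ⟨m, fun q hq hqm => hm (h.no_triangle hbr hq (ha' 0) hbm hqm hbn han).2⟩
  obtain ⟨r₁, hr₁⟩ := hdis
  choose b c hac hbc hbr using fun j => h.exists_proj (hr₁ _ (ha' j))
  have hbr₀ : ∀ j, ¬ I (b j) r₀ := fun j hj => hr₁ _ hj (hbr j)
  have hab : ∀ j, a j ≠ b j := fun j e => hbr₀ j (e ▸ ha' j)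
  have hb : Function.Injective b := fun i j e =>
    foot (hbr₀ i) (hbc i) (e ▸ hbc j) (hac i) (hac j)
  choose d hda hdb hdc hc using fun j => h.exists_third_point (hab j) (hac j) (hbc j)
  have hc₀ : ∀ j, c j ≠ r₀ := fun j e => hbr₀ j (e ▸ hbc j)
  have hc₁ : ∀ j, c j ≠ r₁ := fun j e => hr₁ _ (ha' j) (e ▸ hac j)
  have hdr₀ : ∀ j, ¬ I (d j) r₀ := fun j hj =>
    hda j (h.point_unique _ _ (hc₀ j) _ _ (hdc j) hj (hac j) (ha' j))
  have hdr₁ : ∀ j, ¬ I (d j) r₁ := fun j hj =>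
    hdb j (h.point_unique _ _ (hc₁ j) _ _ (hdc j) hj (hbc j) (hbr j))
  have foot₁ : ∀ {q m n i j}, ¬ I q r₁ → I q m → I q n → I (b i) m → I (b j) n → i = j :=
    fun hq hm hn hi hj => hb (h.no_triangle hq (hbr _) (hbr _) hm hi hn hj).1
  have hd : Function.Injective d := fun i j e =>
    foot (hdr₀ i) (hdc i) (e ▸ hdc j) (hac i) (hac j)
  -- the line through `d 0` and `d 1`, and its third point `e`
  have hr₂ : ∃ r₂, ∀ j, I (d j) r₂ := by
    have hd01 : ¬ I (d 0) (c 1) := fun e =>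
      absurd (foot (hdr₀ 0) (hdc 0) e (hac 0) (hac 1)) (by decide)
    obtain ⟨q, r₂, h0, hq, hqc⟩ := h.exists_proj hd01
    have hq : I (d 1) r₂ := by
      rcases hc 1 q hqc with rfl | rfl | rfl
      · exact absurd (foot (hdr₀ 0) (hdc 0) h0 (hac 0) hq) (by decide)
      · exact absurd (foot₁ (hdr₁ 0) (hdc 0) h0 (hbc 0) hq) (by decide)
      · exact hq
    obtain ⟨e, he0, he1, her, he⟩ :=
      h.exists_third_point (hd.ne (by decide : (0 : Fin 3) ≠ 1)) h0 hq
    have ha2 : ¬ I (a 2) r₂ := fun e =>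
      absurd (foot (hdr₀ 0) (hdc 0) h0 (hac 0) e) (by decide)
    have hb2 : ¬ I (b 2) r₂ := fun e =>
      absurd (foot₁ (hdr₁ 0) (hdc 0) h0 (hbc 0) e) (by decide)
    have hae : ∃ m, I (a 2) m ∧ I e m := by
      obtain ⟨q, m, hm, hqm, hqr⟩ := h.exists_proj ha2
      rcases he q hqr with rfl | rfl | rfl
      · exact absurd (foot (hdr₀ 0) (hdc 0) hqm (hac 0) hm) (by decide)
      · exact absurd (foot (hdr₀ 1) (hdc 1) hqm (hac 1) hm) (by decide)
      · exact ⟨m, hm, hqm⟩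
    have hbe : ∃ m, I (b 2) m ∧ I e m := by
      obtain ⟨q, m, hm, hqm, hqr⟩ := h.exists_proj hb2
      rcases he q hqr with rfl | rfl | rfl
      · exact absurd (foot₁ (hdr₁ 0) (hdc 0) hqm (hbc 0) hm) (by decide)
      · exact absurd (foot₁ (hdr₁ 1) (hdc 1) hqm (hbc 1) hm) (by decide)
      · exact ⟨m, hm, hqm⟩
    obtain ⟨m, ham, hem⟩ := hae
    obtain ⟨n, hbn, hen⟩ := hbe
    have hec : I e (c 2) := by
      by_contra hec
      exact hab 2 (h.no_triangle hec (hac 2) (hbc 2) hem ham hen hbn).1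
    refine ⟨r₂, fun j => ?_⟩
    fin_cases j
    · exact h0
    · exact hq
    · rcases hc 2 e hec with rfl | rfl | rfl
      · exact absurd her ha2
      · exact absurd her hb2
      · exact her
  obtain ⟨r₂, hr₂⟩ := hr₂
  have hinj : ∀ i j i' j', ![a, b, d] i j = ![a, b, d] i' j' → i = i' ∧ j = j' := by
    have hI : ∀ i j, I (![a, b, d] i j) (c j) := by
      intro i j
      fin_cases i
      exacts [hac j, hbc j, hdc j]
    have hrow : ∀ i j j', ![a, b, d] i j = ![a, b, d] i j' → j = j' := by
      intro i
      fin_cases i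
      exacts [fun j j' e => ha e, fun j j' e => hb e, fun j j' e => hd e]
    have hcol : ∀ i i' j, ![a, b, d] i j = ![a, b, d] i' j → i = i' := by
      intro i i' j e
      fin_cases i <;> fin_cases i'
      exacts [rfl, absurd e (hab j), absurd e.symm (hda j), absurd e.symm (hab j), rfl,
        absurd e.symm (hdb j), absurd e (hda j), absurd e (hdb j), rfl]
    have hcinj : ∀ j j', c j = c j' → j = j' := fun j j' e =>
      foot (hbr₀ j) (hbc j) (hbc j) (hac j) (e ▸ hac j')
    intro i j i' j' e
    have hj : j = j' := by
      by_cases hir : I (![a, b, d] i j) r₀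
      · have h1 : ∀ i j, I (![a, b, d] i j) r₀ → i = 0 := by
          intro i j hi
          fin_cases i
          exacts [rfl, absurd hi (hbr₀ j), absurd hi (hdr₀ j)]
        obtain rfl := h1 _ _ hir
        obtain rfl := h1 i' j' (e ▸ hir)
        exact hrow _ _ _ e
      · exact foot hir (hI i j) (e ▸ hI i' j') (hac j) (hac j')
    subst hj
    exact ⟨hcol _ _ _ e, rfl⟩
  refine ⟨![r₀, r₁, r₂], c, ![a, b, d], hinj, fun i q => ?_, fun j q => ?_⟩
  · apply h.incident_iff_of_injective fun j j' e => (hinj _ _ _ _ e).2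
    intro j
    fin_cases i
    exacts [ha' j, hbr j, hr₂ j]
  · apply h.incident_iff_of_injective (f := fun i => ![a, b, d] i j)
      fun i i' e => (hinj _ _ _ _ e).1
    intro i
    fin_cases i
    exacts [hac j, hbc j, hdc j]

end IsGQ

/-- The six permutations of `ℤ/3`: the translations `x ↦ k + x` and the reflections
`x ↦ k - x`. -/
def affinePerm (σ : Fin 2 × Fin 3) (x : Fin 3) : Fin 3 :=
  if σ.1 = 0 then σ.2 + x else σ.2 - x

/-- The incidence relation of the generalized quadrangle of order two. Its points are the cells
`(i, j)` of a `3 × 3` grid and the permutations of `ℤ/3`; its lines are the rows `(0, i)` and the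
columns `(1, j)` of the grid, and for each cell a line through that cell and the two permutations
whose graph contains the cell. -/
def doilyInc : Fin 3 × Fin 3 ⊕ Fin 2 × Fin 3 → Fin 2 × Fin 3 ⊕ Fin 3 × Fin 3 → Bool
  | Sum.inl p, Sum.inl l => if l.1 = 0 then p.1 == l.2 else p.2 == l.2
  | Sum.inl p, Sum.inr q => p == q
  | Sum.inr _, Sum.inl _ => false
  | Sum.inr σ, Sum.inr q => affinePerm σ q.1 == q.2

theorem card_doilyInc_right (a : Fin 3 × Fin 3 ⊕ Fin 2 × Fin 3) :
    (Finset.univ.filter fun b => doilyInc a b = true).card = 3 := by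
  revert a
  decide +kernel

theorem affinePerm_injective (σ : Fin 2 × Fin 3) : Function.Injective (affinePerm σ) := by
  revert σ
  unfold Function.Injective
  decide

theorem affinePerm_inj {σ τ : Fin 2 × Fin 3} (h : ∀ i, affinePerm σ i = affinePerm τ i) :
    σ = τ := by
  revert σ τ
  decide

/-- A generalized quadrangle of order `(2, 2)` is unique. -/
theorem IsGQ.exists_doily_coordinates {P L : Type*} {I : P → L → Prop} (h : IsGQ I 2 2) :
    ∃ (f : Fin 3 × Fin 3 ⊕ Fin 2 × Fin 3 ≃ P) (g : Fin 2 × Fin 3 ⊕ Fin 3 × Fin 3 ≃ L),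
      ∀ a b, I (f a) (g b) ↔ doilyInc a b = true := by
  obtain ⟨r, c, p, hp, hr, hc⟩ := h.exists_grid
  have hpr : ∀ i j i', I (p i j) (r i') ↔ i = i' := by
    intro i j i'
    rw [hr]
    exact ⟨fun ⟨j', e⟩ => (hp _ _ _ _ e).1, fun e => ⟨j, e ▸ rfl⟩⟩
  have hpc : ∀ i j j', I (p i j) (c j') ↔ j = j' := by
    intro i j j'
    rw [hc]
    exact ⟨fun ⟨j', e⟩ => (hp _ _ _ _ e).2, fun e => ⟨i, e ▸ rfl⟩⟩
  have hrc : ∀ i j, r i ≠ c j := fun i j e =>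
    absurd ((hpc i (j + 1) j).1 (e ▸ (hpr i (j + 1) i).2 rfl)) (by clear e; revert j; decide)
  -- the third line on each cell of the grid
  have hg : ∀ i j, ∃ g, g ≠ r i ∧ g ≠ c j ∧ I (p i j) g ∧
      ∀ l, I (p i j) l → l = r i ∨ l = c j ∨ l = g := fun i j =>
    h.dual.exists_third_point (hrc i j) ((hpr i j i).2 rfl) ((hpc i j j).2 rfl)
  choose g hgr hgc hpg hg using hg
  have hcol : ∀ {i j i' j' l}, I (p i j) l → I (p i' j') l → i ≠ i' → j = j' := by
    intro i j i' j' l hl hl' hi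
    have h1 : ¬ I (p i' j') (r i) := fun e => hi ((hpr _ _ _).1 e).symm
    exact (hp _ _ _ _ (h.no_triangle h1 ((hpr i j i).2 rfl) ((hpr i j' i).2 rfl) hl' hl
      ((hpc i' j' j').2 rfl) ((hpc i j' j').2 rfl)).1).2
  have hpg' : ∀ i j i' j', I (p i j) (g i' j') → i = i' ∧ j = j' := by
    intro i j i' j' e
    by_cases hi : i = i'
    · subst hi
      by_contra hj
      exact hgr i j' (h.line_unique (p i j) (p i j') (fun e' => hj ⟨rfl, (hp _ _ _ _ e').2⟩)
        _ _ e (hpg i j') ((hpr _ _ _).2 rfl) ((hpr _ _ _).2 rfl))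
    · have hj := hcol e (hpg i' j') hi
      subst hj
      exact absurd (h.line_unique (p i j) (p i' j) (fun e' => hi (hp _ _ _ _ e').1)
        _ _ e (hpg i' j) ((hpc _ _ _).2 rfl) ((hpc _ _ _).2 rfl)) (hgc i' j)
  -- the point belonging to a permutation
  have hx : ∀ σ : Fin 2 × Fin 3, ∃ x, ∀ i, I x (g i (affinePerm σ i)) := by
    intro σ
    have hσ : ∀ {i j}, affinePerm σ i = affinePerm σ j → i = j := fun e => affinePerm_injective σ e
    have h01 : ¬ I (p 1 (affinePerm σ 1)) (g 0 (affinePerm σ 0)) := fun e =>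
      absurd (hpg' _ _ _ _ e).1 (by decide)
    obtain ⟨x, m, hm, hxm, hx0⟩ := h.exists_proj h01
    have hx1 : I x (g 1 (affinePerm σ 1)) := by
      rcases hg _ _ _ hm with rfl | rfl | rfl
      · obtain ⟨j, rfl⟩ := (hr _ _).1 hxm
        exact absurd (hpg' _ _ _ _ hx0).1 (by decide)
      · obtain ⟨i, rfl⟩ := (hc _ _).1 hxm
        exact absurd (hσ (hpg' _ _ _ _ hx0).2) (by decide)
      · exact hxm
    have hxp : ∀ i j, x ≠ p i j := by
      rintro i j rfl
      exact absurd ((hpg' _ _ _ _ hx0).1.symm.trans (hpg' _ _ _ _ hx1).1) (by decide)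
    have hxr : ¬ I x (r 2) := fun e => let ⟨j, hj⟩ := (hr _ _).1 e; hxp _ _ hj
    have hxc : ∀ j, ¬ I x (c j) := fun j e => let ⟨i, hi⟩ := (hc _ _).1 e; hxp _ _ hi
    obtain ⟨q, n, hxn, hqn, hqr⟩ := h.exists_proj hxr
    obtain ⟨j, rfl⟩ := (hr _ _).1 hqr
    have hne : ∀ i, i ≠ 2 → I x (g i (affinePerm σ i)) → j ≠ affinePerm σ i := by
      rintro i hi hxi rfl
      exact hi (hp _ _ _ _ (h.no_triangle (hxc (affinePerm σ i)) ((hpc i _ _).2 rfl)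
        ((hpc 2 _ _).2 rfl) hxi (hpg _ _) hxn hqn).1).1
    have hj : j = affinePerm σ 2 := by
      have h0 := hne 0 (by decide) hx0
      have h1 := hne 1 (by decide) hx1
      clear hne hx0 hx1 h01 hm hqn hqr hσ
      revert σ j
      decide
    have hx2 : I x (g 2 (affinePerm σ 2)) := by
      subst hj
      rcases hg _ _ _ hqn with rfl | rfl | rfl
      · exact absurd hxn hxr
      · exact absurd hxn (hxc _)
      · exact hxn
    refine ⟨x, fun i => ?_⟩
    fin_cases i
    exacts [hx0, hx1, hx2]
  choose x hx using hx
  have hxr : ∀ σ i, ¬ I (x σ) (r i) := by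
    intro σ i e
    obtain ⟨j, hj⟩ := (hr _ _).1 e
    have h0 := (hpg' i j 0 _ (hj ▸ hx σ 0)).1
    have h1 := (hpg' i j 1 _ (hj ▸ hx σ 1)).1
    exact absurd (h0.symm.trans h1) (by decide)
  let f : Fin 3 × Fin 3 ⊕ Fin 2 × Fin 3 → P := Sum.elim (fun a => p a.1 a.2) x
  let k : Fin 2 × Fin 3 ⊕ Fin 3 × Fin 3 → L :=
    Sum.elim (fun a => if a.1 = 0 then r a.2 else c a.2) fun a => g a.1 a.2
  have hfk : ∀ a b, doilyInc a b = true → I (f a) (k b) := by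
    rintro (⟨i, j⟩ | σ) (⟨ε, i'⟩ | ⟨i', j'⟩) hab
    · by_cases hε : ε = 0
      · simp only [doilyInc, hε, if_true, beq_iff_eq] at hab
        simp [f, k, hε, hpr, hab]
      · simp only [doilyInc, hε, if_false, beq_iff_eq] at hab
        simp [f, k, hε, hpc, hab]
    · simp only [doilyInc, beq_iff_eq, Prod.mk.injEq] at hab
      simp [f, k, hpg, hab]
    · simp [doilyInc] at hab
    · simp only [doilyInc, beq_iff_eq] at hab
      simp [f, k, ← hab, hx]
  have hgr' : ∀ i j i', g i j ≠ r i' := by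
    intro i j i' e
    obtain rfl := (hpr i j i').1 (e ▸ hpg i j)
    exact hgr i j e
  have hgc' : ∀ i j j', g i j ≠ c j' := by
    intro i j j' e
    obtain rfl := (hpc i j j').1 (e ▸ hpg i j)
    exact hgc i j e
  have hkinj : Function.Injective k := by
    rintro (⟨ε, i⟩ | ⟨i, j⟩) (⟨ε', i'⟩ | ⟨i', j'⟩) e
    · by_cases hε : ε = 0 <;> by_cases hε' : ε' = 0
      · simp only [k, Sum.elim_inl, hε, hε', if_true] at e
        rw [hε, hε', (hpr i 0 i').1 (e ▸ (hpr i 0 i).2 rfl)]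
      · simp only [k, Sum.elim_inl, hε, hε', if_true, if_false] at e
        exact absurd e (hrc _ _)
      · simp only [k, Sum.elim_inl, hε, hε', if_true, if_false] at e
        exact absurd e.symm (hrc _ _)
      · simp only [k, Sum.elim_inl, hε, hε', if_false] at e
        have : ε = ε' := by omega
        rw [this, (hpc 0 i i').1 (e ▸ (hpc 0 i i).2 rfl)]
    · simp only [k, Sum.elim_inl, Sum.elim_inr] at e
      split_ifs at e
      exacts [absurd e.symm (hgr' _ _ _), absurd e.symm (hgc' _ _ _)]
    · simp only [k, Sum.elim_inl, Sum.elim_inr] at e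
      split_ifs at e
      exacts [absurd e (hgr' _ _ _), absurd e (hgc' _ _ _)]
    · simp only [k, Sum.elim_inr] at e
      have := hpg' i j i' j' (e ▸ hpg i j)
      rw [this.1, this.2]
  have hfinj : Function.Injective f := by
    rintro (⟨i, j⟩ | σ) (⟨i', j'⟩ | τ) e
    · have := hp i j i' j' e
      rw [this.1, this.2]
    · have e : p i j = x τ := e
      exact absurd (e ▸ (hpr i j i).2 rfl) (hxr τ i)
    · have e : x σ = p i' j' := e
      exact absurd (e ▸ (hpr i' j' i').2 rfl) (hxr σ i')
    · have e : x σ = x τ := e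
      refine congrArg Sum.inr (affinePerm_inj fun i => ?_)
      exact (hp _ _ _ _ (h.no_triangle (hxr σ i) ((hpr i _ i).2 rfl) ((hpr i _ i).2 rfl)
        (hx σ i) (hpg _ _) (e ▸ hx τ i) (hpg _ _)).1).2
  have := h.finite_points
  have := h.finite_lines
  have := Fintype.ofFinite P
  have := Fintype.ofFinite L
  have hf : Function.Bijective f := by
    rw [Fintype.bijective_iff_injective_and_card, ← Nat.card_eq_fintype_card (α := P),
      h.card_points]
    exact ⟨hfinj, by simp⟩
  have hk : Function.Bijective k := by
    rw [Fintype.bijective_iff_injective_and_card, ← Nat.card_eq_fintype_card (α := L),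
      h.card_lines]
    exact ⟨hkinj, by simp⟩
  refine ⟨Equiv.ofBijective f hf, Equiv.ofBijective k hk, fun a b => ⟨fun hab => ?_, hfk a b⟩⟩
  -- the three lines of the model through `a` are all the lines on its image
  have h1 : {b | doilyInc a b = true} = k ⁻¹' {l | I (f a) l} := by
    refine Set.eq_of_subset_of_ncard_le (fun b hb => hfk a b hb) ?_ (Set.toFinite _)
    rw [Set.ncard_preimage_of_injective_subset_range hkinj
      (by rw [hk.surjective.range_eq]; exact Set.subset_univ _), h.lines_on_point]
    refine (card_doilyInc_right a).ge.trans ?_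
    rw [← Set.ncard_coe_finset]
    simp
  exact h1.symm.subset hab

/-! ### The flags of the generalized quadrangle of order two as edges of `K₁₀` -/

/-- The flags of the generalized quadrangle of order two: `(c, i, j)` with `c < 3` is the flag of
the cell `(i, j)` with its row, its column or its third line, for `c = 0, 1, 2`, and `(3 + ε, k, i)`
is the flag of the permutation `(ε, k)` with the line of its cell in row `i`. -/
abbrev DoilyFlag : Type := Fin 5 × Fin 3 × Fin 3

/-- The point of a flag. -/
def doilyFlagPoint (x : DoilyFlag) : Fin 3 × Fin 3 ⊕ Fin 2 × Fin 3 :=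
  if x.1.val < 3 then Sum.inl x.2 else Sum.inr (if x.1.val = 3 then 0 else 1, x.2.1)

/-- The line of a flag. -/
def doilyFlagLine (x : DoilyFlag) : Fin 2 × Fin 3 ⊕ Fin 3 × Fin 3 :=
  match x.1.val with
  | 0 => Sum.inl (0, x.2.1)
  | 1 => Sum.inl (1, x.2.2)
  | 2 => Sum.inr x.2
  | 3 => Sum.inr (x.2.2, affinePerm (0, x.2.1) x.2.2)
  | _ => Sum.inr (x.2.2, affinePerm (1, x.2.1) x.2.2)

/-- Collinearity of points. -/
def doilyCollinear : Fin 3 × Fin 3 ⊕ Fin 2 × Fin 3 → Fin 3 × Fin 3 ⊕ Fin 2 × Fin 3 → Bool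
  | Sum.inl p, Sum.inl q => p.1 == q.1 || p.2 == q.2
  | Sum.inl p, Sum.inr σ => affinePerm σ p.1 == p.2
  | Sum.inr σ, Sum.inl p => affinePerm σ p.1 == p.2
  | Sum.inr σ, Sum.inr τ => σ.1 != τ.1 || σ.2 == τ.2

/-- Concurrency of lines. -/
def doilyConcurrent : Fin 2 × Fin 3 ⊕ Fin 3 × Fin 3 → Fin 2 × Fin 3 ⊕ Fin 3 × Fin 3 → Bool
  | Sum.inl l, Sum.inl m => l.1 != m.1 || l.2 == m.2
  | Sum.inl l, Sum.inr q => if l.1 = 0 then l.2 == q.1 else l.2 == q.2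
  | Sum.inr q, Sum.inl l => if l.1 = 0 then l.2 == q.1 else l.2 == q.2
  | Sum.inr p, Sum.inr q => (p.1 == q.1) == (p.2 == q.2)

theorem doilyCollinear_iff : ∀ p q, doilyCollinear p q = true ↔
    ∃ l, doilyInc p l = true ∧ doilyInc q l = true := by
  decide +kernel

theorem doilyConcurrent_iff : ∀ l m, doilyConcurrent l m = true ↔
    ∃ p, doilyInc p l = true ∧ doilyInc p m = true := by
  decide +kernel

theorem doilyInc_flag : ∀ x, doilyInc (doilyFlagPoint x) (doilyFlagLine x) = true := by
  decide +kernel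

/-- The relation `R₃ ∪ R₄` on the flags. -/
def doilyAdj (x y : DoilyFlag) : Bool :=
  decide (doilyFlagPoint x ≠ doilyFlagPoint y) && decide (doilyFlagLine x ≠ doilyFlagLine y) &&
    (doilyInc (doilyFlagPoint x) (doilyFlagLine y) || doilyInc (doilyFlagPoint y) (doilyFlagLine x))

/-- The edge of the complete graph on `{0, …, 9}` belonging to a flag. The vertex `1 + 3i + j`
stands for the cell `(i, j)`. To a cell with its row belongs the edge between the other two cells
of its column, to a cell with its column the edge between the other two cells of its row, to a cell
with its third line the edge between that cell and the vertex `0`, and to a permutation `σ` with its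
cell in row `i` the edge between the two cells that complete the other two cells of `σ` to a
rectangle. -/
def doilyEdge (x : DoilyFlag) : ℕ × ℕ :=
  let cell (i j : Fin 3) : ℕ := 1 + 3 * i.val + j.val
  match x.1.val with
  | 0 => (cell (x.2.1 + 1) x.2.2, cell (x.2.1 + 2) x.2.2)
  | 1 => (cell x.2.1 (x.2.2 + 1), cell x.2.1 (x.2.2 + 2))
  | 2 => (0, cell x.2.1 x.2.2)
  | 3 => (cell (x.2.2 + 1) (affinePerm (0, x.2.1) (x.2.2 + 2)),
      cell (x.2.2 + 2) (affinePerm (0, x.2.1) (x.2.2 + 1)))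
  | _ => (cell (x.2.2 + 1) (affinePerm (1, x.2.1) (x.2.2 + 2)),
      cell (x.2.2 + 2) (affinePerm (1, x.2.1) (x.2.2 + 1)))

/-- Incidence of a vertex and an edge of the complete graph. -/
def onEdge (u : ℕ) (e : ℕ × ℕ) : Bool := u == e.1 || u == e.2

/-- The edges of the two flags share exactly one vertex. This is the relation `R₅ ∪ R₆`. -/
def doilyMeet (x y : DoilyFlag) : Bool :=
  onEdge (doilyEdge x).1 (doilyEdge y) != onEdge (doilyEdge x).2 (doilyEdge y)

theorem doilyMeet_iff : ∀ x y, doilyMeet x y = true ↔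
    doilyInc (doilyFlagPoint y) (doilyFlagLine x) = false ∧
    doilyInc (doilyFlagPoint x) (doilyFlagLine y) = false ∧
    (doilyCollinear (doilyFlagPoint x) (doilyFlagPoint y) = true ∨
      doilyConcurrent (doilyFlagLine x) (doilyFlagLine y) = true) := by
  decide +kernel

theorem eq_of_doilyFlag : ∀ x y, doilyFlagPoint x = doilyFlagPoint y →
    doilyFlagLine x = doilyFlagLine y → x = y := by
  decide +kernel

/-- Coordinates for the flags of a generalized quadrangle of order two. -/
theorem IsGQ.exists_flag_coordinates {P L : Type*} {I : P → L → Prop} (h : IsGQ I 2 2) :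
    ∃ e : DoilyFlag ≃ IncFlag I, ∀ x y,
      (classRel I {3, 4} (e x) (e y) ↔ doilyAdj x y = true) ∧
      (classRel I {5, 6} (e x) (e y) ↔ doilyMeet x y = true) := by
  obtain ⟨f, g, hfg⟩ := h.exists_doily_coordinates
  have := h.finite_flags
  have := Fintype.ofFinite (IncFlag I)
  let k : DoilyFlag → IncFlag I := fun x =>
    ⟨(f (doilyFlagPoint x), g (doilyFlagLine x)), (hfg _ _).2 (doilyInc_flag x)⟩
  have hk : Function.Bijective k := by
    rw [Fintype.bijective_iff_injective_and_card, ← Nat.card_eq_fintype_card (α := IncFlag I),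
      h.card_flags]
    refine ⟨fun x y e => ?_, by simp⟩
    simp only [k, Subtype.mk.injEq, Prod.mk.injEq, EmbeddingLike.apply_eq_iff_eq] at e
    exact eq_of_doilyFlag x y e.1 e.2
  refine ⟨Equiv.ofBijective k hk, fun x y => ⟨?_, ?_⟩⟩
  · simp only [classRel, Finset.mem_insert, Finset.mem_singleton, exists_eq_or_imp, exists_eq_left,
      flagRel, Equiv.ofBijective_apply, k, hfg, ne_eq, EmbeddingLike.apply_eq_iff_eq, doilyAdj,
      Bool.and_eq_true, Bool.or_eq_true, decide_eq_true_eq]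
    tauto
  · simp only [classRel, Finset.mem_insert, Finset.mem_singleton, exists_eq_or_imp, exists_eq_left,
      h.flagRel_five_iff, h.flagRel_six_iff, Equiv.ofBijective_apply, k, hfg, doilyMeet_iff,
      doilyCollinear_iff, doilyConcurrent_iff, Bool.not_eq_true, f.surjective.exists,
      g.surjective.exists, and_or_left]

/-! ### The partial geometry on the flags -/

/-- The seven involutions fixing `0` in a copy of `PSL(2, 8)` that acts on `ℤ/9`, viewed as the
projective line over the field with eight elements, and contains the translations. -/
def blockInvolution : List (List ℕ) :=
  [[0, 2, 1, 5, 6, 3, 4, 8, 7], [0, 3, 5, 1, 7, 2, 8, 4, 6], [0, 4, 6, 7, 1, 8, 2, 3, 5],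
    [0, 5, 3, 2, 8, 1, 7, 6, 4], [0, 6, 4, 8, 2, 7, 1, 5, 3], [0, 7, 8, 4, 3, 6, 5, 1, 2],
    [0, 8, 7, 6, 5, 4, 3, 2, 1]]

/-- The `63` perfect matchings of the complete graph on `ℤ/9 ∪ {∞}`, with `9` for `∞`: the matching
`(k, r)` joins `r` to `∞` and is given on the rest by the translate by `r` of the `k`-th
involution. These are the `63` involutions of `PSL(2, 8)`, and since this group is sharply
3-transitive, two disjoint edges are in exactly one of the matchings. -/
def blockMate (b : Fin 7 × Fin 9) (u : ℕ) : ℕ :=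
  if u = 9 then b.2.val else if u = b.2.val then 9 else
    (b.2.val + (blockInvolution.getD b.1.val []).getD ((u + 9 - b.2.val) % 9) 0) % 9

/-- A flag is on a line of the partial geometry when its edge belongs to the matching. -/
def blockInc (x : DoilyFlag) (b : Fin 7 × Fin 9) : Bool :=
  blockMate b (doilyEdge x).1 == (doilyEdge x).2

theorem card_blockInc_right : ∀ x y,
    (Finset.univ.filter fun b => blockInc x b = true ∧ blockInc y b = true).card =
      if x = y then 7 else if doilyMeet x y = true then 0 else 1 := by
  decide +kernel

theorem card_blockInc_left : ∀ b, (Finset.univ.filter fun x => blockInc x b = true).card = 5 := by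
  decide +kernel

theorem card_blockInc_antiflag : ∀ x b, blockInc x b = false →
    (Finset.univ.filter fun y => blockInc y b = true ∧ doilyMeet x y = false).card = 3 := by
  decide +kernel

theorem ncard_blockInc (x y : DoilyFlag) :
    {b | blockInc x b = true ∧ blockInc y b = true}.ncard =
      if x = y then 7 else if doilyMeet x y = true then 0 else 1 := by
  rw [← card_blockInc_right, ← Set.ncard_coe_finset]
  simp

theorem exists_blockInc_iff {x y : DoilyFlag} (hxy : x ≠ y) :
    (∃ b, blockInc x b = true ∧ blockInc y b = true) ↔ doilyMeet x y = false := by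
  have h := ncard_blockInc x y
  rw [if_neg hxy] at h
  by_cases hm : doilyMeet x y = true
  · rw [if_pos hm, Set.ncard_eq_zero (Set.toFinite _)] at h
    simp only [hm, Bool.true_eq_false, iff_false]
    rintro ⟨b, hb⟩
    exact (h ▸ hb : b ∈ (∅ : Set _))
  · rw [if_neg hm] at h
    simp only [Bool.not_eq_true] at hm
    simp only [hm, iff_true]
    have h1 : {b | blockInc x b = true ∧ blockInc y b = true}.Nonempty :=
      Set.nonempty_of_ncard_ne_zero (by rw [h]; decide)
    exact h1

theorem eq_of_blockInc {x y : DoilyFlag} (hxy : x ≠ y) {b c : Fin 7 × Fin 9}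
    (hb : blockInc x b = true ∧ blockInc y b = true)
    (hc : blockInc x c = true ∧ blockInc y c = true) : b = c := by
  have h := ncard_blockInc x y
  have h1 := (exists_blockInc_iff hxy).1 ⟨b, hb⟩
  rw [if_neg hxy, h1, if_neg Bool.false_ne_true] at h
  exact (Set.ncard_le_one (Set.toFinite _)).1 h.le b hb c hc

/-- The partial geometry whose points are the edges of `K₁₀`, or the flags. -/
theorem isPartialGeometry_blockInc :
    IsPartialGeometry (fun x b => blockInc x b = true) 4 6 3 where
  finite_points := inferInstance
  finite_lines := inferInstance
  nonempty_points := inferInstance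
  nonempty_lines := inferInstance
  lines_on_point x := by simpa using ncard_blockInc x x
  line_unique x y hxy b c h1 h2 h3 h4 := eq_of_blockInc hxy ⟨h1, h2⟩ ⟨h3, h4⟩
  points_on_line b := by
    refine Eq.trans ?_ (card_blockInc_left b)
    rw [← Set.ncard_coe_finset]
    simp
  antiflag x b hxb := by
    have h1 := card_blockInc_antiflag x b (by simpa using hxb)
    rw [← Set.ncard_coe_finset] at h1
    refine Eq.trans ?_ h1
    have hne : ∀ {y}, blockInc y b = true → x ≠ y := by
      rintro y hy rfl
      exact hxb hy
    refine Set.ncard_congr (fun z _ => z.1) ?_ ?_ ?_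
    · rintro ⟨y, c⟩ ⟨hx, hy, hb⟩
      simpa using ⟨hb, (exists_blockInc_iff (hne hb)).1 ⟨c, hx, hy⟩⟩
    · rintro ⟨y, c⟩ ⟨y', c'⟩ ⟨hx, hy, hb⟩ ⟨hx', hy', hb'⟩ (rfl : y = y')
      exact Prod.ext rfl (eq_of_blockInc (hne hb) ⟨hx, hy⟩ ⟨hx', hy'⟩)
    · intro y hy
      simp only [Finset.coe_filter, Finset.mem_univ, true_and, Set.mem_ofPred_eq] at hy
      obtain ⟨c, hx, hyc⟩ := (exists_blockInc_iff (hne hy.1)).2 hy.2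
      exact ⟨(y, c), ⟨hx, hyc, hy.1⟩, rfl⟩

theorem IsPartialGeometry.comap {P Q L : Type*} {J : P → L → Prop} {s t α : ℕ}
    (h : IsPartialGeometry J s t α) (e : Q ≃ P) :
    IsPartialGeometry (fun x b => J (e x) b) s t α where
  finite_points := have := h.finite_points; Finite.of_equiv P e.symm
  finite_lines := h.finite_lines
  nonempty_points := have := h.nonempty_points; e.nonempty
  nonempty_lines := h.nonempty_lines
  lines_on_point x := h.lines_on_point (e x)
  line_unique x y hxy := h.line_unique _ _ (e.injective.ne hxy)
  points_on_line b := by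
    rw [← h.points_on_line b]
    exact Set.ncard_preimage_of_injective_subset_range (s := {p | J p b}) e.injective (by simp)
  antiflag x b hxb := by
    rw [← h.antiflag (e x) b hxb]
    exact Set.ncard_preimage_of_injective_subset_range (f := Prod.map e id)
      (s := {z | J (e x) z.2 ∧ J z.1 z.2 ∧ J z.1 b}) (e.injective.prodMap Function.injective_id)
      (by simp [(e.surjective.prodMap Function.surjective_id).range_eq])

theorem IsGQ.exists_isPartialGeometry {P L : Type*} {I : P → L → Prop} (h : IsGQ I 2 2) :
    ∃ (B : Type) (J : IncFlag I → B → Prop), IsPartialGeometry J 4 6 3 ∧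
      ∀ x y, classRel I {1, 2, 3, 4, 7} x y ↔ (pointGraph J).Adj x y := by
  obtain ⟨e, he⟩ := h.exists_flag_coordinates
  refine ⟨Fin 7 × Fin 9, fun x b => blockInc (e.symm x) b = true,
    isPartialGeometry_blockInc.comap e.symm, fun x y => ?_⟩
  obtain ⟨x, rfl⟩ := e.surjective x
  obtain ⟨y, rfl⟩ := e.surjective y
  have h1 : classRel I {1, 2, 3, 4, 7} (e x) (e y) ↔
      ¬ classRel I {0} (e x) (e y) ∧ ¬ classRel I {5, 6} (e x) (e y) := by
    obtain ⟨k, hk, -⟩ := h.existsUnique_flagRel (e x) (e y)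
    simp only [h.classRel_iff_mem hk]
    clear hk
    revert k
    decide
  have h0 : classRel I {0} (e x) (e y) ↔ x = y := by
    rw [classRel_singleton, ← e.injective.eq_iff]
    rfl
  simp only [pointGraph, h1, h0, (he x y).2, Equiv.symm_apply_apply, ne_eq, Bool.not_eq_true,
    e.injective.eq_iff]
  exact and_congr_right fun hxy => (exists_blockInc_iff hxy).symm

/-! ### The Gewirtz graph -/

/-- Adjacency in the Gewirtz graph, on a vertex `none`, its neighbours `0, …, 9` and the flags of
the generalized quadrangle of order two: a flag is adjacent to the two ends of its edge, and two
flags are adjacent when they are in `R₃ ∪ R₄`. -/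
def gewirtzAdj : Option (Fin 10 ⊕ DoilyFlag) → Option (Fin 10 ⊕ DoilyFlag) → Bool
  | none, some (Sum.inl _) => true
  | some (Sum.inl _), none => true
  | some (Sum.inl u), some (Sum.inr x) => onEdge u.val (doilyEdge x)
  | some (Sum.inr x), some (Sum.inl u) => onEdge u.val (doilyEdge x)
  | some (Sum.inr x), some (Sum.inr y) => doilyAdj x y
  | _, _ => false

/-- The Gewirtz graph. -/
def gewirtzGraph : SimpleGraph (Option (Fin 10 ⊕ DoilyFlag)) where
  Adj v w := gewirtzAdj v w = true
  symm := ⟨by decide +kernel⟩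
  loopless := ⟨by decide +kernel⟩

theorem card_gewirtzAdj : ∀ v w,
    (Finset.univ.filter fun u => gewirtzAdj v u = true ∧ gewirtzAdj u w = true).card =
      if v = w then 10 else if gewirtzAdj v w = true then 0 else 2 := by
  decide +kernel

theorem ncard_gewirtzAdj (v w : Option (Fin 10 ⊕ DoilyFlag)) :
    {u | gewirtzGraph.Adj v u ∧ gewirtzGraph.Adj u w}.ncard =
      if v = w then 10 else if gewirtzAdj v w = true then 0 else 2 := by
  rw [← card_gewirtzAdj, ← Set.ncard_coe_finset]
  simp [gewirtzGraph]

theorem isGewirtz_gewirtzGraph (e : Fin 56 ≃ Option (Fin 10 ⊕ DoilyFlag)) :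
    IsGewirtz (gewirtzGraph.comap e) := by
  have : DecidableRel (gewirtzGraph.comap e).Adj := fun v w =>
    inferInstanceAs (Decidable (gewirtzAdj (e v) (e w) = true))
  refine ⟨this, isSRGWith_comap_of_ncard gewirtzGraph e (fun v => ?_) (fun v w h => ?_)
      fun v w hvw h => ?_⟩
  · have h1 := ncard_gewirtzAdj v v
    rw [if_pos rfl] at h1
    refine Eq.trans (congrArg Set.ncard ?_) h1
    ext u
    exact ⟨fun h => ⟨h, h.symm⟩, fun h => h.1⟩
  · rw [ncard_gewirtzAdj, if_neg h.ne]
    exact if_pos h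
  · rw [ncard_gewirtzAdj, if_neg hvw]
    exact if_neg h

/-- The coefficients count the common neighbours of two flags among the flags. -/
theorem blockCoeff_three_four (k : Fin 8) :
    blockCoeff 2 2 {3, 4} {3, 4} k = ![8, 2, 2, 0, 0, 1, 1, 2] k := by
  revert k
  decide +kernel

theorem IsGQ.isGewirtzSubconstituent {P L : Type*} {I : P → L → Prop} (h : IsGQ I 2 2) :
    IsGewirtzSubconstituent (classRel I {3, 4}) (classRel I {5, 6}) (classRel I {1, 2, 7}) := by
  obtain ⟨e, he⟩ := h.exists_flag_coordinates
  let ε : Fin 56 ≃ Option (Fin 10 ⊕ DoilyFlag) := (Fintype.equivFinOfCardEq (by simp)).symm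
  let G := gewirtzGraph.comap ε
  let v : Fin 56 := ε.symm none
  have hmem : ∀ x, ε.symm (some (Sum.inr x)) ≠ v ∧ ¬ G.Adj v (ε.symm (some (Sum.inr x))) := by
    intro x
    simp [v, G, gewirtzGraph, gewirtzAdj]
  let f : IncFlag I → SecondSubconstituent G v := fun x =>
    ⟨ε.symm (some (Sum.inr (e.symm x))), hmem _⟩
  have hf : Function.Bijective f := by
    refine ⟨fun x y hxy => ?_, ?_⟩
    · simpa [f] using hxy
    · rintro ⟨w, hw⟩
      obtain ⟨w, rfl⟩ := ε.symm.surjective w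
      rcases w with _ | u | x
      · exact absurd rfl hw.1
      · exact absurd (by simp [v, G, gewirtzGraph, gewirtzAdj]) hw.2
      · exact ⟨e x, by simp [f]⟩
  have hadj : ∀ x y, G.Adj (f x).1 (f y).1 ↔ classRel I {3, 4} x y := by
    intro x y
    have := (he (e.symm x) (e.symm y)).1
    rw [e.apply_symm_apply, e.apply_symm_apply] at this
    rw [this]
    simp [f, G, gewirtzGraph, gewirtzAdj]
  have hcount : ∀ x y k, flagRel I k x y →
      {z : SecondSubconstituent G v | G.Adj (f x).1 z.1 ∧ G.Adj z.1 (f y).1}.ncard =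
        ![8, 2, 2, 0, 0, 1, 1, 2] k := by
    intro x y k hk
    rw [← blockCoeff_three_four, ← h.ncard_classRel {3, 4} {3, 4} hk,
      ← Set.ncard_preimage_of_injective_subset_range hf.1
        (by rw [hf.2.range_eq]; exact Set.subset_univ _)]
    simp only [Set.preimage_ofPred_eq, hadj]
  refine ⟨G, v, Equiv.ofBijective f hf, isGewirtz_gewirtzGraph ε, fun x y => ?_⟩
  obtain ⟨k, hk, -⟩ := h.existsUnique_flagRel x y
  have h0 : x = y ↔ k ∈ ({0} : Finset (Fin 8)) := by
    rw [← h.classRel_iff_mem hk, classRel_singleton]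
    rfl
  simp only [Equiv.ofBijective_apply, hcount x y k hk, hadj, ne_eq, h0, h.classRel_iff_mem hk]
  clear hk h0
  revert k
  decide

/-! ### The fusions and their identification -/

/-- No non-trivial fusion keeps both `R₃` and its converse `R₄`. -/
theorem InFusionTable.not_singleton_three_four {s t : ℕ} {Λ : Finset (Finset (Fin 8))}
    (h : InFusionTable s t Λ) : ¬ ({3} ∈ Λ ∧ {4} ∈ Λ) := by
  rcases h with h | h | h | h | h | h | h | h | h | h | h | h | h | h
  all_goals first
    | (rw [h]; decide)
    | (rw [h.1]; decide)

theorem singleton_mem_dualBlocks {Λ : Finset (Finset (Fin 8))} {i : Fin 8} (h : {i} ∈ Λ) :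
    {dualIndex i} ∈ dualBlocks Λ :=
  Finset.mem_image.2 ⟨{i}, h, Finset.image_singleton _ _⟩

theorem mainTheorem6 {P L : Type*} (I : P → L → Prop) (s t : ℕ) (hs : 1 ≤ s) (ht : 1 ≤ t)
    (hst : (s, t) ≠ (1, 1)) (hI : IsGQ I s t) :
    -- the fusions, up to point-line duality
    (∀ π : Finpartition ({0}ᶜ : Finset (Fin 8)),
      IsFusion I π ↔ InFusionTable s t π.parts ∨ InFusionTable t s (dualBlocks π.parts)) ∧
    (∀ π : Finpartition ({0}ᶜ : Finset (Fin 8)),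
      IsFusion I π → ¬ ({3} ∈ π.parts ∧ {4} ∈ π.parts)) ∧
    -- the fusions with two classes
    (s = 2 → t = 2 → ∃ (B : Type) (J : IncFlag I → B → Prop),
      IsPartialGeometry J 4 6 3 ∧
        ∀ x y, classRel I {1, 2, 3, 4, 7} x y ↔ (pointGraph J).Adj x y) ∧
    (t = 1 → Nonempty (classRel I {2, 5, 7} ≃r (disjointCompletes 2 ((s + 1) ^ 2)).Adj)) ∧
    (t = 1 → Nonempty (classRel I {5} ≃r (disjointCompletes (2 * (s + 1)) (s + 1)).Adj)) ∧
    Nonempty (classRel I {1} ≃r (disjointCompletes ((s * t + 1) * (s + 1)) (t + 1)).Adj) ∧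
    -- the fusions with three classes
    (s = 2 → t = 2 →
      IsGewirtzSubconstituent (classRel I {3, 4}) (classRel I {5, 6}) (classRel I {1, 2, 7})) ∧
    (s = 3 → t = 1 → IsDistanceScheme (halvedCube 6)
      (classRel I {2, 5, 6}) (classRel I {3, 4, 7}) (classRel I {1})) ∧
    (s = 3 → t = 1 → IsDistanceScheme (foldedCube 5)
      (classRel I {3, 4}) (classRel I {2, 5, 7}) (classRel I {1, 6})) ∧
    (t = 1 → IsRectangular 2 ((s + 1) ^ 2)
      (classRel I {2, 5, 7}) (classRel I {1}) (classRel I {3, 4, 6})) ∧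
    (t = 1 → IsDisjointHamming 2 (s + 1)
      (classRel I {2, 5}) (classRel I {7}) (classRel I {1, 3, 4, 6})) ∧
    (t = 1 → IsSRGTensorJ (2 * (s + 1)) (s + 1) 0 (s + 1) (s + 1)
      (classRel I {1, 3, 4, 6}) (classRel I {2, 7}) (classRel I {5})) ∧
    IsSRGTensorJ ((s * t + 1) * (s + 1)) (s * (t + 1)) (s - 1) (t + 1) (t + 1)
      (classRel I {2, 3, 4, 5}) (classRel I {6, 7}) (classRel I {1}) ∧
    -- the fusion with four classes that exists for equal parameters
    (s = t → ∀ x y, classRel I {1, 2} x y ↔ (pointGraph (dualInc (doubleInc I))).Adj x y) := by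
  refine ⟨hI.isFusion_iff_inFusionTable hs ht hst, fun π hπ h34 => ?_, ?_, ?_, ?_,
    hI.classRel_one_iso, ?_, ?_, ?_, ?_, ?_, ?_, hI.isSRGTensorJ_pointGraph hs ht,
    fun _ => classRel_one_two_iff I⟩
  · rcases (hI.isFusion_iff_inFusionTable hs ht hst π).1 hπ with h | h
    · exact h.not_singleton_three_four h34
    · exact h.not_singleton_three_four
        ⟨singleton_mem_dualBlocks h34.2, singleton_mem_dualBlocks h34.1⟩
  · rintro rfl rfl
    exact hI.exists_isPartialGeometry
  · rintro rfl
    exact hI.two_five_seven_iso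
  · rintro rfl
    exact hI.five_iso
  · rintro rfl rfl
    exact hI.isGewirtzSubconstituent
  · rintro rfl rfl
    exact hI.isDistanceScheme_halvedCube
  · rintro rfl rfl
    exact hI.isDistanceScheme_foldedCube
  · rintro rfl
    exact hI.isRectangular
  · rintro rfl
    exact hI.isDisjointHamming
  · rintro rfl
    exact hI.isSRGTensorJ_lines
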